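/- Let $n\ge 1$, $N=2n$, and write $i'=N-i+1$. Let $R_{\mathbb Z/N}$ be the algebra of complex upper triangular matrices $M=(M_{ij})_{i,j\in\mathbb Z}$ commuting with $S^N$, where $S_{ij}=\delta_{i,j-1}$ (i.e. $M_{i+N,j+N}=M_{ij}$), and let $\mathcal M_N=R_{\mathbb Z/N}/\langle S^N\rangle$. Put $\varepsilon_i=1$ for $i\equiv 1,\dots,n$ and $\varepsilon_i=-1$ for $i\equiv n+1,\dots,N \pmod N$, and $(M^\dagger)_{ij}=\varepsilon_i\varepsilon_j M_{N-j+1,N-i+1}$. Let $R^{\mathrm i}_{\mathbb Z/N}$ (resp. $R^{\mathrm c}_{\mathbb Z/N}$) be the set of $M\in R_{\mathbb Z/N}$ with $M=-M^\dagger$ (resp. $M=M^\dagger$). For $\mathrm a\in\{\mathrm i,\mathrm c\}$ let $\mathcal M^{\mathrm a}_N\subset\mathcal M_N$ be the image of $R^{\mathrm a}_{\mathbb Z/N}$ and $$E^{\mathrm a}_N=\{M\in\mathcal M^{\mathrm a}_N : M^2=0,\ M_{ii}=0\ \forall i\}.$$ For $M\in E^{\mathrm a}_N$ let $\mathcal U$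 be the upper triangular $N\times N$ block $(M_{ij})_{1\le i,j\le N}$. Let $J=(\delta_{i,j'}\varepsilon_i)_{1\le i,j\le N}$, and let $\tilde B_N$ be the group of invertible upper triangular $U\in GL_N(\mathbb C)$ with $U^{-1}=J^{-1}U^TJ$. Let $\mathrm{Inv}^{\mathrm i}_N$ be the set of permutations $\pi$ of $\{1,\dots,N\}$ with $\pi^2=1$ and $\pi(i')=\pi(i)'$ for all $i$, and $\mathrm{Inv}^{\mathrm c}_N$ the subset of those with $\pi(i)\ne i'$ for all $i$. For $\pi\in\mathrm{Inv}^{\mathrm a}_N$ let $\pi^{\mathrm a}_<$ be the strictly upper triangular $N\times N$ matrix whose entry $(i,j)$, $i<j$, is $\delta_{i,\pi(j)}$, except that it is $-\delta_{i,\pi(j)}$ if $\mathrm a=\mathrm i$ and $n<i$, or if $\mathrm a=\mathrm c$ and $j'<i\le n$ (for $\mathrm a=\mathrm c$ the antidiagonal entries are $0$). Set $$F^{\mathrm a}_\pi=\{M\in E^{\mathrm a}_N : \exists\, U\in\tilde B_N,\ U\,\mathcal U\,U^{-1}=\pi^{\mathrm a}_<\}.$$ An involution $\pi\in\mathrm{Inv}^{\mathrm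 i}_N$ corresponds to a link pattern if it arises from a partition of $\{1,\dots,n\}$ into pairs and points linked to a boundary point $b$, by setting $\pi(j)=k$, $\pi(k)=j$, $\pi(j')=k'$, $\pi(k')=j'$ for each pair $\{j,k\}$, and $\pi(j)=j'$, $\pi(j')=j$ for each $j$ linked to $b$. An involution $\pi\in\mathrm{Inv}^{\mathrm c}_N$ corresponds to a link pattern if it arises in the same way from a partition of $\{1,\dots,n\}$ into pairs and, if $n$ is odd, exactly one single point $j$, for which $\pi(j)=j$ and $\pi(j')=j'$. Dimensions are those of the Zariski closures in the finite-dimensional vector space $\mathcal M_N$. Then for $\mathrm a\in\{\mathrm i,\mathrm c\}$: 1. For every $\pi\in\mathrm{Inv}^{\mathrm a}_N$, $$\dim F^{\mathrm i}_\pi=n^2+\#\{a\le n:\pi(a)=a'\}+\#\{a<b\le n:\pi(a)=b'\}+2\,\#\{a<b\le n:\pi(a)=b\},$$ $$\dim F^{\mathrm c}_\pi=n(n-1)+\#\{a<b\le n:\pi(a)=b'\}+2\,\#\{a<b\le n:\pi(a)=b\}.$$ 2. The maximum of $\dim F^{\mathrm a}_\pi$ over $\pi\in\mathrm{Inv}^{\mathrm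 a}_N$ is $n(n+1)$ for $\mathrm a=\mathrm i$ and $2\lfloor n^2/2\rfloor$ for $\mathrm a=\mathrm c$. 3. For $\pi\in\mathrm{Inv}^{\mathrm a}_N$, the stratum $F^{\mathrm a}_\pi$ has the maximal dimension if and only if $\pi$ corresponds to a link pattern. -/

import Mathlib

/-- The two boundary conditions: identified (`i`) and closed (`c`). -/
inductive Boundary
  | identified
  | closed

namespace BrauerLoop

noncomputable section

/-! ### Infinite periodic matrices -/

/-- The algebra `R` of complex upper triangular matrices `(M i j)`, `i j : ℤ`, infinite in both
directions, with the matrix product `(M * M') i j = ∑ k ∈ [i, j], M i k * M' k j`. -/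
abbrev UpperTri : Type := IncidenceAlgebra ℂ ℤ

/-- The shift operator `S`, with entries `S i j = δ_{i, j - 1}`. -/
def shift : UpperTri where
  toFun i j := if i = j - 1 then 1 else 0
  eq_zero_of_not_le' i j h := if_neg (by omega)

/-- The subalgebra `R_{ℤ/N}` of the periodic matrices, i.e. those commuting with `S ^ N`. -/
def periodicAlg (N : ℕ) : Subalgebra ℂ UpperTri := Subalgebra.centralizer ℂ {shift ^ N}

instance periodicAlg_ring (N : ℕ) : Ring (periodicAlg N) := Subalgebra.toRing _

/-- `S ^ N` as an element of `R_{ℤ/N}`. -/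
def shiftPow (N : ℕ) : periodicAlg N :=
  ⟨shift ^ N, Subalgebra.mem_centralizer_iff ℂ |>.2 fun g hg => by
    rw [Set.mem_singleton_iff.1 hg]⟩

/-- The ideal of `R_{ℤ/N}` generated by `S ^ N`. -/
def shiftIdeal (N : ℕ) : Ideal (periodicAlg N) := Ideal.span {shiftPow N}

theorem shiftPow_mul_comm (N : ℕ) (M : periodicAlg N) : shiftPow N * M = M * shiftPow N :=
  Subtype.ext ((Subalgebra.mem_centralizer_iff ℂ).1 M.2 _ (Set.mem_singleton _))

/-- Since `S ^ N` is central, the (left) ideal that it generates is two-sided. -/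
instance shiftIdeal_isTwoSided (N : ℕ) : (shiftIdeal N).IsTwoSided where
  mul_mem_of_left {x} b hx := by
    obtain ⟨c, rfl⟩ := Ideal.mem_span_singleton'.1 hx
    rw [mul_assoc, shiftPow_mul_comm, ← mul_assoc]
    exact Ideal.mem_span_singleton'.2 ⟨_, rfl⟩

/-- The algebra `ℳ_N = R_{ℤ/N} / ⟨S ^ N⟩`. -/
abbrev MAlg (N : ℕ) : Type := periodicAlg N ⧸ shiftIdeal N

/-- The sign `ε_i`: `1` if `i ≡ 1, …, n` and `-1` if `i ≡ n + 1, …, 2 n`, modulo `2 n`. -/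
def eps (n : ℕ) (i : ℤ) : ℂ := if (i - 1) % (2 * n : ℤ) < n then 1 else -1

/-- The adjoint `M† = J⁻¹ Mᵀ J` for the antidiagonal symplectic form, where `N = 2 n`:
`M† i j = ε_i ε_j M (N - j + 1) (N - i + 1)`. -/
def dagger (n : ℕ) (M : UpperTri) : UpperTri where
  toFun i j := eps n i * eps n j * M (2 * n - j + 1) (2 * n - i + 1)
  eq_zero_of_not_le' i j h := by
    rw [IncidenceAlgebra.apply_eq_zero_of_not_le (by omega), mul_zero]

/-- The symmetry defining type `a`: `M = - M†` (identified), `M = M†` (closed). -/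
def HasSymmetry (a : Boundary) (n : ℕ) (M : UpperTri) : Prop :=
  match a with
  | .identified => M = -dagger n M
  | .closed => M = dagger n M

/-- The set `R^a_{ℤ/N}`, for `N = 2 n`. -/
def periodicSym (a : Boundary) (n : ℕ) : Set (periodicAlg (2 * n)) :=
  {M | HasSymmetry a n (M : UpperTri)}

/-- The Brauer loop scheme `E^a_N`, `N = 2 n`, as a set: the classes `x` in `ℳ_N` of elements of
`R^a_{ℤ/N}` such that `x ^ 2 = 0` and the diagonal entries of `x` vanish. (The entries `M i j` with
`j < i + N` do not depend on the representative `M` of `x`.) -/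
def scheme (a : Boundary) (n : ℕ) : Set (MAlg (2 * n)) :=
  {x | x ^ 2 = 0 ∧
    ∃ M ∈ periodicSym a n, Ideal.Quotient.mk (shiftIdeal (2 * n)) M = x ∧
      ∀ i : ℤ, (M : UpperTri) i i = 0}

/-! ### Finite matrices

The row and column numbers `1, …, N` correspond to `0, …, N - 1` in `Fin N`, and
`i ↦ N - i + 1` is `Fin.rev`. -/

/-- The block of rows and columns `1, …, N` of an infinite matrix. For `M` upper triangular this
is the upper triangular part `𝒰` in the decomposition `M = (𝒰, Λ)`. -/
def upperBlock (N : ℕ) (M : UpperTri) : Matrix (Fin N) (Fin N) ℂ :=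
  Matrix.of fun i j => M ((i : ℤ) + 1) ((j : ℤ) + 1)

/-- The antidiagonal symplectic form `J` of size `2 n`. -/
def sympForm (n : ℕ) : Matrix (Fin (2 * n)) (Fin (2 * n)) ℂ :=
  Matrix.of fun i j => if j = i.rev then (if (i : ℕ) < n then 1 else -1) else 0

/-- The Borel subgroup `B̃_N` of the symplectic group, `N = 2 n`: the invertible upper triangular
matrices `U` with `U⁻¹ = U† = J⁻¹ Uᵀ J`. -/
def borel (n : ℕ) : Set (Matrix (Fin (2 * n)) (Fin (2 * n)) ℂ) :=
  {U | IsUnit U ∧ (∀ i j, j < i → U i j = 0) ∧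
    U⁻¹ = (sympForm n)⁻¹ * U.transpose * sympForm n}

/-- The set `Inv^a_N` of involutions, `N = 2 n`. -/
def Inv (a : Boundary) (n : ℕ) : Set (Equiv.Perm (Fin (2 * n))) :=
  {π | (∀ i, π (π i) = i) ∧ (∀ i, π i = (π i.rev).rev) ∧
    (a = .closed → ∀ i, π i ≠ i.rev)}

/-- The matrix `π^a_<` of an involution. -/
def invMatrix (a : Boundary) (n : ℕ) (π : Equiv.Perm (Fin (2 * n))) :
    Matrix (Fin (2 * n)) (Fin (2 * n)) ℂ :=
  Matrix.of fun i j =>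
    match a with
    | .identified =>
      if j ≤ i then 0
      else if n ≤ (i : ℕ) then (if i = π j then -1 else 0)
      else (if i = π j then 1 else 0)
    | .closed =>
      if j ≤ i then 0
      else if i = j.rev then 0
      else if j.rev < i ∧ (i : ℕ) < n then (if i = π j then -1 else 0)
      else (if i = π j then 1 else 0)

/-- The stratum `F^a_π`: the `M = (𝒰, Λ)` in `E^a_N` such that `𝒰` is conjugate to `π^a_<` under
`B̃_N`. -/
def stratum (a : Boundary) (n : ℕ) (π : Equiv.Perm (Fin (2 * n))) : Set (MAlg (2 * n)) :=
  {x | x ∈ scheme a n ∧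
    ∃ M ∈ periodicSym a n, Ideal.Quotient.mk (shiftIdeal (2 * n)) M = x ∧
      ∃ U ∈ borel n, U * upperBlock (2 * n) (M : UpperTri) * U⁻¹ = invMatrix a n π}

/-! ### Dimension -/

/-- The algebra of functions on a subset `X` of a complex vector space `V` that are polynomial in
the linear coordinates of `V`. For `V` of finite dimension this is the coordinate ring
`ℂ[V] / I(X)` of the Zariski closure of `X`. -/
def coordRing {V : Type*} [AddCommGroup V] [Module ℂ V] (X : Set V) : Subalgebra ℂ (X → ℂ) :=
  Algebra.adjoin ℂ {f | ∃ φ : Module.Dual ℂ V, ∀ x : X, f x = φ x}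

/-- The dimension of a subset of a finite-dimensional complex vector space: the Krull dimension of
the coordinate ring of its Zariski closure. -/
def zariskiDim {V : Type*} [AddCommGroup V] [Module ℂ V] (X : Set V) : WithBot ℕ∞ :=
  ringKrullDim (coordRing X)

/-! ### Link patterns and chord counts -/

/-- Link patterns with `n` points. `p j = some k` means that `j` is linked to `k`, with
`p j = some j` if `j` is left unpaired, and `p j = none` that `j` is linked to the boundary `b`.
For the identified boundary every point is linked to another point or to `b`; for the closed
boundary every point is linked to another point, except for a single one if `n` is odd. -/
def IsLinkPattern (a : Boundary) (n : ℕ) (p : Fin n → Option (Fin n)) : Prop :=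
  (∀ j k, p j = some k → p k = some j) ∧
  match a with
  | .identified => ∀ j, p j ≠ some j
  | .closed => (∀ j, p j ≠ none) ∧ (Finset.univ.filter fun j => p j = some j).card = n % 2

/-- The point `j ∈ {1, …, n}` seen in `{1, …, 2 n}`. -/
def lower {n : ℕ} (j : Fin n) : Fin (2 * n) := Fin.castLE (by omega) j

/-- The periodic diagram `π̃` of a link pattern `p`: if `p j = k ≠ b`, then `π̃ j = k` and
`π̃ (N - j + 1) = N - k + 1`; if `p j = b`, then `π̃` exchanges `j` and `N - j + 1`. -/
def periodicDiagram {n : ℕ} (p : Fin n → Option (Fin n)) (x : Fin (2 * n)) : Fin (2 * n) :=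
  if h : (x : ℕ) < n then
    match p ⟨x, h⟩ with
    | some k => lower k
    | none => x.rev
  else
    match p ⟨x.rev, by rw [Fin.val_rev]; omega⟩ with
    | some k => (lower k).rev
    | none => x.rev

/-- The involution `π` is the periodic diagram of a link pattern in `LP^a_n`. -/
def IsPatternInvolution (a : Boundary) (n : ℕ) (π : Equiv.Perm (Fin (2 * n))) : Prop :=
  ∃ p : Fin n → Option (Fin n), IsLinkPattern a n p ∧ ∀ x, π x = periodicDiagram p x

/-- The number of `a ∈ {1, …, n}` joined to their mirror image `a' = N - a + 1`. -/
def numSelf (n : ℕ) (π : Equiv.Perm (Fin (2 * n))) : ℕ :=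
  (Finset.univ.filter fun a : Fin n => π (lower a) = (lower a).rev).card

/-- The number of pairs `a < b` in `{1, …, n}` such that `a` is joined to `b'` and hence `b` to
`a'`; these are the mirror pairs of chords that cross each other. -/
def numCross (n : ℕ) (π : Equiv.Perm (Fin (2 * n))) : ℕ :=
  (Finset.univ.filter fun ab : Fin n × Fin n =>
    ab.1 < ab.2 ∧ π (lower ab.1) = (lower ab.2).rev).card

/-- The number of pairs `a < b` in `{1, …, n}` such that `a` is joined to `b` and hence `a'` to
`b'`; these are the mirror pairs of chords that do not cross each other. -/
def numArc (n : ℕ) (π : Equiv.Perm (Fin (2 * n))) : ℕ :=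
  (Finset.univ.filter fun ab : Fin n × Fin n =>
    ab.1 < ab.2 ∧ π (lower ab.1) = lower ab.2).card

/-- The chord counting formula for the dimension of the stratum of `π`. -/
def chordDim (a : Boundary) (n : ℕ) (π : Equiv.Perm (Fin (2 * n))) : ℕ :=
  match a with
  | .identified => n ^ 2 + numSelf n π + numCross n π + 2 * numArc n π
  | .closed => n * (n - 1) + numCross n π + 2 * numArc n π

/-- The maximal dimension of the strata: `n (n + 1)`, respectively `2 ⌊n² / 2⌋`. -/
def maxDim (a : Boundary) (n : ℕ) : ℕ :=
  match a with
  | .identified => n * (n + 1)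
  | .closed => 2 * (n ^ 2 / 2)

end

end BrauerLoop

open Filter Topology

namespace BrauerLoop

/-! ### Krull dimension and transcendence degree -/

/-! Modulo `S ^ N`, a periodic matrix is an `N × N` matrix: an upper triangular part `U` and a
strictly lower part `L`, the latter recording the entries that run past column `N`. Its square
vanishes exactly when `U * U = 0` and the strictly lower part of `U * L + L * U` is zero
(`reduction_sq_eq_zero_iff`). So for fixed `U` the condition on `L` is linear. The group `B̃_N` acts
compatibly, and a stratum is swept out by moving the linear fibre over `P = π_<` around by the group
(`mem_matStratum_iff`). Its dimension is therefore that of the Lie algebra, minus that of the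
stabilizer of `P`, plus that of the fibre.

To obtain this as a Krull dimension, the orbit is parametrized rationally: with `S` a complement of
the stabilizer in the Lie algebra, `(x, B)` is sent to the point obtained by acting with the Cayley
transform of `x` on `P` and `B`. The derivative at `0` is injective and the image is dense, so the
coordinate ring embeds in a field of rational functions and contains the right number of
algebraically independent elements (`zariskiDim_eq_of_parametrization`,
`zariskiDim_stratum_eq_finrank_add`).

Two pieces of linear algebra give the ranks. The trace form identifies the fibre with the
annihilator of the range of `Y ↦ P * Y + Y * P`, which brings in the dimension of the anticommutant
of `P` (`finrank_fibre_add`). Entrywise multiplication by signs turns commutation with `P` into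
anticommutation, up to diagonal and antidiagonal entries (`IsChordMatrix.finrank_stabLie`). The
anticommutant thus enters twice with opposite signs and cancels, so its dimension is never needed;
what is left is a count of points of `π` (`zariskiDim_stratum_add`).

The outcome is that the dimension falls short of `n (n + 1)`, respectively `n ^ 2`, by one for each
fixed point in `{1, …, n}` and one for each crossing pair (`chordDim_add`). In the closed case the
number of fixed points has the parity of `n`. Hence the maximum occurs exactly when nothing crosses
and the number of fixed points is the least possible, which characterizes link patterns
(`isPatternInvolution_iff`). -/

theorem ringKrullDim_eq_of_isIntegral {R S : Type*} [CommRing R] [CommRing S] [Algebra R S]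
    [Algebra.IsIntegral R S] [FaithfulSMul R S] : ringKrullDim S = ringKrullDim R := by
  apply le_antisymm
  -- Incomparability makes contraction of primes strictly monotone; in the other direction, lying
  -- over and going up lift chains.
  · refine Order.krullDim_le_of_strictMono
      (fun I : PrimeSpectrum S => (⟨I.asIdeal.comap (algebraMap R S), inferInstance⟩ :
        PrimeSpectrum R)) fun I J h => ?_
    exact Ideal.IsIntegral.comap_lt_comap (R := R) (A := S) h
  · refine iSup_le fun l => ?_
    obtain ⟨Q, hQ⟩ := (Ideal.nonempty_primesOver (S := S) (l.head.asIdeal)).some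
    have := hQ.1
    have := hQ.2
    obtain ⟨L, hL, -⟩ := Ideal.exists_ltSeries_of_hasGoingUp (S := S) l Q
    rw [← hL]
    exact le_iSup (fun p : LTSeries (PrimeSpectrum S) => (p.length : WithBot ℕ∞)) L

-- By Noether normalization `A` is integral over a polynomial ring in `s` variables, so `s` is both
-- its Krull dimension and its transcendence degree. The family `x` gives `d ≤ s`, and the embedding
-- `ψ` into a field of transcendence degree `d` gives `s ≤ d`.
open Cardinal in
theorem ringKrullDim_eq_of_algebraicIndependent {A : Type*} [CommRing A] [Algebra ℂ A]
    [Algebra.FiniteType ℂ A] {d : ℕ} (x : Fin d → A) (hx : AlgebraicIndependent ℂ x)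
    (ψ : A →ₐ[ℂ] FractionRing (MvPolynomial (Fin d) ℂ)) (hψ : Function.Injective ψ) :
    ringKrullDim A = d := by
  have : IsDomain A := hψ.isDomain ψ.toRingHom
  obtain ⟨s, g, hg, hint⟩ := exists_integral_inj_algHom_of_fg ℂ A
  let _ := g.toRingHom.toAlgebra
  have : IsScalarTower ℂ (MvPolynomial (Fin s) ℂ) A :=
    IsScalarTower.of_algebraMap_eq fun r => (g.commutes r).symm
  have : Algebra.IsIntegral (MvPolynomial (Fin s) ℂ) A := ⟨hint⟩
  have : FaithfulSMul (MvPolynomial (Fin s) ℂ) A :=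
    (faithfulSMul_iff_algebraMap_injective _ _).2 hg
  have hA : Algebra.trdeg ℂ A = s := by
    have := lift_trdeg_add_eq ℂ (MvPolynomial (Fin s) ℂ) A
    rw [trdeg_eq_zero (R := MvPolynomial (Fin s) ℂ)] at this
    simpa using this.symm
  have hK : Algebra.trdeg ℂ (FractionRing (MvPolynomial (Fin d) ℂ)) = d := by
    have := lift_trdeg_add_eq ℂ (MvPolynomial (Fin d) ℂ)
      (FractionRing (MvPolynomial (Fin d) ℂ))
    have h0 : Algebra.IsAlgebraic (MvPolynomial (Fin d) ℂ)
      (FractionRing (MvPolynomial (Fin d) ℂ)) := IsLocalization.isAlgebraic _ (nonZeroDivisors _)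
    rw [trdeg_eq_zero (R := MvPolynomial (Fin d) ℂ)] at this
    simpa using this.symm
  have h1 := hx.lift_cardinalMk_le_trdeg
  have h2 := lift_trdeg_le_of_injective ψ hψ
  rw [hA] at h1 h2
  rw [hK] at h2
  simp at h1 h2
  rw [ringKrullDim_eq_of_isIntegral (R := MvPolynomial (Fin s) ℂ),
    MvPolynomial.ringKrullDim_of_isNoetherianRing]
  simp
  exact le_antisymm h2 h1

theorem MvPolynomial_eq_zero_of_eventually {m : ℕ} (q : MvPolynomial (Fin m) ℂ)
    (y₀ : Fin m → ℂ) (h : ∀ᶠ y in 𝓝 y₀, MvPolynomial.eval y q = 0) : q = 0 := by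
  obtain ⟨ε, hε, hb⟩ := Metric.eventually_nhds_iff_ball.1 h
  refine MvPolynomial.funext_set (fun i => Metric.ball (y₀ i) ε) (fun i => ?_) fun y hy => ?_
  · exact infinite_of_mem_nhds (y₀ i) (Metric.ball_mem_nhds _ hε)
  · rw [map_zero]
    refine hb y ?_
    rw [ball_pi _ hε]
    exact hy

/-- Clearing denominators. -/
theorem exists_clear_denominators {ι : Type*} {m : ℕ} (Q : ι → MvPolynomial (Fin m) ℂ)
    (δ : MvPolynomial (Fin m) ℂ) (hδ : δ ≠ 0) (p : MvPolynomial ι ℂ) :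
    ∃ (e : ℕ) (q : MvPolynomial (Fin m) ℂ),
      MvPolynomial.aeval (fun i => algebraMap _ (FractionRing (MvPolynomial (Fin m) ℂ)) (Q i) /
        algebraMap _ (FractionRing (MvPolynomial (Fin m) ℂ)) δ) p *
          algebraMap _ (FractionRing (MvPolynomial (Fin m) ℂ)) δ ^ e = algebraMap _ _ q ∧
      ∀ y, MvPolynomial.eval y δ ≠ 0 →
        MvPolynomial.eval (fun i => MvPolynomial.eval y (Q i) / MvPolynomial.eval y δ) p *
          MvPolynomial.eval y δ ^ e = MvPolynomial.eval y q := by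
  have hδ' : algebraMap _ (FractionRing (MvPolynomial (Fin m) ℂ)) δ ≠ 0 := by simpa using hδ
  induction p using MvPolynomial.induction_on with
  | C a => exact ⟨0, MvPolynomial.C a, by
      simp [IsScalarTower.algebraMap_apply ℂ (MvPolynomial (Fin m) ℂ)
        (FractionRing (MvPolynomial (Fin m) ℂ)), MvPolynomial.algebraMap_eq], by simp⟩
  | add p₁ p₂ h₁ h₂ =>
    obtain ⟨e₁, q₁, h₁, h₁'⟩ := h₁
    obtain ⟨e₂, q₂, h₂, h₂'⟩ := h₂
    refine ⟨e₁ + e₂, q₁ * δ ^ e₂ + q₂ * δ ^ e₁, ?_, fun y hy => ?_⟩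
    · simp only [map_add, map_mul, map_pow, ← h₁, ← h₂]; ring
    · simp only [map_add, map_mul, map_pow, ← h₁' y hy, ← h₂' y hy]; ring
  | mul_X p i h =>
    obtain ⟨e, q, h, h'⟩ := h
    refine ⟨e + 1, q * Q i, ?_, fun y hy => ?_⟩
    · simp only [map_mul, ← h, MvPolynomial.aeval_X]; field_simp; ring
    · simp only [map_mul, ← h' y hy, MvPolynomial.eval_X]; field_simp; ring

/-- The identity theorem for polynomials in rational functions. -/
theorem eval_div_eq_zero_of_eventually {ι : Type*} {m : ℕ} (Q : ι → MvPolynomial (Fin m) ℂ)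
    (δ : MvPolynomial (Fin m) ℂ) (hδ : δ ≠ 0) (p : MvPolynomial ι ℂ) (y₀ : Fin m → ℂ)
    (h : ∀ᶠ y in 𝓝 y₀, MvPolynomial.eval y δ ≠ 0 →
      MvPolynomial.eval (fun i => MvPolynomial.eval y (Q i) / MvPolynomial.eval y δ) p = 0) :
    (∀ y, MvPolynomial.eval y δ ≠ 0 →
      MvPolynomial.eval (fun i => MvPolynomial.eval y (Q i) / MvPolynomial.eval y δ) p = 0) ∧
    MvPolynomial.aeval (fun i => algebraMap _ (FractionRing (MvPolynomial (Fin m) ℂ)) (Q i) /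
        algebraMap _ (FractionRing (MvPolynomial (Fin m) ℂ)) δ) p = 0 := by
  obtain ⟨e, q, h1, h2⟩ := exists_clear_denominators Q δ hδ p
  have hδ' : algebraMap _ (FractionRing (MvPolynomial (Fin m) ℂ)) δ ≠ 0 := by simpa using hδ
  have hq : q = 0 := by
    -- The extra factor `δ` covers the points where the denominator vanishes, about which the
    -- hypothesis says nothing.
    have : q * δ = 0 := by
      refine MvPolynomial_eq_zero_of_eventually _ y₀ ?_
      filter_upwards [h] with y hy
      by_cases hd : MvPolynomial.eval y δ = 0
      · simp [hd]
      · rw [map_mul, ← h2 y hd, hy hd]; simp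
    exact (mul_eq_zero.1 this).resolve_right hδ
  refine ⟨fun y hy => ?_, ?_⟩
  · have := h2 y hy
    rw [hq, map_zero] at this
    exact (mul_eq_zero.1 this).resolve_right (pow_ne_zero _ hy)
  · rw [hq, map_zero] at h1
    exact (mul_eq_zero.1 h1).resolve_right (pow_ne_zero _ hδ')

/-- The coordinate ring of `X` as a quotient of a polynomial ring. -/
noncomputable def coordHom {V ι : Type*} [AddCommGroup V] [Module ℂ V] (e : V ≃ₗ[ℂ] (ι → ℂ))
    (X : Set V) : MvPolynomial ι ℂ →ₐ[ℂ] coordRing X :=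
  MvPolynomial.aeval fun i => ⟨fun x => e x i,
    Algebra.subset_adjoin ⟨(LinearMap.proj i).comp e.toLinearMap, fun _ => rfl⟩⟩

theorem coordHom_apply {V ι : Type*} [AddCommGroup V] [Module ℂ V] (e : V ≃ₗ[ℂ] (ι → ℂ))
    (X : Set V) (p : MvPolynomial ι ℂ) (x : X) :
    (coordHom e X p : X → ℂ) x = MvPolynomial.eval (e x) p := by
  have : ((Pi.evalAlgHom ℂ (fun _ : X => ℂ) x).comp
      ((coordRing X).val.comp (coordHom e X))) = MvPolynomial.aeval (e x) := by
    ext i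
    simp [coordHom]
  have h := DFunLike.congr_fun this p
  simpa using h

theorem coordHom_surjective {V ι : Type*} [AddCommGroup V] [Module ℂ V] [Fintype ι]
    (e : V ≃ₗ[ℂ] (ι → ℂ)) (X : Set V) : Function.Surjective (coordHom e X) := by
  classical
  have h : coordRing X ≤ ((coordRing X).val.comp (coordHom e X)).range := by
    refine Algebra.adjoin_le ?_
    rintro f ⟨φ, hφ⟩
    refine ⟨∑ i, MvPolynomial.C (φ (e.symm (Pi.single i 1))) * MvPolynomial.X i, ?_⟩
    funext x
    have h1 : (((coordRing X).val.comp (coordHom e X))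
      (∑ i, MvPolynomial.C (φ (e.symm (Pi.single i 1))) * MvPolynomial.X i) : X → ℂ) x = _ :=
      coordHom_apply e X _ x
    refine h1.trans ?_
    rw [hφ x]
    simp only [map_sum, map_mul, MvPolynomial.eval_C, MvPolynomial.eval_X]
    conv_rhs => rw [← e.symm_apply_apply (x : V), pi_eq_sum_univ (e x)]
    simp only [map_sum, map_smul, smul_eq_mul]
    refine Finset.sum_congr rfl fun i _ => ?_
    rw [mul_comm]
    congr 3
    ext j
    simp [Pi.single_apply, eq_comm]
  rintro ⟨f, hf⟩
  obtain ⟨p, hp⟩ := h hf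
  exact ⟨p, Subtype.ext hp⟩

/-- A subset of a finite-dimensional space that is the closure of the image of a rational map in
`d` variables with injective derivative at some point has dimension `d`. -/
theorem zariskiDim_eq_of_parametrization {V ι : Type*} [AddCommGroup V] [Module ℂ V] [Fintype ι]
    (e : V ≃ₗ[ℂ] (ι → ℂ)) (X : Set V) {d : ℕ} (Q : ι → MvPolynomial (Fin d) ℂ)
    (δ : MvPolynomial (Fin d) ℂ) (y₀ : Fin d → ℂ) (hδ : MvPolynomial.eval y₀ δ ≠ 0)
    (hmem : ∀ y, MvPolynomial.eval y δ ≠ 0 →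
      e.symm (fun i => MvPolynomial.eval y (Q i) / MvPolynomial.eval y δ) ∈ X)
    (hdense : ∀ p : MvPolynomial ι ℂ, (∀ y, MvPolynomial.eval y δ ≠ 0 →
      MvPolynomial.eval (fun i => MvPolynomial.eval y (Q i) / MvPolynomial.eval y δ) p = 0) →
        ∀ x ∈ X, MvPolynomial.eval (e x) p = 0)
    (f' : (Fin d → ℂ) →L[ℂ] (ι → ℂ))
    (hf : HasStrictFDerivAt
      (fun y i => MvPolynomial.eval y (Q i) / MvPolynomial.eval y δ) f' y₀)
    (hinj : Function.Injective f') : zariskiDim X = d := by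
  have hδ0 : δ ≠ 0 := fun h => hδ (by simp [h])
  set f : (Fin d → ℂ) → ι → ℂ :=
    fun y i => MvPolynomial.eval y (Q i) / MvPolynomial.eval y δ with hfdef
  set φ₂ : MvPolynomial ι ℂ →ₐ[ℂ] FractionRing (MvPolynomial (Fin d) ℂ) :=
    MvPolynomial.aeval (fun i => algebraMap _ (FractionRing (MvPolynomial (Fin d) ℂ)) (Q i) /
        algebraMap _ (FractionRing (MvPolynomial (Fin d) ℂ)) δ) with hφ₂
  have hker₁ : ∀ p, coordHom e X p = 0 ↔ ∀ x ∈ X, MvPolynomial.eval (e x) p = 0 := by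
    intro p
    constructor
    · intro h x hx
      rw [← coordHom_apply e X p ⟨x, hx⟩, h]; rfl
    · intro h
      refine Subtype.ext (funext fun x => ?_)
      rw [coordHom_apply, h x x.2]; rfl
  -- Vanishing on `X` and vanishing after substitution of the generic point are equivalent: one
  -- direction uses that the image lies in `X`, the other that it is dense in `X`.
  have hker : ∀ p, coordHom e X p = 0 ↔ φ₂ p = 0 := by
    intro p
    rw [hker₁]
    constructor
    · intro h
      refine (eval_div_eq_zero_of_eventually Q δ hδ0 p y₀ (Eventually.of_forall fun y hy => ?_)).2
      have := h _ (hmem y hy)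
      rwa [e.apply_symm_apply] at this
    · intro h
      refine hdense p fun y hy => ?_
      obtain ⟨n, q, h1, h2⟩ := exists_clear_denominators Q δ hδ0 p
      have hq : q = 0 := by
        rw [← hφ₂, h, zero_mul] at h1
        simpa using h1.symm
      have := h2 y hy
      rw [hq, map_zero] at this
      exact (mul_eq_zero.1 this).resolve_right (pow_ne_zero _ hy)
  have hsurj := coordHom_surjective e X
  set ψ : coordRing X →ₐ[ℂ] FractionRing (MvPolynomial (Fin d) ℂ) :=
    (Ideal.Quotient.liftₐ (RingHom.ker (coordHom e X)) φ₂ fun p hp => (hker p).1 hp).comp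
      (Ideal.quotientKerAlgEquivOfSurjective hsurj).symm.toAlgHom with hψ
  have hψi : Function.Injective ψ := by
    have : Function.Injective
        (Ideal.Quotient.liftₐ (RingHom.ker (coordHom e X)) φ₂ fun p hp => (hker p).1 hp) := by
      rw [injective_iff_map_eq_zero]
      intro a ha
      obtain ⟨p, rfl⟩ := Ideal.Quotient.mk_surjective a
      exact Ideal.Quotient.eq_zero_iff_mem.2 ((hker p).2 ha)
    exact this.comp (Ideal.quotientKerAlgEquivOfSurjective hsurj).symm.injective
  have : Algebra.FiniteType ℂ (coordRing X) := Algebra.FiniteType.of_surjective _ hsurj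
  -- A left inverse of the derivative selects `d` linear forms on the ambient space. Composed with
  -- the parametrization they have derivative the identity at `y₀`, so their joint values fill a
  -- neighbourhood, and no polynomial relation between them can hold.
  obtain ⟨g, hg⟩ := LinearMap.exists_leftInverse_of_injective f'.toLinearMap
    (LinearMap.ker_eq_bot.2 hinj)
  set G : (ι → ℂ) →L[ℂ] (Fin d → ℂ) := g.toContinuousLinearMap with hG
  classical
  set ℓ : Fin d → MvPolynomial ι ℂ :=
    fun j => ∑ i, MvPolynomial.C (g (Pi.single i 1) j) * MvPolynomial.X i with hℓ
  have hℓe : ∀ v j, MvPolynomial.eval v (ℓ j) = g v j := by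
    intro v j
    simp only [hℓ, map_sum, map_mul, MvPolynomial.eval_C, MvPolynomial.eval_X]
    conv_rhs => rw [LinearMap.pi_apply_eq_sum_univ g v]
    simp only [Finset.sum_apply, Pi.smul_apply, smul_eq_mul]
    refine Finset.sum_congr rfl fun i _ => ?_
    have h1 : (fun j => if i = j then (1 : ℂ) else 0) = Pi.single i 1 := by
      ext k
      simp [Pi.single_apply, eq_comm]
    rw [mul_comm, h1]
  refine ringKrullDim_eq_of_algebraicIndependent (fun j => coordHom e X (ℓ j)) ?_ ψ hψi
  rw [algebraicIndependent_iff]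
  intro q hq
  have h1 : coordHom e X (MvPolynomial.aeval ℓ q) = 0 := by
    rw [← hq, ← AlgHom.comp_apply, MvPolynomial.comp_aeval]
  rw [hker₁] at h1
  have hstrict : HasStrictFDerivAt (fun y => G (f y)) (ContinuousLinearMap.id ℂ (Fin d → ℂ)) y₀ := by
    have h := G.hasStrictFDerivAt.comp y₀ hf
    have hid : G ∘SL f' = ContinuousLinearMap.id ℂ (Fin d → ℂ) :=
      ContinuousLinearMap.ext fun v => LinearMap.congr_fun hg v
    rw [hid] at h
    exact h
  have hmap := hstrict.map_nhds_eq_of_surj (by simp)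
  refine MvPolynomial_eq_zero_of_eventually q (G (f y₀)) ?_
  rw [← hmap, eventually_map]
  have hc : ContinuousAt (fun y => MvPolynomial.eval y δ) y₀ :=
    (MvPolynomial.continuous_eval δ).continuousAt
  filter_upwards [hc.eventually_ne hδ] with y hy
  have h2 := h1 _ (hmem y hy)
  rw [e.apply_symm_apply] at h2
  have h3 : (MvPolynomial.eval (f y)) (MvPolynomial.aeval ℓ q) = MvPolynomial.eval (G (f y)) q := by
    have h4 : ((MvPolynomial.aeval (f y) : MvPolynomial ι ℂ →ₐ[ℂ] ℂ).comp (MvPolynomial.aeval ℓ)) =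
        MvPolynomial.aeval (G (f y)) := by
      ext j
      have h5 := hℓe (f y) j
      simp only [AlgHom.comp_apply, MvPolynomial.aeval_X]
      rw [MvPolynomial.aeval_eq_eval]
      exact h5
    simpa using DFunLike.congr_fun h4 q
  rw [← h3]; exact h2

/-! ### Periodic matrices modulo `S ^ N` as `N × N` matrices -/

theorem shift_pow_apply (k : ℕ) (i j : ℤ) :
    (shift ^ k) i j = if i = j - k then 1 else 0 := by
  induction k generalizing i j with
  | zero => simp [IncidenceAlgebra.one_apply]
  | succ k ih =>
    rw [pow_succ, IncidenceAlgebra.mul_apply]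
    have : ∀ x ∈ Finset.Icc i j, (shift ^ k) i x * shift x j =
        if x = j - 1 then (if i = j - (k + 1 : ℕ) then (1 : ℂ) else 0) else 0 := by
      intro x _
      rw [ih]
      change _ * (if x = j - 1 then (1 : ℂ) else 0) = _
      by_cases hx : x = j - 1
      · subst hx
        simp only [if_true, mul_one]
        congr 1
        push_cast
        exact propext ⟨fun h => by omega, fun h => by omega⟩
      · simp [hx]
    rw [Finset.sum_congr rfl this, Finset.sum_ite_eq']
    by_cases h : j - 1 ∈ Finset.Icc i j
    · rw [if_pos h]
    · rw [if_neg h, if_neg]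
      rw [Finset.mem_Icc] at h
      push_cast
      omega

theorem shift_pow_mul_apply (k : ℕ) (M : UpperTri) (i j : ℤ) :
    (shift ^ k * M) i j = M (i + k) j := by
  rw [IncidenceAlgebra.mul_apply]
  have : ∀ x ∈ Finset.Icc i j, (shift ^ k) i x * M x j = if x = i + k then M (i + k) j else 0 := by
    intro x _
    rw [shift_pow_apply]
    by_cases hx : x = i + k
    · subst hx; simp
    · rw [if_neg (by omega), if_neg hx, zero_mul]
  rw [Finset.sum_congr rfl this, Finset.sum_ite_eq']
  by_cases h : i + k ∈ Finset.Icc i j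
  · rw [if_pos h]
  · rw [if_neg h, IncidenceAlgebra.apply_eq_zero_of_not_le]
    rw [Finset.mem_Icc] at h
    omega

theorem mul_shift_pow_apply (k : ℕ) (M : UpperTri) (i j : ℤ) :
    (M * shift ^ k) i j = M i (j - k) := by
  rw [IncidenceAlgebra.mul_apply]
  have : ∀ x ∈ Finset.Icc i j, M i x * (shift ^ k) x j = if x = j - k then M i (j - k) else 0 := by
    intro x _
    rw [shift_pow_apply]
    by_cases hx : x = j - k
    · subst hx; simp
    · rw [if_neg hx, if_neg hx, mul_zero]
  rw [Finset.sum_congr rfl this, Finset.sum_ite_eq']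
  by_cases h : j - k ∈ Finset.Icc i j
  · rw [if_pos h]
  · rw [if_neg h, IncidenceAlgebra.apply_eq_zero_of_not_le]
    rw [Finset.mem_Icc] at h
    omega

theorem mem_periodicAlg_iff (N : ℕ) (M : UpperTri) :
    M ∈ periodicAlg N ↔ ∀ i j, M (i + N) (j + N) = M i j := by
  have : M ∈ periodicAlg N ↔ shift ^ N * M = M * shift ^ N := by
    unfold periodicAlg
    rw [Subalgebra.mem_centralizer_iff]
    simp
  rw [this]
  constructor
  · intro h i j
    have h2 : (shift ^ N * M) i (j + N) = (M * shift ^ N) i (j + N) := by rw [h]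
    simpa only [shift_pow_mul_apply, mul_shift_pow_apply, add_sub_cancel_right] using h2
  · intro h
    ext i j
    rw [shift_pow_mul_apply, mul_shift_pow_apply, ← h i (j - N)]
    simp

theorem periodic_apply {N : ℕ} (M : periodicAlg N) (i j : ℤ) :
    (M : UpperTri) (i + N) (j + N) = (M : UpperTri) i j :=
  (mem_periodicAlg_iff N _).1 M.2 i j

theorem periodic_apply_mul {N : ℕ} (M : periodicAlg N) (k i j : ℤ) :
    (M : UpperTri) (i + k * N) (j + k * N) = (M : UpperTri) i j := by
  induction k using Int.induction_on with
  | zero => simp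
  | succ k ih =>
    rw [← ih, ← periodic_apply M (i + k * N)]
    exact congrArg₂ (fun a b => (M : UpperTri) a b) (by ring) (by ring)
  | pred k ih =>
    rw [← ih, ← periodic_apply M (i + (-k - 1) * N)]
    exact congrArg₂ (fun a b => (M : UpperTri) a b) (by ring) (by ring)

/-- The entries `M i j` with `1 ≤ i ≤ N` and `i ≤ j < i + N`, arranged in an `N × N` matrix. -/
noncomputable def reduction (N : ℕ) : periodicAlg N →ₗ[ℂ] Matrix (Fin N) (Fin N) ℂ where
  toFun M := Matrix.of fun i j =>
    if i ≤ j then (M : UpperTri) ((i : ℤ) + 1) ((j : ℤ) + 1)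
    else (M : UpperTri) ((i : ℤ) + 1) ((j : ℤ) + 1 + N)
  map_add' M M' := by
    ext i j
    by_cases h : i ≤ j <;> simp [h]
  map_smul' c M := by
    ext i j
    by_cases h : i ≤ j <;> simp [h]

/-- Multiplication by `S ^ N` shifts the columns by `N`, so its multiples are the periodic matrices
that vanish in the band `i ≤ j < i + N`. By periodicity it suffices to look at the rows `1, …, N`,
and those band entries are the ones the reduction lists. -/
theorem reduction_eq_zero_iff {N : ℕ} [NeZero N] (M : periodicAlg N) :
    reduction N M = 0 ↔ M ∈ shiftIdeal N := by
  have hN : 0 < N := Nat.pos_of_neZero N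
  constructor
  · intro h
    have h0 : ∀ i j : ℤ, i ≤ j → j < i + N → (M : UpperTri) i j = 0 := by
      intro i j hij hj
      set k := (i - 1) / (N : ℤ) with hk
      have h1 : N * k + (i - 1) % N = i - 1 := Int.mul_ediv_add_emod (i - 1) N
      have h2 : 0 ≤ (i - 1) % (N : ℤ) := Int.emod_nonneg _ (by omega)
      have h3 : (i - 1) % (N : ℤ) < N := Int.emod_lt_of_pos _ (by omega)
      set r := (i - 1) % (N : ℤ) with hr
      have h4 : (M : UpperTri) i j = (M : UpperTri) (r + 1) (j - k * N) := by
        rw [← periodic_apply_mul M k (r + 1)]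
        exact congrArg₂ (fun a b => (M : UpperTri) a b) (by linarith [mul_comm (N : ℤ) k]) (by ring)
      rw [h4]
      have hi : i = N * k + r + 1 := by omega
      by_cases hc : j - k * N ≤ N
      · have h5 := congrFun (congrFun h ⟨r.toNat, by omega⟩) ⟨(j - k * N - 1).toNat, by
          have : (N : ℤ) * k = k * N := mul_comm _ _
          omega⟩
        have : (N : ℤ) * k = k * N := mul_comm _ _
        have h6 : (r.toNat : ℤ) = r := by omega
        have h7 : ((j - k * N - 1).toNat : ℤ) = j - k * N - 1 := by omega
        simp only [reduction, LinearMap.coe_mk, AddHom.coe_mk, Matrix.of_apply, Fin.mk_le_mk,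
          Matrix.zero_apply] at h5
        rw [if_pos (by omega), h6, h7, sub_add_cancel] at h5
        exact h5
      · have : (N : ℤ) * k = k * N := mul_comm _ _
        have h5 := congrFun (congrFun h ⟨r.toNat, by omega⟩) ⟨(j - k * N - 1 - N).toNat, by
          omega⟩
        have h6 : (r.toNat : ℤ) = r := by omega
        have h7 : ((j - k * N - 1 - N).toNat : ℤ) = j - k * N - 1 - N := by omega
        simp only [reduction, LinearMap.coe_mk, AddHom.coe_mk, Matrix.of_apply, Fin.mk_le_mk,
          Matrix.zero_apply] at h5
        rw [if_neg (by omega), h6, h7] at h5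
        rw [← h5]
        exact congrArg (fun b => (M : UpperTri) (r + 1) b) (by ring)
    -- The quotient of `M` by `S ^ N`; it is upper triangular precisely because the band vanishes.
    let M' : UpperTri := ⟨fun i j => (M : UpperTri) i (j + N), fun i j hij => by
      by_cases hc : i ≤ j + N
      · exact h0 i (j + N) hc (by omega)
      · exact IncidenceAlgebra.apply_eq_zero_of_not_le hc _⟩
    have hM' : M' ∈ periodicAlg N :=
      (mem_periodicAlg_iff N M').2 fun i j => periodic_apply M i (j + N)
    refine Ideal.mem_span_singleton'.2 ⟨⟨M', hM'⟩, Subtype.ext ?_⟩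
    ext i j
    change (M' * shift ^ N) i j = _
    rw [mul_shift_pow_apply]
    change (M : UpperTri) i (j - N + N) = _
    rw [sub_add_cancel]
  · intro h
    obtain ⟨M', rfl⟩ := Ideal.mem_span_singleton'.1 h
    ext i j
    have h1 : ∀ a b, ((M' * shiftPow N : periodicAlg N) : UpperTri) a b =
        (M' : UpperTri) a (b - N) := fun a b => mul_shift_pow_apply N (M' : UpperTri) a b
    simp only [reduction, LinearMap.coe_mk, AddHom.coe_mk, Matrix.of_apply, Matrix.zero_apply, h1]
    have := i.2
    have := j.2
    split_ifs with hij
    · exact IncidenceAlgebra.apply_eq_zero_of_not_le (by omega) _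
    · have : (j : ℕ) < i := by simpa using hij
      exact IncidenceAlgebra.apply_eq_zero_of_not_le (by omega) _

/-- The residue of `i - 1` modulo `N`. -/
def residue (N : ℕ) [NeZero N] (i : ℤ) : Fin N :=
  ⟨((i - 1) % N).toNat, by
    have hN : 0 < N := Nat.pos_of_neZero N
    have := Int.emod_lt_of_pos (i - 1) (by omega : (0 : ℤ) < N)
    have := Int.emod_nonneg (i - 1) (by omega : (N : ℤ) ≠ 0)
    omega⟩

theorem residue_add (N : ℕ) [NeZero N] (i : ℤ) : residue N (i + N) = residue N i := by
  have : (i + N - 1) % (N : ℤ) = (i - 1) % N := by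
    rw [show i + N - 1 = i - 1 + N by ring, Int.add_emod_right]
  simp [residue, this]

theorem residue_coe (N : ℕ) [NeZero N] (i : Fin N) : residue N ((i : ℤ) + 1) = i := by
  have : (i : ℤ) % N = i := Int.emod_eq_of_lt (by omega) (by omega)
  simp [residue, this]

theorem residue_rev (N : ℕ) [NeZero N] (i : ℤ) : residue N (N - i + 1) = (residue N i).rev := by
  have hN : 0 < N := Nat.pos_of_neZero N
  apply Fin.ext
  rw [Fin.val_rev]
  simp only [residue]
  have h1 := Int.emod_lt_of_pos (i - 1) (by omega : (0 : ℤ) < N)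
  have h2 := Int.emod_nonneg (i - 1) (by omega : (N : ℤ) ≠ 0)
  have h3 := Int.mul_ediv_add_emod (i - 1) N
  have h4 : ((N : ℤ) - i + 1 - 1) % N = N - 1 - (i - 1) % N := by
    rw [← Int.emod_eq_of_lt (a := N - 1 - (i - 1) % (N : ℤ)) (b := N) (by omega) (by omega)]
    have : (N : ℤ) - i + 1 - 1 = N - 1 - (i - 1) % (N : ℤ) + N * (-((i - 1) / N)) := by
      linarith
    rw [this, Int.add_mul_emod_self_left]
  omega

/-- A periodic matrix with a given reduction. -/
noncomputable def periodicLift (N : ℕ) [NeZero N] :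
    Matrix (Fin N) (Fin N) ℂ →ₗ[ℂ] periodicAlg N where
  toFun A := ⟨⟨fun i j => if i ≤ j ∧ j < i + N then A (residue N i) (residue N j) else 0,
    fun i j h => if_neg (by omega)⟩, by
      rw [mem_periodicAlg_iff]
      intro i j
      simp only [IncidenceAlgebra.coe_mk, residue_add]
      congr 1
      exact propext ⟨fun h => by omega, fun h => by omega⟩⟩
  map_add' A B := by
    refine Subtype.ext ?_
    ext i j
    by_cases h : i ≤ j ∧ j < i + N <;> simp [h]
  map_smul' c A := by
    refine Subtype.ext ?_
    ext i j
    by_cases h : i ≤ j ∧ j < i + N <;> simp [h]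

theorem periodicLift_apply (N : ℕ) [NeZero N] (A : Matrix (Fin N) (Fin N) ℂ) (i j : ℤ) :
    (periodicLift N A : UpperTri) i j =
      if i ≤ j ∧ j < i + N then A (residue N i) (residue N j) else 0 := rfl

theorem reduction_periodicLift (N : ℕ) [NeZero N] (A : Matrix (Fin N) (Fin N) ℂ) :
    reduction N (periodicLift N A) = A := by
  ext i j
  simp only [reduction, LinearMap.coe_mk, AddHom.coe_mk, Matrix.of_apply, periodicLift_apply,
    residue_add, residue_coe]
  have := i.2
  have := j.2
  split_ifs with h1 h2 h3
  · rfl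
  · have : (i : ℕ) ≤ j := h1
    omega
  · rfl
  · have : ¬ (i : ℕ) ≤ j := h1
    omega

/-- The space `ℳ_N` as the space of `N × N` matrices. -/
noncomputable def malgEquiv (N : ℕ) [NeZero N] : MAlg N ≃ₗ[ℂ] Matrix (Fin N) (Fin N) ℂ :=
  (LinearEquiv.ofBijective
    (((Submodule.mkQ (shiftIdeal N)).restrictScalars ℂ).comp (periodicLift N)) (by
      constructor
      · rw [← LinearMap.ker_eq_bot, LinearMap.ker_eq_bot']
        intro A hA
        have h1 : periodicLift N A ∈ shiftIdeal N := (Submodule.Quotient.mk_eq_zero _).1 hA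
        rw [← reduction_eq_zero_iff, reduction_periodicLift] at h1
        exact h1
      · intro x
        obtain ⟨M, rfl⟩ := Ideal.Quotient.mk_surjective x
        refine ⟨reduction N M, ?_⟩
        refine (Submodule.Quotient.eq _).2 ?_
        rw [← reduction_eq_zero_iff, map_sub, reduction_periodicLift, sub_self])).symm

theorem malgEquiv_mk (N : ℕ) [NeZero N] (M : periodicAlg N) :
    malgEquiv N (Ideal.Quotient.mk (shiftIdeal N) M) = reduction N M := by
  rw [malgEquiv, LinearEquiv.symm_apply_eq]
  refine (Submodule.Quotient.eq _).2 ?_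
  rw [← reduction_eq_zero_iff, map_sub, reduction_periodicLift, sub_self]

/-! ### The strata as sets of matrices -/

/-- The sign `ε_i` for `i` in `{1, …, 2 n}`. -/
noncomputable def sgn (n : ℕ) (i : Fin (2 * n)) : ℂ := if (i : ℕ) < n then 1 else -1

theorem sgn_mul_self (n : ℕ) (i : Fin (2 * n)) : sgn n i * sgn n i = 1 := by
  unfold sgn; split_ifs <;> norm_num

theorem sgn_rev (n : ℕ) (i : Fin (2 * n)) : sgn n i.rev = -sgn n i := by
  unfold sgn
  have := i.2
  rw [Fin.val_rev]
  by_cases h : (i : ℕ) < n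
  · rw [if_pos h, if_neg (by omega)]
  · rw [if_neg h, if_pos (by omega), neg_neg]

/-- The adjoint of a square matrix for the antidiagonal symplectic form. -/
noncomputable def adj (n : ℕ) : Matrix (Fin (2 * n)) (Fin (2 * n)) ℂ →ₗ[ℂ]
    Matrix (Fin (2 * n)) (Fin (2 * n)) ℂ where
  toFun A := Matrix.of fun i j => sgn n i * sgn n j * A j.rev i.rev
  map_add' A B := by ext i j; simp [mul_add]
  map_smul' c A := by ext i j; simp; ring

theorem adj_apply (n : ℕ) (A : Matrix (Fin (2 * n)) (Fin (2 * n)) ℂ) (i j : Fin (2 * n)) :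
    adj n A i j = sgn n i * sgn n j * A j.rev i.rev := rfl

/-- The upper triangular part, diagonal included. -/
def upPart (N : ℕ) : Matrix (Fin N) (Fin N) ℂ →ₗ[ℂ] Matrix (Fin N) (Fin N) ℂ where
  toFun A := Matrix.of fun i j => if i ≤ j then A i j else 0
  map_add' A B := by ext i j; by_cases h : i ≤ j <;> simp [h]
  map_smul' c A := by ext i j; by_cases h : i ≤ j <;> simp [h]

theorem upPart_apply (N : ℕ) (A : Matrix (Fin N) (Fin N) ℂ) (i j : Fin N) :
    upPart N A i j = if i ≤ j then A i j else 0 := rfl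

/-- The strictly lower triangular part. -/
def lowPart (N : ℕ) : Matrix (Fin N) (Fin N) ℂ →ₗ[ℂ] Matrix (Fin N) (Fin N) ℂ where
  toFun A := Matrix.of fun i j => if j < i then A i j else 0
  map_add' A B := by ext i j; by_cases h : j < i <;> simp [h]
  map_smul' c A := by ext i j; by_cases h : j < i <;> simp [h]

theorem lowPart_apply (N : ℕ) (A : Matrix (Fin N) (Fin N) ℂ) (i j : Fin N) :
    lowPart N A i j = if j < i then A i j else 0 := rfl

/-- The sign in the symmetry `M = ± M†` of a boundary condition. -/
def bsign : Boundary → ℂ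
  | .identified => -1
  | .closed => 1

theorem bsign_mul_self (a : Boundary) : bsign a * bsign a = 1 := by
  cases a <;> simp [bsign]

/-- The stratum of matrices whose upper triangular part is conjugate to `P`. -/
def matStratum (s : ℂ) (n : ℕ) (P : Matrix (Fin (2 * n)) (Fin (2 * n)) ℂ) :
    Set (Matrix (Fin (2 * n)) (Fin (2 * n)) ℂ) :=
  {A | A = s • adj n A ∧ (∀ i, A i i = 0) ∧ upPart _ A * upPart _ A = 0 ∧
    lowPart _ (upPart _ A * lowPart _ A + lowPart _ A * upPart _ A) = 0 ∧
    ∃ U ∈ borel n, U * upPart _ A * U⁻¹ = P}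

theorem mul_apply_of_subset (M M' : UpperTri) (i j : ℤ) (s : Finset ℤ)
    (hs : Finset.Icc i j ⊆ s) : (M * M') i j = ∑ x ∈ s, M i x * M' x j := by
  rw [IncidenceAlgebra.mul_apply]
  refine Finset.sum_subset hs fun x _ hx => ?_
  rw [Finset.mem_Icc] at hx
  by_cases h : i ≤ x
  · rw [IncidenceAlgebra.apply_eq_zero_of_not_le (a := x) (by omega), mul_zero]
  · rw [IncidenceAlgebra.apply_eq_zero_of_not_le h, zero_mul]

theorem sum_Icc_eq_sum_fin (N : ℕ) (f : ℤ → ℂ) (c : ℤ) :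
    ∑ x ∈ Finset.Icc (c + 1) (c + N), f x = ∑ k : Fin N, f ((k : ℤ) + 1 + c) := by
  refine (Finset.sum_bij (fun (k : Fin N) _ => (k : ℤ) + 1 + c) ?_ ?_ ?_ ?_).symm
  · intro k _
    have := k.2
    rw [Finset.mem_Icc]
    omega
  · intro k _ l _ h
    ext
    omega
  · intro x hx
    rw [Finset.mem_Icc] at hx
    exact ⟨⟨(x - 1 - c).toNat, by omega⟩, Finset.mem_univ _, by simp; omega⟩
  · intro k _
    rfl

theorem reduction_apply (N : ℕ) (M : periodicAlg N) (i j : Fin N) :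
    reduction N M i j = if i ≤ j then (M : UpperTri) ((i : ℤ) + 1) ((j : ℤ) + 1)
      else (M : UpperTri) ((i : ℤ) + 1) ((j : ℤ) + 1 + N) := rfl

/-- For an entry beyond column `N` the intermediate index runs over two periods. Those in the first
give upper times lower, and those in the second, after shifting back by `N`, give lower times upper.
Lower times lower would land in the ideal of `S ^ N` and does not appear. -/
theorem reduction_mul (N : ℕ) (M M' : periodicAlg N) :
    reduction N (M * M') = upPart N (reduction N M) * upPart N (reduction N M') +
      lowPart N (upPart N (reduction N M) * lowPart N (reduction N M') +
        lowPart N (reduction N M) * upPart N (reduction N M')) := by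
  ext i j
  have hi := i.2
  have hj := j.2
  rw [reduction_apply]
  change (if i ≤ j then ((M : UpperTri) * (M' : UpperTri)) ((i : ℤ) + 1) ((j : ℤ) + 1)
      else ((M : UpperTri) * (M' : UpperTri)) ((i : ℤ) + 1) ((j : ℤ) + 1 + N)) = _
  rw [Matrix.add_apply, lowPart_apply, Matrix.add_apply, Matrix.mul_apply, Matrix.mul_apply,
    Matrix.mul_apply, ← Finset.sum_add_distrib]
  by_cases h : i ≤ j
  · have h' : (i : ℕ) ≤ j := h
    rw [if_pos h, if_neg (not_lt.2 h), add_zero,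
      mul_apply_of_subset _ _ _ _ (Finset.Icc (0 + 1) (0 + N))
        (Finset.Icc_subset_Icc (by omega) (by omega)), sum_Icc_eq_sum_fin]
    refine Finset.sum_congr rfl fun k _ => ?_
    have hk := k.2
    simp only [upPart_apply, reduction_apply, add_zero]
    by_cases h1 : i ≤ k
    · by_cases h2 : k ≤ j
      · simp [h1, h2]
      · have h2' : ¬ (k : ℕ) ≤ j := h2
        rw [IncidenceAlgebra.apply_eq_zero_of_not_le (a := (k : ℤ) + 1) (by omega)]
        simp [h2]
    · have h1' : ¬ (i : ℕ) ≤ k := h1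
      rw [IncidenceAlgebra.apply_eq_zero_of_not_le (a := (i : ℤ) + 1) (by omega)]
      simp [h1]
  · have h' : ¬ (i : ℕ) ≤ j := h
    have h0 : ∑ k, upPart N (reduction N M) i k * upPart N (reduction N M') k j = 0 := by
      refine Finset.sum_eq_zero fun k _ => ?_
      simp only [upPart_apply]
      by_cases h1 : i ≤ k
      · rw [if_neg (c := k ≤ j) (fun h2 => h (h1.trans h2)), mul_zero]
      · rw [if_neg h1, zero_mul]
    have hun : Finset.Icc (0 + 1 : ℤ) (0 + N) ∪ Finset.Icc ((N : ℤ) + 1) (N + N) =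
        Finset.Icc (1 : ℤ) (N + N) := by
      ext x
      simp only [Finset.mem_union, Finset.mem_Icc]
      omega
    have hdis : Disjoint (Finset.Icc (0 + 1 : ℤ) (0 + N)) (Finset.Icc ((N : ℤ) + 1) (N + N)) := by
      rw [Finset.disjoint_left]
      intro x hx hx'
      simp only [Finset.mem_Icc] at hx hx'
      omega
    rw [h0, if_neg h, if_pos (not_le.1 h), zero_add,
      mul_apply_of_subset _ _ _ _ (Finset.Icc (1 : ℤ) (N + N))
        (Finset.Icc_subset_Icc (by omega) (by omega)), ← hun, Finset.sum_union hdis,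
      sum_Icc_eq_sum_fin, sum_Icc_eq_sum_fin, ← Finset.sum_add_distrib]
    refine Finset.sum_congr rfl fun k _ => ?_
    have hk := k.2
    simp only [upPart_apply, lowPart_apply, reduction_apply, add_zero, periodic_apply]
    congr 1
    · by_cases h1 : i ≤ k
      · have h2 : j < k := lt_of_lt_of_le (not_le.1 h) h1
        simp [h1, h2, not_le.2 h2]
      · have h1' : ¬ (i : ℕ) ≤ k := h1
        rw [IncidenceAlgebra.apply_eq_zero_of_not_le (a := (i : ℤ) + 1) (by omega)]
        simp [h1]
    · by_cases h1 : k ≤ j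
      · have h2 : k < i := lt_of_le_of_lt h1 (not_le.1 h)
        simp [h1, h2, not_le.2 h2]
      · have h1' : ¬ (k : ℕ) ≤ j := h1
        rw [IncidenceAlgebra.apply_eq_zero_of_not_le (a := (k : ℤ) + 1) (by omega)]
        simp [h1]

/-- The two summands of the product formula are supported on complementary sets of entries, so they
vanish separately. -/
theorem reduction_sq_eq_zero_iff (N : ℕ) (M : periodicAlg N) :
    reduction N (M * M) = 0 ↔ upPart N (reduction N M) * upPart N (reduction N M) = 0 ∧
      lowPart N (upPart N (reduction N M) * lowPart N (reduction N M) +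
        lowPart N (reduction N M) * upPart N (reduction N M)) = 0 := by
  rw [reduction_mul]
  constructor
  · intro h
    have hu : upPart N (reduction N M) * upPart N (reduction N M) = 0 := by
      ext i j
      have hij := congrFun (congrFun h i) j
      rw [Matrix.add_apply, lowPart_apply] at hij
      by_cases h1 : j < i
      · rw [Matrix.mul_apply]
        refine Finset.sum_eq_zero fun k _ => ?_
        simp only [upPart_apply]
        by_cases h2 : i ≤ k
        · rw [if_neg (c := k ≤ j) (fun h3 => absurd (h2.trans h3) (not_le.2 h1)), mul_zero]
        · rw [if_neg h2, zero_mul]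
      · rwa [if_neg h1, add_zero] at hij
    rw [hu, zero_add] at h
    exact ⟨hu, h⟩
  · rintro ⟨h1, h2⟩
    rw [h1, h2, add_zero]

theorem upperBlock_eq (N : ℕ) (M : periodicAlg N) :
    upperBlock N (M : UpperTri) = upPart N (reduction N M) := by
  ext i j
  rw [upPart_apply, reduction_apply]
  change (M : UpperTri) ((i : ℤ) + 1) ((j : ℤ) + 1) = _
  by_cases h : i ≤ j
  · simp [h]
  · have h' : ¬ (i : ℕ) ≤ j := h
    rw [if_neg h, IncidenceAlgebra.apply_eq_zero_of_not_le (by omega)]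

theorem hasSymmetry_iff (a : Boundary) (n : ℕ) (M : UpperTri) :
    HasSymmetry a n M ↔ ∀ i j, M i j = bsign a *
      (eps n i * eps n j * M (2 * n - j + 1) (2 * n - i + 1)) := by
  cases a
  · simp only [HasSymmetry, bsign, neg_one_mul]
    refine ⟨fun h i j => ?_, fun h => ?_⟩
    · conv_lhs => rw [h]
      rfl
    · ext i j
      exact h i j
  · simp only [HasSymmetry, bsign, one_mul]
    refine ⟨fun h i j => ?_, fun h => ?_⟩
    · conv_lhs => rw [h]
      rfl
    · ext i j
      exact h i j

theorem eps_eq (n : ℕ) [NeZero (2 * n)] (i : ℤ) : eps n i = sgn n (residue (2 * n) i) := by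
  have hN : 0 < 2 * n := Nat.pos_of_neZero (2 * n)
  have h2 := Int.emod_nonneg (i - 1) (by omega : (2 * n : ℤ) ≠ 0)
  unfold eps sgn residue
  push_cast
  congr 1
  exact propext ⟨fun h => by omega, fun h => by omega⟩

theorem reduction_symm (a : Boundary) (n : ℕ) [NeZero (2 * n)] (M : periodicAlg (2 * n))
    (hM : M ∈ periodicSym a n) :
    reduction _ M = bsign a • adj n (reduction _ M) := by
  have hM' := (hasSymmetry_iff a n _).1 hM
  ext i j
  have hi := i.2
  have hj := j.2
  rw [Matrix.smul_apply, adj_apply, smul_eq_mul, reduction_apply, reduction_apply]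
  have e1 : ((j.rev : ℕ) : ℤ) = 2 * n - 1 - j := by rw [Fin.val_rev]; omega
  have e2 : ((i.rev : ℕ) : ℤ) = 2 * n - 1 - i := by rw [Fin.val_rev]; omega
  have e3 : eps n ((i : ℤ) + 1) = sgn n i := by rw [eps_eq, residue_coe]
  have e4 : eps n ((j : ℤ) + 1) = sgn n j := by rw [eps_eq, residue_coe]
  have e5 : eps n ((j : ℤ) + 1 + (2 * n : ℕ)) = sgn n j := by
    rw [eps_eq, residue_add, residue_coe]
  by_cases h : i ≤ j
  · rw [if_pos h, if_pos (Fin.rev_le_rev.2 h), hM', e3, e4, e1, e2]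
    exact congrArg (fun z => bsign a * (sgn n i * sgn n j * z))
      (congrArg₂ (fun x y => (M : UpperTri) x y) (by ring) (by ring))
  · rw [if_neg h, if_neg (fun h' => h (Fin.rev_le_rev.1 h')), hM', e3, e5, e1, e2,
      ← periodic_apply]
    refine congrArg (fun z => bsign a * (sgn n i * sgn n j * z))
      (congrArg₂ (fun x y => (M : UpperTri) x y) ?_ ?_)
    · push_cast; ring
    · push_cast; ring

theorem periodicLift_mem_periodicSym (a : Boundary) (n : ℕ) [NeZero (2 * n)]
    (A : Matrix (Fin (2 * n)) (Fin (2 * n)) ℂ) (hA : A = bsign a • adj n A) :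
    periodicLift (2 * n) A ∈ periodicSym a n := by
  refine (hasSymmetry_iff a n _).2 fun i j => ?_
  simp only [periodicLift_apply]
  have e : ((2 * n : ℕ) : ℤ) = 2 * n := by push_cast; ring
  by_cases h : i ≤ j ∧ j < i + (2 * n : ℕ)
  · rw [if_pos h, if_pos (by omega), eps_eq, eps_eq, ← e, residue_rev, residue_rev]
    conv_lhs => rw [hA]
    rw [Matrix.smul_apply, adj_apply, smul_eq_mul]
  · rw [if_neg h, if_neg (by omega), mul_zero, mul_zero]

/-- All conditions defining the stratum are visible on the reduction, and conversely `periodicLift`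
produces a representative that inherits the symmetry and the zero diagonal. -/
theorem mem_stratum_iff (a : Boundary) (n : ℕ) [NeZero (2 * n)]
    (π : Equiv.Perm (Fin (2 * n))) (x : MAlg (2 * n)) :
    x ∈ stratum a n π ↔ malgEquiv (2 * n) x ∈ matStratum (bsign a) n (invMatrix a n π) := by
  constructor
  · rintro ⟨⟨hx2, M, hM, rfl, hd⟩, M', hM', hx, U, hU, hUM⟩
    -- The scheme and the stratum each supply a representative; these may differ, but only by a
    -- multiple of `S ^ N`.
    have hred : reduction _ M' = reduction _ M := by
      rw [← malgEquiv_mk, ← malgEquiv_mk, hx]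
    have hsq : reduction _ (M * M) = 0 := by
      rw [reduction_eq_zero_iff, ← Ideal.Quotient.eq_zero_iff_mem, map_mul, ← pow_two]
      exact hx2
    rw [reduction_sq_eq_zero_iff] at hsq
    rw [malgEquiv_mk]
    rw [upperBlock_eq, hred] at hUM
    refine ⟨reduction_symm a n M hM, fun i => ?_, hsq.1, hsq.2, U, hU, hUM⟩
    rw [reduction_apply, if_pos le_rfl]
    exact hd _
  · rintro ⟨hs, hd, h1, h2, U, hU, hUM⟩
    set A := malgEquiv (2 * n) x with hA
    have hx : Ideal.Quotient.mk (shiftIdeal (2 * n)) (periodicLift (2 * n) A) = x := by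
      apply (malgEquiv (2 * n)).injective
      rw [malgEquiv_mk, reduction_periodicLift]
    refine ⟨⟨?_, _, periodicLift_mem_periodicSym a n A hs, hx, fun i => ?_⟩,
      _, periodicLift_mem_periodicSym a n A hs, hx, U, hU, ?_⟩
    · rw [← hx, pow_two, ← map_mul, Ideal.Quotient.eq_zero_iff_mem, ← reduction_eq_zero_iff,
        reduction_sq_eq_zero_iff, reduction_periodicLift]
      exact ⟨h1, h2⟩
    · rw [periodicLift_apply, hd, ite_self]
    · rw [upperBlock_eq, reduction_periodicLift, hUM]

/-! ### The group `B̃_N` and its action -/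

theorem adj_mul (n : ℕ) (A B : Matrix (Fin (2 * n)) (Fin (2 * n)) ℂ) :
    adj n (A * B) = adj n B * adj n A := by
  ext i j
  rw [adj_apply, Matrix.mul_apply, Matrix.mul_apply, Finset.mul_sum,
    ← Equiv.sum_comp Fin.revPerm]
  refine Finset.sum_congr rfl fun k _ => ?_
  simp only [adj_apply, Fin.revPerm_apply]
  linear_combination (-(sgn n i * sgn n j * A j.rev k.rev * B k.rev i.rev)) * sgn_mul_self n k

theorem adj_adj (n : ℕ) (A : Matrix (Fin (2 * n)) (Fin (2 * n)) ℂ) : adj n (adj n A) = A := by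
  ext i j
  rw [adj_apply, adj_apply, sgn_rev, sgn_rev, Fin.rev_rev, Fin.rev_rev]
  linear_combination (A i j) * (sgn n j * sgn n j * sgn_mul_self n i + sgn_mul_self n j)

theorem adj_one (n : ℕ) : adj n 1 = 1 := by
  ext i j
  rw [adj_apply]
  by_cases h : i = j
  · subst h; simp [sgn_mul_self]
  · rw [Matrix.one_apply_ne h, Matrix.one_apply_ne (fun h' => h (Fin.rev_injective h').symm),
      mul_zero]

theorem sympForm_inv_mul (n : ℕ) (U : Matrix (Fin (2 * n)) (Fin (2 * n)) ℂ) :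
    (sympForm n)⁻¹ * U.transpose * sympForm n = adj n U := by
  have hl : ∀ (A : Matrix (Fin (2 * n)) (Fin (2 * n)) ℂ) i j,
      (sympForm n * A) i j = sgn n i * A i.rev j := by
    intro A i j
    rw [Matrix.mul_apply, Finset.sum_eq_single i.rev]
    · simp [sympForm, sgn]
    · intro k _ hk
      simp [sympForm, hk]
    · simp
  have hr : ∀ (A : Matrix (Fin (2 * n)) (Fin (2 * n)) ℂ) i j,
      (A * sympForm n) i j = -sgn n j * A i j.rev := by
    intro A i j
    rw [Matrix.mul_apply, Finset.sum_eq_single j.rev]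
    · rw [← sgn_rev]; simp [sympForm, sgn, mul_comm]
    · intro k _ hk
      have : ¬ j = k.rev := fun h => hk (by rw [h, Fin.rev_rev])
      simp [sympForm, this]
    · simp
  have hJ : (sympForm n)⁻¹ = -sympForm n := by
    refine Matrix.inv_eq_right_inv ?_
    ext i j
    rw [hl, Matrix.neg_apply]
    by_cases h : i = j
    · subst h
      have := sgn_mul_self n i
      have h2 : sympForm n i.rev i = sgn n i.rev := by simp [sympForm, sgn]
      rw [h2, sgn_rev, Matrix.one_apply_eq]
      linear_combination this
    · have h2 : sympForm n i.rev j = 0 := by simp [sympForm, Ne.symm h]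
      rw [h2, Matrix.one_apply_ne h]
      simp
  ext i j
  rw [hr, hJ, Matrix.neg_mul, Matrix.neg_apply, hl, adj_apply, Matrix.transpose_apply]
  ring

theorem mem_borel_iff (n : ℕ) (U : Matrix (Fin (2 * n)) (Fin (2 * n)) ℂ) :
    U ∈ borel n ↔ U.BlockTriangular id ∧ U * adj n U = 1 := by
  constructor
  · rintro ⟨h1, h2, h3⟩
    refine ⟨fun i j h => h2 i j h, ?_⟩
    rw [← sympForm_inv_mul, ← h3]
    exact Matrix.mul_nonsing_inv _ ((Matrix.isUnit_iff_isUnit_det _).1 h1)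
  · rintro ⟨h1, h2⟩
    refine ⟨(Matrix.isUnit_iff_isUnit_det _).2 (Matrix.isUnit_det_of_right_inverse h2),
      fun i j h => h1 h, ?_⟩
    rw [sympForm_inv_mul]
    exact Matrix.inv_eq_right_inv h2

theorem inv_eq_adj {n : ℕ} {U : Matrix (Fin (2 * n)) (Fin (2 * n)) ℂ} (hU : U ∈ borel n) :
    U⁻¹ = adj n U := Matrix.inv_eq_right_inv ((mem_borel_iff n U).1 hU).2

theorem adj_mul_of_mem_borel {n : ℕ} {U : Matrix (Fin (2 * n)) (Fin (2 * n)) ℂ}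
    (hU : U ∈ borel n) : adj n U * U = 1 :=
  mul_eq_one_comm.1 ((mem_borel_iff n U).1 hU).2

theorem blockTriangular_adj {n : ℕ} {U : Matrix (Fin (2 * n)) (Fin (2 * n)) ℂ}
    (hU : U.BlockTriangular id) : (adj n U).BlockTriangular id := by
  intro i j h
  have h' : id i.rev < id j.rev := Fin.rev_lt_rev.2 h
  rw [adj_apply, hU h', mul_zero]

theorem adj_mem_borel {n : ℕ} {U : Matrix (Fin (2 * n)) (Fin (2 * n)) ℂ} (hU : U ∈ borel n) :
    adj n U ∈ borel n := by
  rw [mem_borel_iff, adj_adj]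
  exact ⟨blockTriangular_adj ((mem_borel_iff n U).1 hU).1, adj_mul_of_mem_borel hU⟩

theorem mul_mem_borel {n : ℕ} {U V : Matrix (Fin (2 * n)) (Fin (2 * n)) ℂ} (hU : U ∈ borel n)
    (hV : V ∈ borel n) : U * V ∈ borel n := by
  rw [mem_borel_iff] at *
  refine ⟨hU.1.mul hV.1, ?_⟩
  rw [adj_mul, mul_assoc, ← mul_assoc V, hV.2, one_mul, hU.2]

/-- Upper triangular matrices are stable under multiplication by upper triangular ones. Hence
`lowPart`, seen as the quotient by them, is compatible with such multiplications, here on the left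
and below on the right. -/
theorem lowPart_mul_lowPart {N : ℕ} {B : Matrix (Fin N) (Fin N) ℂ} (hB : B.BlockTriangular id)
    (Z : Matrix (Fin N) (Fin N) ℂ) : lowPart N (B * lowPart N Z) = lowPart N (B * Z) := by
  ext i j
  rw [lowPart_apply, lowPart_apply]
  split_ifs with h
  · rw [Matrix.mul_apply, Matrix.mul_apply]
    refine Finset.sum_congr rfl fun k _ => ?_
    rw [lowPart_apply]
    split_ifs with h1
    · rfl
    · rw [hB (show id k < id i from lt_of_le_of_lt (not_lt.1 h1) h), zero_mul, zero_mul]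
  · rfl

theorem lowPart_lowPart_mul {N : ℕ} {B : Matrix (Fin N) (Fin N) ℂ} (hB : B.BlockTriangular id)
    (Z : Matrix (Fin N) (Fin N) ℂ) : lowPart N (lowPart N Z * B) = lowPart N (Z * B) := by
  ext i j
  rw [lowPart_apply, lowPart_apply]
  split_ifs with h
  · rw [Matrix.mul_apply, Matrix.mul_apply]
    refine Finset.sum_congr rfl fun k _ => ?_
    rw [lowPart_apply]
    split_ifs with h1
    · rfl
    · rw [hB (show id j < id k from lt_of_lt_of_le h (not_lt.1 h1)), mul_zero, mul_zero]
  · rfl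

theorem lowPart_conj {N : ℕ} {B C : Matrix (Fin N) (Fin N) ℂ} (hB : B.BlockTriangular id)
    (hC : C.BlockTriangular id) (Z : Matrix (Fin N) (Fin N) ℂ) :
    lowPart N (B * lowPart N Z * C) = lowPart N (B * Z * C) := by
  rw [← lowPart_lowPart_mul hC, lowPart_mul_lowPart hB, lowPart_lowPart_mul hC]

theorem adj_lowPart (n : ℕ) (Z : Matrix (Fin (2 * n)) (Fin (2 * n)) ℂ) :
    adj n (lowPart _ Z) = lowPart _ (adj n Z) := by
  ext i j
  rw [adj_apply, lowPart_apply, lowPart_apply, adj_apply]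
  by_cases h : j < i
  · rw [if_pos h, if_pos (Fin.rev_lt_rev.2 h)]
  · rw [if_neg h, if_neg (fun h' => h (Fin.rev_lt_rev.1 h')), mul_zero]

theorem lowPart_lowPart (N : ℕ) (Z : Matrix (Fin N) (Fin N) ℂ) :
    lowPart N (lowPart N Z) = lowPart N Z := by
  ext i j
  simp only [lowPart_apply]
  split_ifs <;> rfl

theorem lowPart_eq_zero_of_blockTriangular {N : ℕ} {B : Matrix (Fin N) (Fin N) ℂ}
    (hB : B.BlockTriangular id) : lowPart N B = 0 := by
  ext i j
  rw [lowPart_apply]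
  split_ifs with h
  · exact hB h
  · rfl

theorem upPart_eq_self_of_blockTriangular {N : ℕ} {B : Matrix (Fin N) (Fin N) ℂ}
    (hB : B.BlockTriangular id) : upPart N B = B := by
  ext i j
  rw [upPart_apply]
  split_ifs with h
  · rfl
  · exact (hB (not_le.1 h)).symm

theorem upPart_lowPart (N : ℕ) (Z : Matrix (Fin N) (Fin N) ℂ) : upPart N (lowPart N Z) = 0 := by
  ext i j
  rw [upPart_apply, lowPart_apply]
  split_ifs with h h'
  · exact absurd h' (not_lt.2 h)
  · rfl
  · rfl

theorem upPart_add_lowPart (N : ℕ) (Z : Matrix (Fin N) (Fin N) ℂ) :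
    upPart N Z + lowPart N Z = Z := by
  ext i j
  rw [Matrix.add_apply, upPart_apply, lowPart_apply]
  by_cases h : i ≤ j
  · rw [if_pos h, if_neg (not_lt.2 h), add_zero]
  · rw [if_neg h, if_pos (not_le.1 h), zero_add]

/-- The fibre over `P` of a stratum: the possible lower triangular parts. -/
noncomputable def fibre (s : ℂ) (n : ℕ) (P : Matrix (Fin (2 * n)) (Fin (2 * n)) ℂ) :
    Submodule ℂ (Matrix (Fin (2 * n)) (Fin (2 * n)) ℂ) where
  carrier := {A | lowPart _ A = A ∧ A = s • adj n A ∧ lowPart _ (P * A + A * P) = 0}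
  zero_mem' := by simp
  add_mem' := by
    rintro A B ⟨h1, h2, h3⟩ ⟨h1', h2', h3'⟩
    refine ⟨by rw [map_add, h1, h1'], by rw [map_add, smul_add, ← h2, ← h2'], ?_⟩
    rw [mul_add, add_mul, add_add_add_comm, map_add, h3, h3', add_zero]
  smul_mem' := by
    rintro c A ⟨h1, h2, h3⟩
    refine ⟨by rw [map_smul, h1], by rw [map_smul, smul_comm, ← h2], ?_⟩
    rw [Matrix.mul_smul, Matrix.smul_mul, ← smul_add, map_smul, h3, smul_zero]

/-- The action of `B̃_N` on a pair of an upper and a lower triangular matrix. -/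
noncomputable def orbitPoint (n : ℕ) (P g A : Matrix (Fin (2 * n)) (Fin (2 * n)) ℂ) :
    Matrix (Fin (2 * n)) (Fin (2 * n)) ℂ :=
  g * P * g⁻¹ + lowPart _ (g * A * g⁻¹)

/-- Conjugation by `g` respects the adjoint because `g⁻¹ = adj n g`, and it carries the
anticommutator with `P` to that with `P'`; truncating to the lower part loses nothing, as `g` is
upper triangular. -/
theorem lowPart_conj_mem_fibre {s : ℂ} {n : ℕ} {P P' A g : Matrix (Fin (2 * n)) (Fin (2 * n)) ℂ}
    (hP : P.BlockTriangular id) (hg : g ∈ borel n) (hA : A ∈ fibre s n P)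
    (hP' : g * P * g⁻¹ = P') : lowPart _ (g * A * g⁻¹) ∈ fibre s n P' := by
  obtain ⟨h1, h2, h3⟩ := hA
  rw [inv_eq_adj hg] at *
  have hg' := (mem_borel_iff n g).1 hg
  have hgt := blockTriangular_adj hg'.1
  have hg2 := adj_mul_of_mem_borel hg
  have hPt : P'.BlockTriangular id := hP' ▸ (hg'.1.mul hP).mul hgt
  refine ⟨lowPart_lowPart _ _, ?_, ?_⟩
  · rw [adj_lowPart, ← map_smul, adj_mul, adj_mul, adj_adj]
    conv_lhs => rw [h2]
    rw [Matrix.mul_smul, Matrix.smul_mul, mul_assoc]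
  · rw [map_add, lowPart_mul_lowPart hPt, lowPart_lowPart_mul hPt, ← map_add]
    have : P' * (g * A * adj n g) + g * A * adj n g * P' = g * (P * A + A * P) * adj n g := by
      rw [← hP']
      calc _ = g * P * (adj n g * g) * A * adj n g + g * A * (adj n g * g) * P * adj n g := by
            noncomm_ring
        _ = _ := by rw [hg2]; noncomm_ring
    rw [this, ← lowPart_conj hg'.1 hgt, h3]
    simp

theorem mem_matStratum_iff {s : ℂ} {n : ℕ} {P : Matrix (Fin (2 * n)) (Fin (2 * n)) ℂ}
    (hP : P.BlockTriangular id) (hPd : ∀ i, P i i = 0) (hPP : P * P = 0) (hPs : P = s • adj n P)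
    (A : Matrix (Fin (2 * n)) (Fin (2 * n)) ℂ) :
    A ∈ matStratum s n P ↔ ∃ g ∈ borel n, ∃ B ∈ fibre s n P, A = orbitPoint n P g B := by
  constructor
  · rintro ⟨h1, h2, h3, h4, U, hU, hUP⟩
    have hU' := (mem_borel_iff n U).1 hU
    have hUt := blockTriangular_adj hU'.1
    have hU2 := adj_mul_of_mem_borel hU
    have hup : (upPart _ A).BlockTriangular id := by
      intro i j h
      have h' : ¬ i ≤ j := not_le.2 h
      rw [upPart_apply, if_neg h']
    have hlow : lowPart _ A ∈ fibre s n (upPart _ A) := by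
      refine ⟨lowPart_lowPart _ _, ?_, ?_⟩
      · rw [adj_lowPart, ← map_smul, ← h1]
      · exact h4
    -- `U` brings the point to the base point `P`, so the group element leading back is `U⁻¹`, here
    -- in the form `adj n U`.
    refine ⟨adj n U, adj_mem_borel hU, _, lowPart_conj_mem_fibre hup hU hlow hUP, ?_⟩
    rw [orbitPoint, inv_eq_adj (adj_mem_borel hU), adj_adj, lowPart_conj hUt hU'.1,
      ← hUP, inv_eq_adj hU]
    have e : ∀ Z, adj n U * (U * Z * adj n U) * U = Z := by
      intro Z
      calc _ = (adj n U * U) * Z * (adj n U * U) := by noncomm_ring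
        _ = Z := by rw [hU2, one_mul, mul_one]
    rw [e, e, lowPart_lowPart, upPart_add_lowPart]
  · rintro ⟨g, hg, B, hB, rfl⟩
    have hg' := (mem_borel_iff n g).1 hg
    have hgt := blockTriangular_adj hg'.1
    have hg2 := adj_mul_of_mem_borel hg
    have hP' : (g * P * adj n g).BlockTriangular id := (hg'.1.mul hP).mul hgt
    have hf := lowPart_conj_mem_fibre hP hg hB rfl
    rw [inv_eq_adj hg] at hf
    have hu : upPart _ (orbitPoint n P g B) = g * P * adj n g := by
      rw [orbitPoint, inv_eq_adj hg, map_add, upPart_lowPart, add_zero,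
        upPart_eq_self_of_blockTriangular hP']
    have hl : lowPart _ (orbitPoint n P g B) = lowPart _ (g * B * adj n g) := by
      rw [orbitPoint, inv_eq_adj hg, map_add, lowPart_lowPart,
        lowPart_eq_zero_of_blockTriangular hP', zero_add]
    refine ⟨?_, ?_, ?_, ?_, adj n g, adj_mem_borel hg, ?_⟩
    · rw [orbitPoint, inv_eq_adj hg, map_add, smul_add, ← hf.2.1, adj_mul, adj_mul, adj_adj]
      conv_lhs => rw [hPs]
      rw [Matrix.mul_smul, Matrix.smul_mul, mul_assoc g]
    · intro i
      have h1 : (g * P * adj n g) i i = 0 := by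
        rw [Matrix.mul_apply]
        refine Finset.sum_eq_zero fun k _ => ?_
        by_cases hk : k ≤ i
        · rw [Matrix.mul_apply, Finset.sum_eq_zero fun l _ => ?_, zero_mul]
          by_cases hl : i ≤ l
          · rcases eq_or_lt_of_le (hk.trans hl) with h | h
            · rw [h, hPd, mul_zero]
            · rw [hP (show id k < id l from h), mul_zero]
          · rw [hg'.1 (show id l < id i from not_le.1 hl), zero_mul]
        · rw [hgt (show id i < id k from not_le.1 hk), mul_zero]
      rw [orbitPoint, inv_eq_adj hg, Matrix.add_apply, h1, lowPart_apply, if_neg (lt_irrefl _),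
        zero_add]
    · rw [hu]
      calc _ = g * P * (adj n g * g) * P * adj n g := by noncomm_ring
        _ = g * (P * P) * adj n g := by rw [hg2]; noncomm_ring
        _ = 0 := by rw [hPP]; simp
    · rw [hu, hl]; exact hf.2.2
    · rw [hu, inv_eq_adj (adj_mem_borel hg), adj_adj]
      calc _ = (adj n g * g) * P * (adj n g * g) := by noncomm_ring
        _ = P := by rw [hg2, one_mul, mul_one]

/-! ### The Cayley transform -/

section Cayley

variable {𝔸 : Type*} [NormedRing 𝔸] [NormedAlgebra ℂ 𝔸] [CompleteSpace 𝔸]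

/-- The Cayley transform `(1 + x) (1 - x)⁻¹`. -/
noncomputable def cayley {R : Type*} [Ring R] (x : R) : R := (1 + x) * Ring.inverse (1 - x)

/-- The inverse `(u - 1) (u + 1)⁻¹` of the Cayley transform. -/
noncomputable def cayleyInv {R : Type*} [Ring R] (u : R) : R := (u - 1) * Ring.inverse (u + 1)

theorem cayley_zero {R : Type*} [Ring R] : cayley (0 : R) = 1 := by simp [cayley]

/-- With `v = u + 1` the inverse transform is `1 - 2 v⁻¹`, so `1` minus it has the explicit inverse
`v / 2`. -/
theorem cayley_cayleyInv {R : Type*} [Ring R] [Algebra ℂ R] (u : R) (hu : IsUnit (u + 1)) :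
    IsUnit (1 - cayleyInv u) ∧ cayley (cayleyInv u) = u := by
  obtain ⟨v, hv⟩ := hu
  have hu' : u = v - 1 := by rw [hv]; abel
  have h1 : cayleyInv u = 1 - (2 : ℂ) • (↑v⁻¹ : R) := by
    rw [cayleyInv, ← hv, Ring.inverse_unit, hu', two_smul]
    have : (↑v : R) * ↑v⁻¹ = 1 := v.mul_inv
    calc ((v : R) - 1 - 1) * ↑v⁻¹ = (v : R) * ↑v⁻¹ - (↑v⁻¹ + ↑v⁻¹) := by noncomm_ring
      _ = _ := by rw [this]
  have h2 : (1 - cayleyInv u) * ((1 / 2 : ℂ) • (v : R)) = 1 := by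
    rw [h1, sub_sub_cancel, smul_mul_smul_comm, v.inv_mul]
    norm_num
  have h3 : ((1 / 2 : ℂ) • (v : R)) * (1 - cayleyInv u) = 1 := by
    rw [h1, sub_sub_cancel, smul_mul_smul_comm, v.mul_inv]
    norm_num
  have hunit : IsUnit (1 - cayleyInv u) := ⟨⟨_, _, h2, h3⟩, rfl⟩
  refine ⟨hunit, ?_⟩
  have h4 : Ring.inverse (1 - cayleyInv u) = (1 / 2 : ℂ) • (v : R) :=
    Ring.inverse_unit (⟨_, _, h2, h3⟩ : Rˣ)
  rw [cayley, h4, h1, hu']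
  have : (↑v⁻¹ : R) * ↑v = 1 := v.inv_mul
  rw [mul_smul_comm, ← add_sub_assoc, sub_mul, smul_mul_assoc, this, smul_sub, smul_smul,
    add_mul, one_mul, ← two_smul ℂ (v : R), smul_smul]
  norm_num

theorem hasStrictFDerivAt_inverse_one :
    HasStrictFDerivAt (Ring.inverse : 𝔸 → 𝔸) (-ContinuousLinearMap.id ℂ 𝔸) 1 := by
  have h := hasStrictFDerivAt_ringInverse (𝕜 := ℂ) (1 : 𝔸ˣ)
  refine h.congr_fderiv ?_
  ext x
  simp

theorem hasStrictFDerivAt_cayley :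
    HasStrictFDerivAt (cayley : 𝔸 → 𝔸) ((2 : ℂ) • ContinuousLinearMap.id ℂ 𝔸) 0 := by
  have h1 : HasStrictFDerivAt (fun x : 𝔸 => 1 + x) (ContinuousLinearMap.id ℂ 𝔸) 0 :=
    (hasStrictFDerivAt_id (0 : 𝔸)).const_add 1
  have h2 : HasStrictFDerivAt (fun x : 𝔸 => 1 - x) (-ContinuousLinearMap.id ℂ 𝔸) 0 :=
    (hasStrictFDerivAt_id (0 : 𝔸)).const_sub 1
  have h3 : HasStrictFDerivAt (Ring.inverse : 𝔸 → 𝔸) (-ContinuousLinearMap.id ℂ 𝔸) (1 - 0) := by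
    rw [sub_zero]; exact hasStrictFDerivAt_inverse_one
  have h4 := h1.mul' (h3.comp 0 h2)
  refine h4.congr_fderiv ?_
  ext x
  simp [two_smul]

theorem hasStrictFDerivAt_cayleyInv :
    HasStrictFDerivAt (cayleyInv : 𝔸 → 𝔸) ((1 / 2 : ℂ) • ContinuousLinearMap.id ℂ 𝔸) 1 := by
  have h1 : HasStrictFDerivAt (fun x : 𝔸 => x - 1) (ContinuousLinearMap.id ℂ 𝔸) 1 :=
    (hasStrictFDerivAt_id (1 : 𝔸)).sub_const 1
  have h2 : HasStrictFDerivAt (fun x : 𝔸 => x + 1) (ContinuousLinearMap.id ℂ 𝔸) 1 :=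
    (hasStrictFDerivAt_id (1 : 𝔸)).add_const 1
  have e1 : (1 + 1 : 𝔸) * ((1 / 2 : ℂ) • 1) = 1 := by
    rw [mul_smul_comm, mul_one, ← two_smul ℂ (1 : 𝔸), smul_smul]; norm_num
  have e2 : ((1 / 2 : ℂ) • 1) * (1 + 1 : 𝔸) = 1 := by
    rw [smul_mul_assoc, one_mul, ← two_smul ℂ (1 : 𝔸), smul_smul]; norm_num
  have h3 := hasStrictFDerivAt_ringInverse (𝕜 := ℂ) (⟨1 + 1, (1 / 2 : ℂ) • 1, e1, e2⟩ : 𝔸ˣ)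
  have h4 := h1.mul' (HasStrictFDerivAt.comp (g := Ring.inverse) (f := fun x : 𝔸 => x + 1) 1 h3 h2)
  refine h4.congr_fderiv ?_
  have h5 : Ring.inverse (1 + 1 : 𝔸) = (1 / 2 : ℂ) • 1 :=
    Ring.inverse_unit (⟨1 + 1, (1 / 2 : ℂ) • 1, e1, e2⟩ : 𝔸ˣ)
  ext x
  simp [h5]

theorem eventually_isUnit {𝔸 E : Type*} [NormedRing 𝔸] [CompleteSpace 𝔸] [TopologicalSpace E] {f : E → 𝔸} {y₀ : E}
    (hf : ContinuousAt f y₀) {u : 𝔸} (h0 : f y₀ = u) (hu : IsUnit u) :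
    ∀ᶠ y in 𝓝 y₀, IsUnit (f y) :=
  hf.eventually (by rw [h0]; exact Units.isOpen.mem_nhds hu)

/-- Local factorization of the Cayley transform along a decomposition of a linear space. -/
theorem eventually_exists_cayley_mul [FiniteDimensional ℂ 𝔸] (b S H : Submodule ℂ 𝔸)
    (hS : S ≤ b) (hH : H ≤ b) (hSH : b ≤ S ⊔ H)
    (hb : ∀ x ∈ b, ∀ y ∈ b, IsUnit (1 - x) → IsUnit (1 - y) → IsUnit (1 + x) → IsUnit (1 + y) →
      IsUnit (cayley x * cayley y + 1) → cayleyInv (cayley x * cayley y) ∈ b) :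
    ∀ᶠ X : b in 𝓝 0, ∃ x ∈ S, ∃ y ∈ H, IsUnit (1 - x) ∧ IsUnit (1 - y) ∧ IsUnit (1 + x) ∧
      IsUnit (1 + y) ∧ cayley (X : 𝔸) = cayley x * cayley y := by
  -- A linear projection onto `b` gives a map with values in `b`, to which the open mapping property
  -- of strict derivatives applies; near `0` the projection changes nothing, by the closure
  -- hypothesis `hb`.
  obtain ⟨pr, hpr⟩ := LinearMap.exists_leftInverse_of_injective b.subtype (by simp)
  set prc : 𝔸 →L[ℂ] b := pr.toContinuousLinearMap with hprc
  have hprb : ∀ x : b, prc (x : 𝔸) = x := fun x => LinearMap.congr_fun hpr x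
  set F : S × H → 𝔸 := fun w => cayley (w.1 : 𝔸) * cayley (w.2 : 𝔸) with hF
  set i₁ : S × H →L[ℂ] 𝔸 := S.subtypeL.comp (ContinuousLinearMap.fst ℂ S H) with hi₁
  set i₂ : S × H →L[ℂ] 𝔸 := H.subtypeL.comp (ContinuousLinearMap.snd ℂ S H) with hi₂
  have hF0 : F 0 = 1 := by simp [hF, cayley_zero]
  have d1 : HasStrictFDerivAt (fun w : S × H => cayley (w.1 : 𝔸)) ((2 : ℂ) • i₁) 0 := by
    have h : HasStrictFDerivAt (cayley : 𝔸 → 𝔸) ((2 : ℂ) • ContinuousLinearMap.id ℂ 𝔸) (i₁ 0) := by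
      rw [map_zero]; exact hasStrictFDerivAt_cayley
    refine (h.comp 0 i₁.hasStrictFDerivAt).congr_fderiv ?_
    ext x <;> simp
  have d2 : HasStrictFDerivAt (fun w : S × H => cayley (w.2 : 𝔸)) ((2 : ℂ) • i₂) 0 := by
    have h : HasStrictFDerivAt (cayley : 𝔸 → 𝔸) ((2 : ℂ) • ContinuousLinearMap.id ℂ 𝔸) (i₂ 0) := by
      rw [map_zero]; exact hasStrictFDerivAt_cayley
    refine (h.comp 0 i₂.hasStrictFDerivAt).congr_fderiv ?_
    ext x <;> simp
  have dF : HasStrictFDerivAt F ((2 : ℂ) • (i₁ + i₂)) 0 := by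
    refine (d1.mul' d2).congr_fderiv ?_
    ext x <;> simp [cayley_zero, add_comm]
  -- The factor `2` from the Cayley transforms cancels the `1 / 2` from the inverse transform,
  -- leaving the projection of `x + y`; this is surjective onto `b` because `S` and `H` together
  -- span it.
  have dΘ : HasStrictFDerivAt (fun w => prc (cayleyInv (F w))) (prc.comp (i₁ + i₂)) 0 := by
    have h : HasStrictFDerivAt (cayleyInv : 𝔸 → 𝔸) ((1 / 2 : ℂ) • ContinuousLinearMap.id ℂ 𝔸)
        (F 0) := by
      rw [hF0]; exact hasStrictFDerivAt_cayleyInv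
    refine (prc.hasStrictFDerivAt.comp 0 (h.comp 0 dF)).congr_fderiv ?_
    ext x <;> simp
  have hsurj : (prc.comp (i₁ + i₂)).range = ⊤ := by
    rw [eq_top_iff]
    rintro X -
    obtain ⟨x, hx, y, hy, hxy⟩ := Submodule.mem_sup.1 (hSH X.2)
    refine ⟨(⟨x, hx⟩, ⟨y, hy⟩), ?_⟩
    have : prc (x + y) = X := by rw [hxy]; exact hprb X
    simpa [hi₁, hi₂] using this
  have hmap := dΘ.map_nhds_eq_of_surj hsurj
  have hv0 : prc (cayleyInv (F 0)) = 0 := by rw [hF0]; simp [cayleyInv]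
  rw [hv0] at hmap
  rw [← hmap, eventually_map]
  have two_unit : IsUnit (1 + 1 : 𝔸) := by
    have : (1 + 1 : 𝔸) = algebraMap ℂ 𝔸 2 := by
      rw [show (2 : ℂ) = 1 + 1 by norm_num, map_add, map_one]
    rw [this]
    exact (isUnit_iff_ne_zero.2 two_ne_zero).map _
  have c1 : Continuous fun w : S × H => (1 - (w.1 : 𝔸)) := by fun_prop
  have c2 : Continuous fun w : S × H => (1 - (w.2 : 𝔸)) := by fun_prop
  have c3 : Continuous fun w : S × H => (1 + (w.1 : 𝔸)) := by fun_prop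
  have c4 : Continuous fun w : S × H => (1 + (w.2 : 𝔸)) := by fun_prop
  filter_upwards [eventually_isUnit c1.continuousAt (by simp) isUnit_one,
    eventually_isUnit c2.continuousAt (by simp) isUnit_one,
    eventually_isUnit c3.continuousAt (by simp) isUnit_one,
    eventually_isUnit c4.continuousAt (by simp) isUnit_one,
    eventually_isUnit (dF.continuousAt.add_const 1) (by rw [hF0]) two_unit]
    with w h1 h2 h3 h4 h5
  refine ⟨w.1, w.1.2, w.2, w.2.2, h1, h2, h3, h4, ?_⟩
  have hmem := hb w.1 (hS w.1.2) w.2 (hH w.2.2) h1 h2 h3 h4 h5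
  have : prc (cayleyInv (F w)) = ⟨cayleyInv (F w), hmem⟩ := hprb ⟨_, hmem⟩
  rw [this]
  exact (cayley_cayleyInv _ h5).2

/-- At `0` the Cayley transform equals `1` with derivative `2`, so the first term contributes twice
a commutator. In the second term `ζ` vanishes at `0`, so only its own derivative survives. -/
theorem hasStrictFDerivAt_cayley_conj {E : Type*} [NormedAddCommGroup E] [NormedSpace ℂ E]
    (ξ ζ : E →L[ℂ] 𝔸) (P : 𝔸) (low : 𝔸 →L[ℂ] 𝔸) :
    ∃ D : E →L[ℂ] 𝔸, (∀ v, D v = (2 : ℂ) • (ξ v * P - P * ξ v) + low (ζ v)) ∧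
      HasStrictFDerivAt (fun y => cayley (ξ y) * P * cayley (-ξ y) +
        low (cayley (ξ y) * ζ y * cayley (-ξ y))) D 0 := by
  have d1 : HasStrictFDerivAt (fun y => cayley (ξ y)) ((2 : ℂ) • ξ) 0 := by
    have h : HasStrictFDerivAt (cayley : 𝔸 → 𝔸) ((2 : ℂ) • ContinuousLinearMap.id ℂ 𝔸) (ξ 0) := by
      rw [map_zero]; exact hasStrictFDerivAt_cayley
    refine (h.comp 0 ξ.hasStrictFDerivAt).congr_fderiv ?_
    ext x; simp
  have d2 : HasStrictFDerivAt (fun y => cayley (-ξ y)) (-((2 : ℂ) • ξ)) 0 := by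
    have h : HasStrictFDerivAt (cayley : 𝔸 → 𝔸) ((2 : ℂ) • ContinuousLinearMap.id ℂ 𝔸)
        ((-ξ) 0) := by
      rw [map_zero]; exact hasStrictFDerivAt_cayley
    refine (h.comp 0 (-ξ).hasStrictFDerivAt).congr_fderiv ?_
    ext x; simp
  have h := ((d1.mul_const' P).mul' d2).add
    (low.hasStrictFDerivAt.comp 0 ((d1.mul' ζ.hasStrictFDerivAt).mul' d2))
  refine ⟨_, fun v => ?_, h⟩
  simp [cayley_zero, smul_sub]
  abel

end Cayley

/-- The Lie algebra of `B̃_N`. -/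
noncomputable def borelLie (n : ℕ) : Submodule ℂ (Matrix (Fin (2 * n)) (Fin (2 * n)) ℂ) where
  carrier := {X | X.BlockTriangular id ∧ adj n X = -X}
  zero_mem' := ⟨Matrix.blockTriangular_zero, by simp⟩
  add_mem' := by
    rintro A B ⟨h1, h2⟩ ⟨h1', h2'⟩
    exact ⟨h1.add h1', by rw [map_add, h2, h2', neg_add]⟩
  smul_mem' := by
    rintro c A ⟨h1, h2⟩
    exact ⟨fun i j h => by rw [Matrix.smul_apply, h1 h, smul_zero],
      by rw [map_smul, h2, smul_neg]⟩

/-- The Lie algebra of the stabilizer of `P` in `B̃_N`. -/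
noncomputable def stabLie (n : ℕ) (P : Matrix (Fin (2 * n)) (Fin (2 * n)) ℂ) :
    Submodule ℂ (Matrix (Fin (2 * n)) (Fin (2 * n)) ℂ) where
  carrier := {X | X ∈ borelLie n ∧ X * P = P * X}
  zero_mem' := ⟨zero_mem _, by simp⟩
  add_mem' := by
    rintro A B ⟨h1, h2⟩ ⟨h1', h2'⟩
    exact ⟨add_mem h1 h1', by rw [add_mul, mul_add, h2, h2']⟩
  smul_mem' := by
    rintro c A ⟨h1, h2⟩
    exact ⟨Submodule.smul_mem _ _ h1, by rw [Matrix.smul_mul, Matrix.mul_smul, h2]⟩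

/-! ### The Cayley transform between the Lie algebra and the group `B̃_N` -/

theorem ring_inverse_eq_inv {N : ℕ} (A : Matrix (Fin N) (Fin N) ℂ) : Ring.inverse A = A⁻¹ :=
  (Matrix.nonsing_inv_eq_ringInverse A).symm

theorem blockTriangular_ring_inverse {N : ℕ} {A : Matrix (Fin N) (Fin N) ℂ}
    (hA : A.BlockTriangular id) (hu : IsUnit A) : (Ring.inverse A).BlockTriangular id := by
  rw [ring_inverse_eq_inv]
  have : Invertible A := hu.invertible
  exact Matrix.blockTriangular_inv_of_blockTriangular hA

theorem adj_ring_inverse {n : ℕ} {A : Matrix (Fin (2 * n)) (Fin (2 * n)) ℂ} (hu : IsUnit A) :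
    adj n (Ring.inverse A) = Ring.inverse (adj n A) := by
  have h1 : adj n A * adj n (Ring.inverse A) = 1 := by
    rw [← adj_mul, Ring.inverse_mul_cancel _ hu, adj_one]
  rw [ring_inverse_eq_inv (adj n A)]
  exact (Matrix.inv_eq_right_inv h1).symm

theorem cayley_mul_cayley_neg {R : Type*} [Ring R] {x : R} (h1 : IsUnit (1 - x))
    (h2 : IsUnit (1 + x)) : cayley x * cayley (-x) = 1 := by
  rw [cayley, cayley, sub_neg_eq_add, ← sub_eq_add_neg]
  calc _ = (1 + x) * (Ring.inverse (1 - x) * (1 - x)) * Ring.inverse (1 + x) := by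
        simp only [mul_assoc]
    _ = 1 := by rw [Ring.inverse_mul_cancel _ h1, mul_one, Ring.mul_inverse_cancel _ h2]

theorem cayley_inv {N : ℕ} {X : Matrix (Fin N) (Fin N) ℂ} (h1 : IsUnit (1 - X))
    (h2 : IsUnit (1 + X)) : (cayley X)⁻¹ = cayley (-X) :=
  Matrix.inv_eq_right_inv (cayley_mul_cayley_neg h1 h2)

theorem inverse_mul_eq_mul_inverse {R : Type*} [Ring R] {u v : R} (hu : IsUnit u)
    (h : u * v = v * u) : Ring.inverse u * v = v * Ring.inverse u := by
  calc Ring.inverse u * v = Ring.inverse u * (v * u) * Ring.inverse u := by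
        rw [mul_assoc, mul_assoc, Ring.mul_inverse_cancel _ hu, mul_one]
    _ = Ring.inverse u * u * v * Ring.inverse u := by rw [← h]; simp only [mul_assoc]
    _ = _ := by rw [Ring.inverse_mul_cancel _ hu, one_mul]

/-- The adjoint is an anti-automorphism that negates `X`, so it sends `cayley X` to `cayley (-X)`,
which is its inverse. -/
theorem cayley_mem_borel {n : ℕ} {X : Matrix (Fin (2 * n)) (Fin (2 * n)) ℂ}
    (hX : X ∈ borelLie n) (h1 : IsUnit (1 - X)) (h2 : IsUnit (1 + X)) : cayley X ∈ borel n := by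
  obtain ⟨ht, ha⟩ := hX
  rw [mem_borel_iff]
  refine ⟨(Matrix.blockTriangular_one.add ht).mul
    (blockTriangular_ring_inverse (Matrix.blockTriangular_one.sub ht) h1), ?_⟩
  have : adj n (cayley X) = cayley (-X) := by
    rw [cayley, adj_mul, adj_ring_inverse h1, map_sub, map_add, ha, adj_one, cayley,
      sub_neg_eq_add, ← sub_eq_add_neg]
    exact inverse_mul_eq_mul_inverse h2 (by noncomm_ring)
  rw [this, cayley_mul_cayley_neg h1 h2]

theorem cayleyInv_mem_borelLie {n : ℕ} {U : Matrix (Fin (2 * n)) (Fin (2 * n)) ℂ}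
    (hU : U ∈ borel n) (h : IsUnit (U + 1)) : cayleyInv U ∈ borelLie n := by
  have hU' := (mem_borel_iff n U).1 hU
  refine ⟨(hU'.1.sub Matrix.blockTriangular_one).mul
    (blockTriangular_ring_inverse (hU'.1.add Matrix.blockTriangular_one) h), ?_⟩
  -- This is `U⁻¹ + 1 = (U + 1) U⁻¹`; it expresses the inverse of `adj n U + 1` through that of `U +
  -- 1`.
  have e1 : adj n U + 1 = (U + 1) * adj n U := by rw [add_mul, hU'.2, one_mul, add_comm]
  have e2 : Ring.inverse (adj n U + 1) = U * Ring.inverse (U + 1) := by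
    rw [ring_inverse_eq_inv]
    refine Matrix.inv_eq_right_inv ?_
    rw [e1, mul_assoc, ← mul_assoc _ U, adj_mul_of_mem_borel hU, one_mul,
      Ring.mul_inverse_cancel _ h]
  rw [cayleyInv, adj_mul, adj_ring_inverse h, map_sub, map_add, adj_one, e2,
    ← inverse_mul_eq_mul_inverse h (by noncomm_ring), mul_assoc, mul_sub, hU'.2, mul_one,
    inverse_mul_eq_mul_inverse h (by noncomm_ring), ← neg_mul, neg_sub]

theorem isUnit_one_add_cayleyInv {R : Type*} [Ring R] [Algebra ℂ R] {u : R} (hu : IsUnit u)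
    (h : IsUnit (u + 1)) : IsUnit (1 + cayleyInv u) := by
  obtain ⟨h1, h2⟩ := cayley_cayleyInv u h
  have : 1 + cayleyInv u = u * (1 - cayleyInv u) := by
    conv_rhs => rw [← h2]
    rw [h2]
    have h3 : (1 + cayleyInv u) * Ring.inverse (1 - cayleyInv u) = u := h2
    rw [← h3, h3, ← h3, mul_assoc, h3, Ring.inverse_mul_cancel _ h1, mul_one]
  rw [this]
  exact hu.mul h1

/-! ### The orbit map as a rational map -/

/-- The matrix of linear forms of a linear map into matrices. -/
noncomputable def genMat {N m : ℕ} (ξ : (Fin m → ℂ) →ₗ[ℂ] Matrix (Fin N) (Fin N) ℂ) :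
    Matrix (Fin N) (Fin N) (MvPolynomial (Fin m) ℂ) :=
  Matrix.of fun i j => ∑ k, MvPolynomial.C (ξ (Pi.single k 1) i j) * MvPolynomial.X k

theorem eval_genMat {N m : ℕ} (ξ : (Fin m → ℂ) →ₗ[ℂ] Matrix (Fin N) (Fin N) ℂ)
    (y : Fin m → ℂ) : (MvPolynomial.eval y).mapMatrix (genMat ξ) = ξ y := by
  ext i j
  have h1 : y = ∑ k, y k • (Pi.single k 1 : Fin m → ℂ) := by
    ext l
    simp [Finset.sum_apply, Pi.single_apply]
  conv_rhs => rw [h1]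
  simp only [genMat, RingHom.mapMatrix_apply, Matrix.map_apply, Matrix.of_apply, map_sum, map_mul,
    MvPolynomial.eval_C, MvPolynomial.eval_X, map_smul, Matrix.sum_apply, Matrix.smul_apply,
    smul_eq_mul]
  exact Finset.sum_congr rfl fun k _ => mul_comm _ _

/-- The common denominator of the orbit map in Cayley coordinates. -/
noncomputable def orbitDen {N m : ℕ} (ξ : (Fin m → ℂ) →ₗ[ℂ] Matrix (Fin N) (Fin N) ℂ) :
    MvPolynomial (Fin m) ℂ :=
  (1 - genMat ξ).det * (1 + genMat ξ).det

/-- The numerators of the orbit map in Cayley coordinates. -/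
noncomputable def orbitNum {N m : ℕ} (P : Matrix (Fin N) (Fin N) ℂ)
    (ξ ζ : (Fin m → ℂ) →ₗ[ℂ] Matrix (Fin N) (Fin N) ℂ) (i j : Fin N) : MvPolynomial (Fin m) ℂ :=
  ((1 + genMat ξ) * (1 - genMat ξ).adjugate * P.map MvPolynomial.C *
      ((1 - genMat ξ) * (1 + genMat ξ).adjugate) :
        Matrix (Fin N) (Fin N) (MvPolynomial (Fin m) ℂ)) i j +
    if j < i then ((1 + genMat ξ) * (1 - genMat ξ).adjugate * genMat ζ *
      ((1 - genMat ξ) * (1 + genMat ξ).adjugate) :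
        Matrix (Fin N) (Fin N) (MvPolynomial (Fin m) ℂ)) i j else 0

theorem eval_orbitDen {N m : ℕ} (ξ : (Fin m → ℂ) →ₗ[ℂ] Matrix (Fin N) (Fin N) ℂ)
    (y : Fin m → ℂ) :
    MvPolynomial.eval y (orbitDen ξ) = (1 - ξ y).det * (1 + ξ y).det := by
  rw [orbitDen, map_mul, RingHom.map_det, RingHom.map_det, map_sub, map_add, map_one, eval_genMat]

theorem eval_orbitDen_ne_zero_iff {N m : ℕ} (ξ : (Fin m → ℂ) →ₗ[ℂ] Matrix (Fin N) (Fin N) ℂ)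
    (y : Fin m → ℂ) :
    MvPolynomial.eval y (orbitDen ξ) ≠ 0 ↔ IsUnit (1 - ξ y) ∧ IsUnit (1 + ξ y) := by
  rw [eval_orbitDen, Matrix.isUnit_iff_isUnit_det, Matrix.isUnit_iff_isUnit_det,
    isUnit_iff_ne_zero, isUnit_iff_ne_zero, mul_ne_zero_iff]

/-- Adjugates replace inverses in the numerators, which multiplies the two Cayley factors by `det (1
- ξ y)` and `det (1 + ξ y)`; the product of these is the denominator. -/
theorem eval_orbitNum_div {N m : ℕ} (P : Matrix (Fin N) (Fin N) ℂ)
    (ξ ζ : (Fin m → ℂ) →ₗ[ℂ] Matrix (Fin N) (Fin N) ℂ) (y : Fin m → ℂ)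
    (h : MvPolynomial.eval y (orbitDen ξ) ≠ 0) (i j : Fin N) :
    MvPolynomial.eval y (orbitNum P ξ ζ i j) / MvPolynomial.eval y (orbitDen ξ) =
      (cayley (ξ y) * P * cayley (-ξ y) +
        lowPart N (cayley (ξ y) * ζ y * cayley (-ξ y))) i j := by
  have hu := (eval_orbitDen_ne_zero_iff ξ y).1 h
  rw [Matrix.isUnit_iff_isUnit_det, Matrix.isUnit_iff_isUnit_det] at hu
  have hadj : ∀ A : Matrix (Fin N) (Fin N) ℂ, IsUnit A.det →
      A.adjugate = A.det • Ring.inverse A := by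
    intro A hA
    rw [ring_inverse_eq_inv, Matrix.inv_def, smul_smul, Ring.mul_inverse_cancel _ hA, one_smul]
  have hP : (MvPolynomial.eval y).mapMatrix (P.map MvPolynomial.C) = P := by
    ext i j; simp
  have hR : ∀ Z : Matrix (Fin N) (Fin N) (MvPolynomial (Fin m) ℂ),
      (MvPolynomial.eval y).mapMatrix ((1 + genMat ξ) * (1 - genMat ξ).adjugate * Z *
        ((1 - genMat ξ) * (1 + genMat ξ).adjugate)) = MvPolynomial.eval y (orbitDen ξ) •
        (cayley (ξ y) * (MvPolynomial.eval y).mapMatrix Z * cayley (-ξ y)) := by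
    intro Z
    simp only [map_mul, map_add, map_sub, map_one, RingHom.map_adjugate, eval_genMat]
    rw [hadj _ hu.1, hadj _ hu.2, eval_orbitDen, cayley, cayley, sub_neg_eq_add,
      ← sub_eq_add_neg]
    simp only [Matrix.mul_smul, Matrix.smul_mul, smul_smul]
    rw [mul_comm (1 + ξ y).det]
  have he : ∀ (Z : Matrix (Fin N) (Fin N) (MvPolynomial (Fin m) ℂ)) (i j : Fin N),
      MvPolynomial.eval y (Z i j) = (MvPolynomial.eval y).mapMatrix Z i j := fun Z i j => rfl
  rw [div_eq_iff h, orbitNum, map_add, he, hR, hP, Matrix.add_apply, lowPart_apply,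
    Matrix.smul_apply, smul_eq_mul]
  split_ifs with hij
  · rw [he, hR, eval_genMat, Matrix.smul_apply, smul_eq_mul]
    ring
  · rw [map_zero]
    ring

/-- Matrices as functions of pairs of indices. -/
def entryEquiv (N : ℕ) : Matrix (Fin N) (Fin N) ℂ ≃ₗ[ℂ] (Fin N × Fin N → ℂ) :=
  (LinearEquiv.curry ℂ ℂ (Fin N) (Fin N)).symm

theorem entryEquiv_apply (N : ℕ) (A : Matrix (Fin N) (Fin N) ℂ) (ij : Fin N × Fin N) :
    entryEquiv N A ij = A ij.1 ij.2 := rfl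

theorem orbitPoint_cayley {n : ℕ} (P B : Matrix (Fin (2 * n)) (Fin (2 * n)) ℂ)
    {X : Matrix (Fin (2 * n)) (Fin (2 * n)) ℂ} (h1 : IsUnit (1 - X)) (h2 : IsUnit (1 + X)) :
    orbitPoint n P (cayley X) B =
      cayley X * P * cayley (-X) + lowPart _ (cayley X * B * cayley (-X)) := by
  rw [orbitPoint, cayley_inv h1 h2]

theorem eval_orbit_eq {n m : ℕ} (P : Matrix (Fin (2 * n)) (Fin (2 * n)) ℂ)
    (ξ ζ : (Fin m → ℂ) →ₗ[ℂ] Matrix (Fin (2 * n)) (Fin (2 * n)) ℂ) (y : Fin m → ℂ)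
    (h : MvPolynomial.eval y (orbitDen ξ) ≠ 0) :
    (fun ij : Fin (2 * n) × Fin (2 * n) => MvPolynomial.eval y (orbitNum P ξ ζ ij.1 ij.2) /
      MvPolynomial.eval y (orbitDen ξ)) =
      entryEquiv _ (orbitPoint n P (cayley (ξ y)) (ζ y)) := by
  obtain ⟨h1, h2⟩ := (eval_orbitDen_ne_zero_iff ξ y).1 h
  ext ij
  rw [eval_orbitNum_div P ξ ζ y h, entryEquiv_apply, orbitPoint_cayley _ _ h1 h2]

theorem orbitDen_ne_zero {N m : ℕ} (ξ : (Fin m → ℂ) →ₗ[ℂ] Matrix (Fin N) (Fin N) ℂ) :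
    orbitDen ξ ≠ 0 := by
  intro h
  have := (eval_orbitDen_ne_zero_iff ξ 0).2 (by simp)
  rw [h, map_zero] at this
  exact this rfl

/-- A stabilizing factor can be absorbed into the fibre variable. This is why group elements from a
complement of the stabilizer suffice. -/
theorem orbitPoint_mul {n : ℕ} {P B g k : Matrix (Fin (2 * n)) (Fin (2 * n)) ℂ}
    (hg : g ∈ borel n) (hk : k * P * k⁻¹ = P) :
    orbitPoint n P (g * k) B = orbitPoint n P g (lowPart _ (k * B * k⁻¹)) := by
  have hg' := (mem_borel_iff n g).1 hg
  rw [orbitPoint, orbitPoint, Matrix.mul_inv_rev, inv_eq_adj hg,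
    lowPart_conj hg'.1 (blockTriangular_adj hg'.1)]
  congr 1
  · conv_rhs => rw [← hk]
    simp only [mul_assoc]
  · simp only [mul_assoc]

theorem cayley_conj_eq_self {N : ℕ} {P X : Matrix (Fin N) (Fin N) ℂ} (hX : X * P = P * X)
    (h1 : IsUnit (1 - X)) (h2 : IsUnit (1 + X)) : cayley X * P * (cayley X)⁻¹ = P := by
  have h3 : Ring.inverse (1 - X) * P = P * Ring.inverse (1 - X) :=
    inverse_mul_eq_mul_inverse h1 (by rw [sub_mul, mul_sub, one_mul, mul_one, hX])
  have h4 : cayley X * P = P * cayley X := by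
    rw [cayley, mul_assoc, h3, ← mul_assoc, ← mul_assoc, add_mul, mul_add, one_mul, mul_one, hX]
  rw [h4, mul_assoc, cayley_inv h1 h2, cayley_mul_cayley_neg h1 h2, mul_one]

/-! ### Density of the Cayley chart and the dimension of a stratum -/

section Orbit

attribute [local instance] Matrix.linftyOpNormedRing Matrix.linftyOpNormedAlgebra

/-- Near `0` the element `cayley X` factors as `cayley x * cayley η` with `x ∈ S` and `η` in the
stabilizer, whose factor is absorbed into the fibre. So `p` vanishes near `0` on the linear space of
all pairs `(X, B)`, and the identity theorem for rational functions removes the restriction. -/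
theorem eval_orbitPoint_cayley_eq_zero {s : ℂ} {n : ℕ}
    {P : Matrix (Fin (2 * n)) (Fin (2 * n)) ℂ} (hP : P.BlockTriangular id)
    {S : Submodule ℂ (Matrix (Fin (2 * n)) (Fin (2 * n)) ℂ)} (hS : S ≤ borelLie n)
    (hSH : borelLie n ≤ S ⊔ stabLie n P) (p : MvPolynomial (Fin (2 * n) × Fin (2 * n)) ℂ)
    (hp : ∀ x ∈ S, ∀ B ∈ fibre s n P, IsUnit (1 - x) → IsUnit (1 + x) →
      MvPolynomial.eval (entryEquiv _ (orbitPoint n P (cayley x) B)) p = 0)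
    {X B : Matrix (Fin (2 * n)) (Fin (2 * n)) ℂ} (hX : X ∈ borelLie n) (hB : B ∈ fibre s n P)
    (h1 : IsUnit (1 - X)) (h2 : IsUnit (1 + X)) :
    MvPolynomial.eval (entryEquiv _ (orbitPoint n P (cayley X) B)) p = 0 := by
  have : CompleteSpace (Matrix (Fin (2 * n)) (Fin (2 * n)) ℂ) := FiniteDimensional.complete ℂ _
  have hloc := eventually_exists_cayley_mul (borelLie n) S (stabLie n P) hS (fun _ h => h.1) hSH
    fun x hx y hy hx1 hy1 hx2 hy2 hu => cayleyInv_mem_borelLie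
      (mul_mem_borel (cayley_mem_borel hx hx1 hx2) (cayley_mem_borel hy hy1 hy2)) hu
  set Ψ := (Module.finBasis ℂ (borelLie n × fibre s n P)).equivFun.symm with hΨ
  set ξ : (Fin _ → ℂ) →ₗ[ℂ] Matrix (Fin (2 * n)) (Fin (2 * n)) ℂ :=
    (borelLie n).subtype.comp ((LinearMap.fst ℂ _ _).comp Ψ.toLinearMap) with hξ
  set ζ : (Fin _ → ℂ) →ₗ[ℂ] Matrix (Fin (2 * n)) (Fin (2 * n)) ℂ :=
    (fibre s n P).subtype.comp ((LinearMap.snd ℂ _ _).comp Ψ.toLinearMap) with hζ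
  have hc : Continuous fun y => (Ψ y).1 :=
    ((LinearMap.fst ℂ _ _).comp Ψ.toLinearMap).continuous_of_finiteDimensional
  have hc0 : Tendsto (fun y => (Ψ y).1) (𝓝 0) (𝓝 0) := by
    have := hc.tendsto 0
    rwa [map_zero] at this
  have key := (eval_div_eq_zero_of_eventually
    (fun ij : Fin (2 * n) × Fin (2 * n) => orbitNum P ξ ζ ij.1 ij.2) (orbitDen ξ)
    (orbitDen_ne_zero ξ) p 0 ?_).1 (Ψ.symm (⟨X, hX⟩, ⟨B, hB⟩)) ?_
  · rw [eval_orbit_eq] at key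
    · simpa [hξ, hζ] using key
    · rw [eval_orbitDen_ne_zero_iff]
      simpa [hξ] using ⟨h1, h2⟩
  · filter_upwards [hc0.eventually hloc] with y hy hδ
    obtain ⟨x, hx, η, hη, hx1, hη1, hx2, hη2, he⟩ := hy
    rw [eval_orbit_eq P ξ ζ y hδ]
    have hk := cayley_conj_eq_self hη.2 hη1 hη2
    have hkb := cayley_mem_borel hη.1 hη1 hη2
    have he' : cayley (ξ y) = cayley x * cayley η := he
    rw [he', orbitPoint_mul (cayley_mem_borel (hS hx) hx1 hx2) hk]
    exact hp x hx _ (lowPart_conj_mem_fibre hP hkb (Ψ y).2.2 hk) hx1 hx2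
  · rw [eval_orbitDen_ne_zero_iff]
    simpa [hξ] using ⟨h1, h2⟩

/-- A one-parameter subgroup of the torus of `B̃_N`. -/
noncomputable def torus (n : ℕ) (t : ℂ) : Matrix (Fin (2 * n)) (Fin (2 * n)) ℂ :=
  Matrix.diagonal fun i => if (i : ℕ) < n then t else t⁻¹

theorem adj_torus (n : ℕ) (t : ℂ) : adj n (torus n t) = torus n t⁻¹ := by
  ext i j
  rw [adj_apply, torus, torus]
  by_cases h : i = j
  · subst h
    rw [Matrix.diagonal_apply_eq, Matrix.diagonal_apply_eq, sgn_mul_self, one_mul, inv_inv,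
      Fin.val_rev]
    have := i.2
    by_cases h : (i : ℕ) < n
    · rw [if_neg (by omega), if_pos h]
    · rw [if_pos (by omega), if_neg h]
  · rw [Matrix.diagonal_apply_ne _ h,
      Matrix.diagonal_apply_ne _ (fun h' => h (Fin.rev_injective h').symm), mul_zero]

theorem torus_mem_borel (n : ℕ) {t : ℂ} (ht : t ≠ 0) : torus n t ∈ borel n := by
  rw [mem_borel_iff, adj_torus]
  refine ⟨Matrix.blockTriangular_diagonal _, ?_⟩
  rw [torus, torus, Matrix.diagonal_mul_diagonal, ← Matrix.diagonal_one]
  congr 1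
  ext i
  split_ifs
  · exact mul_inv_cancel₀ ht
  · rw [inv_inv]; exact inv_mul_cancel₀ ht

/-- Conjugation by a diagonal matrix only rescales entries, which makes the dependence on `t`
explicit and continuous. -/
theorem orbitPoint_torus_mul {n : ℕ} {P B g : Matrix (Fin (2 * n)) (Fin (2 * n)) ℂ} {t : ℂ}
    (ht : t ≠ 0) (i j : Fin (2 * n)) :
    orbitPoint n P (torus n t * g) B i j = (if (i : ℕ) < n then t else t⁻¹) *
      (if (j : ℕ) < n then t⁻¹ else t) * orbitPoint n P g B i j := by
  have e : ∀ Z : Matrix (Fin (2 * n)) (Fin (2 * n)) ℂ,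
      (torus n t * g * Z * (torus n t * g)⁻¹) i j = (if (i : ℕ) < n then t else t⁻¹) *
      (if (j : ℕ) < n then t⁻¹ else t) * (g * Z * g⁻¹) i j := by
    intro Z
    rw [Matrix.mul_inv_rev, inv_eq_adj (torus_mem_borel n ht), adj_torus]
    have : torus n t * g * Z * (g⁻¹ * torus n t⁻¹) = torus n t * (g * Z * g⁻¹) * torus n t⁻¹ := by
      noncomm_ring
    rw [this, torus, torus, Matrix.mul_diagonal, Matrix.diagonal_mul, inv_inv]
    ring
  rw [orbitPoint, orbitPoint, Matrix.add_apply, Matrix.add_apply, lowPart_apply, lowPart_apply,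
    e, e]
  split_ifs <;> ring

/-- The Cayley transform misses exactly those `g` with `g + 1` singular. Multiplying by a torus
element `t ≠ 1` close to `1` avoids them, and letting `t` tend to `1` recovers `g` by continuity. -/
theorem eval_orbitPoint_eq_zero {s : ℂ} {n : ℕ}
    {P : Matrix (Fin (2 * n)) (Fin (2 * n)) ℂ} (hP : P.BlockTriangular id)
    {S : Submodule ℂ (Matrix (Fin (2 * n)) (Fin (2 * n)) ℂ)} (hS : S ≤ borelLie n)
    (hSH : borelLie n ≤ S ⊔ stabLie n P) (p : MvPolynomial (Fin (2 * n) × Fin (2 * n)) ℂ)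
    (hp : ∀ x ∈ S, ∀ B ∈ fibre s n P, IsUnit (1 - x) → IsUnit (1 + x) →
      MvPolynomial.eval (entryEquiv _ (orbitPoint n P (cayley x) B)) p = 0)
    {g B : Matrix (Fin (2 * n)) (Fin (2 * n)) ℂ} (hg : g ∈ borel n) (hB : B ∈ fibre s n P) :
    MvPolynomial.eval (entryEquiv _ (orbitPoint n P g B)) p = 0 := by
  have hg' := (mem_borel_iff n g).1 hg
  set F : ℂ → ℂ := fun t => MvPolynomial.eval (fun ij : Fin (2 * n) × Fin (2 * n) =>
    (if (ij.1 : ℕ) < n then t else t⁻¹) * (if (ij.2 : ℕ) < n then t⁻¹ else t) *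
      orbitPoint n P g B ij.1 ij.2) p with hF
  have hF1 : F 1 = MvPolynomial.eval (entryEquiv _ (orbitPoint n P g B)) p := by
    simp only [hF, inv_one, ite_self, one_mul]
    rfl
  have hFt : ∀ t ≠ 0, F t = MvPolynomial.eval (entryEquiv _ (orbitPoint n P (torus n t * g) B)) p := by
    intro t ht
    simp only [hF]
    congr 2
    ext ij
    rw [entryEquiv_apply, orbitPoint_torus_mul ht]
  have hcont : ContinuousAt F 1 := by
    refine (MvPolynomial.continuous_eval p).continuousAt.comp ?_
    refine continuousAt_pi.2 fun ij => ?_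
    refine ContinuousAt.mul (ContinuousAt.mul ?_ ?_) continuousAt_const
    · split_ifs
      · exact continuousAt_id
      · exact continuousAt_inv₀ one_ne_zero
    · split_ifs
      · exact continuousAt_inv₀ one_ne_zero
      · exact continuousAt_id
  have hev : ∀ᶠ t in 𝓝[≠] (1 : ℂ), F t = 0 := by
    -- As `g` is upper triangular only its diagonal matters: an entry `-1` is moved away by any `t ≠
    -- 1`, and any other entry stays away from `-1` for `t` near `1`.
    have hdet : ∀ᶠ t in 𝓝[≠] (1 : ℂ), ∀ i : Fin (2 * n),
        (if (i : ℕ) < n then t else t⁻¹) * g i i + 1 ≠ 0 := by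
      rw [eventually_all]
      intro i
      by_cases hi : g i i = -1
      · filter_upwards [self_mem_nhdsWithin] with t ht h0
        rw [hi] at h0
        have h3 : (if (i : ℕ) < n then t else t⁻¹) = 1 := by linear_combination -h0
        split_ifs at h3
        · exact ht h3
        · exact ht (inv_eq_one.1 h3)
      · have hc : ContinuousAt (fun t : ℂ => (if (i : ℕ) < n then t else t⁻¹) * g i i + 1) 1 := by
          refine (ContinuousAt.mul ?_ continuousAt_const).add continuousAt_const
          split_ifs
          · exact continuousAt_id
          · exact continuousAt_inv₀ one_ne_zero
        refine (hc.eventually_ne ?_).filter_mono nhdsWithin_le_nhds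
        simp only [inv_one, ite_self, one_mul]
        exact fun h => hi (eq_neg_of_add_eq_zero_left h)
    have hne : ∀ᶠ t in 𝓝[≠] (1 : ℂ), t ≠ 0 :=
      (continuousAt_id.eventually_ne (by simp)).filter_mono nhdsWithin_le_nhds
    filter_upwards [hdet, hne] with t ht ht0
    have hu : torus n t * g ∈ borel n := mul_mem_borel (torus_mem_borel n ht0) hg
    have hut := (mem_borel_iff n _).1 hu
    have hunit : IsUnit (torus n t * g + 1) := by
      rw [Matrix.isUnit_iff_isUnit_det, Matrix.det_of_isUpperTriangular
        (hut.1.add Matrix.blockTriangular_one), isUnit_iff_ne_zero, Finset.prod_ne_zero_iff]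
      intro i _
      rw [Matrix.add_apply, Matrix.one_apply_eq, torus, Matrix.diagonal_mul]
      exact ht i
    have hU : IsUnit (torus n t * g) :=
      (Matrix.isUnit_iff_isUnit_det _).2 (Matrix.isUnit_det_of_right_inverse hut.2)
    obtain ⟨h1, h2⟩ := cayley_cayleyInv _ hunit
    rw [hFt t ht0, ← h2]
    exact eval_orbitPoint_cayley_eq_zero hP hS hSH p hp (cayleyInv_mem_borelLie hu hunit) hB h1
      (isUnit_one_add_cayleyInv hU hunit)
  rw [← hF1]
  refine tendsto_nhds_unique (hcont.tendsto.mono_left nhdsWithin_le_nhds :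
    Tendsto F (𝓝[≠] 1) (𝓝 (F 1))) ?_
  exact (tendsto_congr' hev).2 tendsto_const_nhds

theorem hasStrictFDerivAt_orbit {n m : ℕ} (P : Matrix (Fin (2 * n)) (Fin (2 * n)) ℂ)
    (ξ ζ : (Fin m → ℂ) →ₗ[ℂ] Matrix (Fin (2 * n)) (Fin (2 * n)) ℂ) :
    ∃ D : (Fin m → ℂ) →L[ℂ] (Fin (2 * n) × Fin (2 * n) → ℂ),
      (∀ v, D v = entryEquiv _ ((2 : ℂ) • (ξ v * P - P * ξ v) + lowPart _ (ζ v))) ∧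
      HasStrictFDerivAt (fun y (ij : Fin (2 * n) × Fin (2 * n)) =>
        MvPolynomial.eval y (orbitNum P ξ ζ ij.1 ij.2) / MvPolynomial.eval y (orbitDen ξ)) D 0 := by
  have : CompleteSpace (Matrix (Fin (2 * n)) (Fin (2 * n)) ℂ) := FiniteDimensional.complete ℂ _
  obtain ⟨D, hD, hDf⟩ := hasStrictFDerivAt_cayley_conj
    (LinearMap.toContinuousLinearMap ξ) (LinearMap.toContinuousLinearMap ζ) P
    (LinearMap.toContinuousLinearMap (lowPart (2 * n)))
  set E : Matrix (Fin (2 * n)) (Fin (2 * n)) ℂ →L[ℂ] (Fin (2 * n) × Fin (2 * n) → ℂ) :=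
    LinearMap.toContinuousLinearMap (entryEquiv (2 * n)).toLinearMap with hE
  refine ⟨E.comp D, fun v => congrArg E (hD v), ?_⟩
  have hδ : MvPolynomial.eval 0 (orbitDen ξ) ≠ 0 := (eval_orbitDen_ne_zero_iff ξ 0).2 (by simp)
  have h := E.hasStrictFDerivAt.comp 0 hDf
  -- The quotient of polynomials agrees with the Cayley expression only where the denominator is
  -- nonzero, which includes a neighbourhood of `0`.
  refine h.congr_of_eventuallyEq ?_
  have hc : ContinuousAt (fun y => MvPolynomial.eval y (orbitDen ξ)) 0 :=
    (MvPolynomial.continuous_eval (orbitDen ξ)).continuousAt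
  filter_upwards [hc.eventually_ne hδ] with y hy
  ext ij
  rw [eval_orbitNum_div P ξ ζ y hy]
  rfl

/-- The parameters are pairs in `S` times the fibre. If the derivative kills `(x, B)`, then twice
the commutator of `x` with `P`, which is upper triangular, cancels `B`, which is strictly lower
triangular; so both vanish, and `x` lies in `S` and in the stabilizer. -/
theorem zariskiDim_stratum_eq_finrank_add (a : Boundary) (n : ℕ) [NeZero (2 * n)]
    (π : Equiv.Perm (Fin (2 * n))) (hP : (invMatrix a n π).BlockTriangular id)
    (hPd : ∀ i, invMatrix a n π i i = 0) (hPP : invMatrix a n π * invMatrix a n π = 0)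
    (hPs : invMatrix a n π = bsign a • adj n (invMatrix a n π))
    {S : Submodule ℂ (Matrix (Fin (2 * n)) (Fin (2 * n)) ℂ)} (hS : S ≤ borelLie n)
    (hSH : borelLie n ≤ S ⊔ stabLie n (invMatrix a n π))
    (hdis : Disjoint S (stabLie n (invMatrix a n π))) :
    zariskiDim (stratum a n π) =
      (Module.finrank ℂ S + Module.finrank ℂ (fibre (bsign a) n (invMatrix a n π)) : ℕ) := by
  set P := invMatrix a n π with hPdef
  rw [← Module.finrank_prod]
  set Ψ := (Module.finBasis ℂ (S × fibre (bsign a) n P)).equivFun.symm with hΨ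
  set ξ : (Fin _ → ℂ) →ₗ[ℂ] Matrix (Fin (2 * n)) (Fin (2 * n)) ℂ :=
    S.subtype.comp ((LinearMap.fst ℂ _ _).comp Ψ.toLinearMap) with hξ
  set ζ : (Fin _ → ℂ) →ₗ[ℂ] Matrix (Fin (2 * n)) (Fin (2 * n)) ℂ :=
    (fibre (bsign a) n P).subtype.comp ((LinearMap.snd ℂ _ _).comp Ψ.toLinearMap) with hζ
  have hδ : MvPolynomial.eval 0 (orbitDen ξ) ≠ 0 := (eval_orbitDen_ne_zero_iff ξ 0).2 (by simp)
  obtain ⟨D, hD, hDf⟩ := hasStrictFDerivAt_orbit P ξ ζ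
  have hmemS : ∀ x, x ∈ stratum a n π ↔ ∃ g ∈ borel n, ∃ B ∈ fibre (bsign a) n P,
      malgEquiv (2 * n) x = orbitPoint n P g B := by
    intro x
    rw [mem_stratum_iff, mem_matStratum_iff hP hPd hPP hPs]
  refine zariskiDim_eq_of_parametrization ((malgEquiv (2 * n)).trans (entryEquiv (2 * n)))
    (stratum a n π) (fun ij => orbitNum P ξ ζ ij.1 ij.2) (orbitDen ξ) 0 hδ ?_ ?_ D hDf ?_
  · intro y hy
    obtain ⟨h1, h2⟩ := (eval_orbitDen_ne_zero_iff ξ y).1 hy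
    rw [eval_orbit_eq P ξ ζ y hy, hmemS]
    refine ⟨cayley (ξ y), cayley_mem_borel (hS (Ψ y).1.2) h1 h2, ζ y, (Ψ y).2.2, ?_⟩
    simp
  · intro p hp x hx
    obtain ⟨g, hg, B, hB, hxg⟩ := (hmemS x).1 hx
    rw [LinearEquiv.trans_apply, hxg]
    refine eval_orbitPoint_eq_zero hP hS hSH p (fun X hX B hB h1 h2 => ?_) hg hB
    have e1 : ξ (Ψ.symm (⟨X, hX⟩, ⟨B, hB⟩)) = X := by simp [hξ]
    have e2 : ζ (Ψ.symm (⟨X, hX⟩, ⟨B, hB⟩)) = B := by simp [hζ]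
    have hy : MvPolynomial.eval (Ψ.symm (⟨X, hX⟩, ⟨B, hB⟩)) (orbitDen ξ) ≠ 0 := by
      rw [eval_orbitDen_ne_zero_iff, e1]
      exact ⟨h1, h2⟩
    have := hp _ hy
    rwa [eval_orbit_eq P ξ ζ _ hy, e1, e2] at this
  · rw [injective_iff_map_eq_zero]
    intro v hv
    rw [hD, LinearEquiv.map_eq_zero_iff] at hv
    have hξv : ξ v ∈ borelLie n := hS (Ψ v).1.2
    have hζv : lowPart _ (ζ v) = ζ v := (Ψ v).2.2.1
    have hv' : (2 : ℂ) • (ξ v * P - P * ξ v) + ζ v = 0 := by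
      rw [← hv, hζv]
    have hup : ((2 : ℂ) • (ξ v * P - P * ξ v)).BlockTriangular id := by
      intro i j hij
      rw [Matrix.smul_apply, ((hξv.1.mul hP).sub (hP.mul hξv.1)) hij, smul_zero]
    have hζ0 : ζ v = 0 := by
      have := congrArg (lowPart (2 * n)) hv'
      rwa [map_add, lowPart_eq_zero_of_blockTriangular hup, hζv, zero_add, map_zero] at this
    have hξ0 : ξ v = 0 := by
      rw [hζ0, add_zero] at hv'
      have h3 := (smul_eq_zero.1 hv').resolve_left two_ne_zero
      have h4 : ξ v ∈ stabLie n P := ⟨hξv, sub_eq_zero.1 h3⟩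
      exact (Submodule.disjoint_def.1 hdis) _ (Ψ v).1.2 h4
    have : Ψ v = 0 := Prod.ext (Subtype.ext hξ0) (Subtype.ext hζ0)
    exact (LinearEquiv.map_eq_zero_iff Ψ).1 this

end Orbit

/-! ### Dimensions of spaces of matrices -/

/-- The strictly upper triangular matrices with `Z = s Z†`. -/
noncomputable def nilSym (s : ℂ) (n : ℕ) : Submodule ℂ (Matrix (Fin (2 * n)) (Fin (2 * n)) ℂ) where
  carrier := {Z | (∀ i j, j ≤ i → Z i j = 0) ∧ Z = s • adj n Z}
  zero_mem' := by simp
  add_mem' := by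
    rintro A B ⟨h1, h2⟩ ⟨h1', h2'⟩
    exact ⟨fun i j h => by rw [Matrix.add_apply, h1 i j h, h1' i j h, add_zero],
      by rw [map_add, smul_add, ← h2, ← h2']⟩
  smul_mem' := by
    rintro c A ⟨h1, h2⟩
    exact ⟨fun i j h => by rw [Matrix.smul_apply, h1 i j h, smul_zero],
      by rw [map_smul, smul_comm, ← h2]⟩

/-- The matrices in `nilSym 1 n` that anticommute with `P`. -/
noncomputable def antiComm (n : ℕ) (P : Matrix (Fin (2 * n)) (Fin (2 * n)) ℂ) :
    Submodule ℂ (Matrix (Fin (2 * n)) (Fin (2 * n)) ℂ) where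
  carrier := {Y | Y ∈ nilSym 1 n ∧ P * Y + Y * P = 0}
  zero_mem' := ⟨zero_mem _, by simp⟩
  add_mem' := by
    rintro A B ⟨h1, h2⟩ ⟨h1', h2'⟩
    exact ⟨add_mem h1 h1', by rw [add_mul, mul_add, add_add_add_comm, h2, h2', add_zero]⟩
  smul_mem' := by
    rintro c A ⟨h1, h2⟩
    exact ⟨Submodule.smul_mem _ _ h1, by
      rw [Matrix.smul_mul, Matrix.mul_smul, ← smul_add, h2, smul_zero]⟩

/-- The strictly lower triangular matrices with `A = s A†`. -/
noncomputable def lowSym (s : ℂ) (n : ℕ) : Submodule ℂ (Matrix (Fin (2 * n)) (Fin (2 * n)) ℂ) where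
  carrier := {A | lowPart _ A = A ∧ A = s • adj n A}
  zero_mem' := by simp
  add_mem' := by
    rintro A B ⟨h1, h2⟩ ⟨h1', h2'⟩
    exact ⟨by rw [map_add, h1, h1'], by rw [map_add, smul_add, ← h2, ← h2']⟩
  smul_mem' := by
    rintro c A ⟨h1, h2⟩
    exact ⟨by rw [map_smul, h1], by rw [map_smul, smul_comm, ← h2]⟩

theorem lowPart_eq_self_iff {N : ℕ} (A : Matrix (Fin N) (Fin N) ℂ) :
    lowPart N A = A ↔ ∀ i j, i ≤ j → A i j = 0 := by
  constructor
  · intro h i j hij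
    rw [← h, lowPart_apply, if_neg (not_lt.2 hij)]
  · intro h
    ext i j
    rw [lowPart_apply]
    split_ifs with hij
    · rfl
    · exact (h i j (not_lt.1 hij)).symm

theorem adj_transpose (n : ℕ) (A : Matrix (Fin (2 * n)) (Fin (2 * n)) ℂ) :
    adj n A.transpose = (adj n A).transpose := by
  ext i j
  rw [Matrix.transpose_apply, adj_apply, adj_apply, Matrix.transpose_apply]
  ring

theorem star_sgn (n : ℕ) (i : Fin (2 * n)) : star (sgn n i) = sgn n i := by
  unfold sgn; split_ifs <;> simp

theorem adj_conjTranspose (n : ℕ) (A : Matrix (Fin (2 * n)) (Fin (2 * n)) ℂ) :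
    adj n A.conjTranspose = (adj n A).conjTranspose := by
  ext i j
  rw [Matrix.conjTranspose_apply, adj_apply, adj_apply, Matrix.conjTranspose_apply, star_mul,
    star_mul, star_sgn, star_sgn]
  ring

theorem finrank_lowSym (s : ℂ) (n : ℕ) :
    Module.finrank ℂ (lowSym s n) = Module.finrank ℂ (nilSym s n) := by
  refine LinearEquiv.finrank_eq (LinearEquiv.ofSubmodules
    (Matrix.transposeLinearEquiv (Fin (2 * n)) (Fin (2 * n)) ℂ ℂ) _ _ ?_)
  ext Z
  rw [Submodule.mem_map]
  constructor
  · rintro ⟨A, ⟨h1, h2⟩, rfl⟩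
    rw [lowPart_eq_self_iff] at h1
    refine ⟨fun i j h => h1 j i h, ?_⟩
    change A.transpose = s • adj n A.transpose
    rw [adj_transpose, ← Matrix.transpose_smul, ← h2]
  · rintro ⟨h1, h2⟩
    refine ⟨Z.transpose, ⟨?_, ?_⟩, Matrix.transpose_transpose Z⟩
    · rw [lowPart_eq_self_iff]
      exact fun i j h => h1 j i h
    · rw [adj_transpose, ← Matrix.transpose_smul, ← h2]

-- For real `s` the conjugate transpose of `A` is itself an admissible test matrix, and `A * Aᴴ` has
-- trace zero only if `A = 0`. So the trace pairing is nondegenerate on the lower triangular side.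
open scoped ComplexOrder in
theorem eq_zero_of_trace_mul_eq_zero {s : ℂ} (hs : star s = s) {n : ℕ}
    {A : Matrix (Fin (2 * n)) (Fin (2 * n)) ℂ} (hA : A ∈ lowSym s n)
    (h : ∀ Z ∈ nilSym s n, (A * Z).trace = 0) : A = 0 := by
  rw [← Matrix.trace_mul_conjTranspose_self_eq_zero_iff]
  refine h _ ⟨fun i j hij => ?_, ?_⟩
  · rw [Matrix.conjTranspose_apply, (lowPart_eq_self_iff A).1 hA.1 j i hij, star_zero]
  · rw [adj_conjTranspose]
    conv_lhs => rw [hA.2]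
    rw [Matrix.conjTranspose_smul, hs]

theorem trace_lowPart_mul {N : ℕ} (W Y : Matrix (Fin N) (Fin N) ℂ)
    (hY : ∀ i j, j ≤ i → Y i j = 0) : (lowPart N W * Y).trace = (W * Y).trace := by
  simp only [Matrix.trace, Matrix.diag_apply, Matrix.mul_apply, lowPart_apply]
  refine Finset.sum_congr rfl fun i _ => Finset.sum_congr rfl fun j _ => ?_
  split_ifs with h
  · rfl
  · rw [hY j i (not_lt.1 h), mul_zero, mul_zero]

/-- The anticommutator with `P` is adjoint to itself for the trace form. -/
theorem finrank_fibre_add {s : ℂ} (hs : star s = s) (hss : s * s = 1) {n : ℕ}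
    {P : Matrix (Fin (2 * n)) (Fin (2 * n)) ℂ} (hP : ∀ i j, j ≤ i → P i j = 0)
    (hPs : P = s • adj n P) :
    Module.finrank ℂ (fibre s n P) + Module.finrank ℂ (nilSym 1 n) =
      Module.finrank ℂ (nilSym s n) + Module.finrank ℂ (antiComm n P) := by
  have hadjP : adj n P = s • P := by
    conv_rhs => rw [hPs]
    rw [smul_smul, hss, one_smul]
  set T₀ : Matrix (Fin (2 * n)) (Fin (2 * n)) ℂ →ₗ[ℂ] Matrix (Fin (2 * n)) (Fin (2 * n)) ℂ :=
    LinearMap.mulLeft ℂ P + LinearMap.mulRight ℂ P with hT₀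
  have hT₀a : ∀ Y, T₀ Y = P * Y + Y * P := fun Y => rfl
  have hmul : ∀ A B : Matrix (Fin (2 * n)) (Fin (2 * n)) ℂ, (∀ i j, j ≤ i → A i j = 0) →
      (∀ i j, j ≤ i → B i j = 0) → ∀ i j, j ≤ i → (A * B) i j = 0 := by
    intro A B hA hB i j hij
    rw [Matrix.mul_apply]
    refine Finset.sum_eq_zero fun k _ => ?_
    by_cases hk : k ≤ i
    · rw [hA i k hk, zero_mul]
    · rw [hB k j (hij.trans (not_le.1 hk).le), mul_zero]
  have hT₀m : ∀ Y ∈ nilSym 1 n, T₀ Y ∈ nilSym s n := by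
    rintro Y ⟨h1, h2⟩
    rw [one_smul] at h2
    refine ⟨fun i j hij => ?_, ?_⟩
    · rw [hT₀a, Matrix.add_apply, hmul _ _ hP h1 i j hij, hmul _ _ h1 hP i j hij, add_zero]
    · rw [hT₀a, map_add, adj_mul, adj_mul, ← h2, hadjP, Matrix.mul_smul, Matrix.smul_mul,
        ← smul_add, smul_smul, hss, one_smul, add_comm]
  set T : nilSym 1 n →ₗ[ℂ] nilSym s n := T₀.restrict hT₀m with hT
  have hker : Module.finrank ℂ (LinearMap.ker T) = Module.finrank ℂ (antiComm n P) := by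
    have : antiComm n P = (LinearMap.ker T).map (nilSym 1 n).subtype := by
      ext Y
      rw [Submodule.mem_map]
      constructor
      · rintro ⟨h1, h2⟩
        exact ⟨⟨Y, h1⟩, Subtype.ext h2, rfl⟩
      · rintro ⟨Y, hY, rfl⟩
        exact ⟨Y.2, congrArg Subtype.val hY⟩
    rw [this]
    exact (LinearEquiv.finrank_eq (Submodule.equivMapOfInjective _ (Submodule.injective_subtype _)
      _))
  set β : lowSym s n →ₗ[ℂ] Module.Dual ℂ (nilSym s n) :=
    LinearMap.mk₂ ℂ (fun A Z => ((A : Matrix (Fin (2 * n)) (Fin (2 * n)) ℂ) * Z).trace)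
      (by intros; simp [add_mul]) (by intros; simp) (by intros; simp [mul_add])
      (by intros; simp) with hβ
  have hβa : ∀ A Z, β A Z = ((A : Matrix (Fin (2 * n)) (Fin (2 * n)) ℂ) * Z).trace :=
    fun A Z => rfl
  have hβi : Function.Injective β := by
    rw [injective_iff_map_eq_zero]
    intro A hA
    refine Subtype.ext (eq_zero_of_trace_mul_eq_zero hs A.2 fun Z hZ => ?_)
    rw [← hβa A ⟨Z, hZ⟩, hA]; rfl
  set βe := LinearEquiv.ofInjectiveOfFinrankEq β hβi (by
    rw [finrank_lowSym, Subspace.dual_finrank_eq]) with hβe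
  -- By cyclicity of the trace, pairing `A` with `P * Y + Y * P` is pairing the lower part of `P * A
  -- + A * P` with `Y`. Hence the fibre condition on `A` says that `A` annihilates the range of `T`.
  have hfib : fibre s n P = (((LinearMap.range T).dualAnnihilator).comap β).map
      (lowSym s n).subtype := by
    ext A
    rw [Submodule.mem_map]
    have htr : ∀ Y : Matrix (Fin (2 * n)) (Fin (2 * n)) ℂ, (∀ i j, j ≤ i → Y i j = 0) →
        (A * (P * Y + Y * P)).trace = (lowPart _ (P * A + A * P) * Y).trace := by
      intro Y hY
      rw [trace_lowPart_mul _ _ hY, mul_add, add_mul, Matrix.trace_add, Matrix.trace_add,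
        ← mul_assoc, add_comm, ← mul_assoc A Y P, Matrix.trace_mul_comm (A * Y) P, mul_assoc P]
    constructor
    · rintro ⟨h1, h2, h3⟩
      refine ⟨⟨A, h1, h2⟩, ?_, rfl⟩
      rw [Submodule.mem_comap, Submodule.mem_dualAnnihilator]
      rintro _ ⟨Y, rfl⟩
      rw [hβa]
      change (A * (P * Y + Y * P)).trace = 0
      rw [htr Y Y.2.1, h3, zero_mul, Matrix.trace_zero]
    · rintro ⟨⟨A', h1, h2⟩, h3, rfl⟩
      refine ⟨h1, h2, ?_⟩
      rw [Submodule.mem_comap, Submodule.mem_dualAnnihilator] at h3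
      -- The sign is `1` here: `P` and `A'` both have sign `s`, so their anticommutator has sign `s
      -- * s = 1`, matching the domain of `T`.
      refine eq_zero_of_trace_mul_eq_zero (s := 1) (n := n) (by simp) ⟨lowPart_lowPart _ _, ?_⟩
        fun Y hY => ?_
      · rw [one_smul, adj_lowPart]
        have hadjA : adj n A' = s • A' := by
          conv_rhs => rw [h2]
          rw [smul_smul, hss, one_smul]
        change lowPart _ (P * A' + A' * P) = lowPart _ (adj n (P * A' + A' * P))
        rw [map_add (adj n), adj_mul, adj_mul, hadjA, hadjP]
        simp only [Matrix.smul_mul, Matrix.mul_smul, smul_smul, hss, one_smul]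
        rw [add_comm]
      · rw [← htr Y hY.1]
        exact h3 _ ⟨⟨Y, hY⟩, rfl⟩
  have h1 : Module.finrank ℂ (fibre s n P) =
      Module.finrank ℂ (LinearMap.range T).dualAnnihilator := by
    rw [hfib]
    refine ((Submodule.equivMapOfInjective _ (Submodule.injective_subtype _)
      _).finrank_eq).symm.trans ?_
    exact (βe.ofSubmodule' _).finrank_eq
  have h2 := Subspace.finrank_add_finrank_dualAnnihilator_eq (LinearMap.range T)
  have h3 := LinearMap.finrank_range_add_finrank_ker T
  omega

/-! ### The stabilizer of the matrix of an involution -/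

/-- `P` is a strictly upper triangular matrix whose nonzero entries are at the chords of the
mirror symmetric involution `π`. -/
structure IsChordMatrix (n : ℕ) (π : Equiv.Perm (Fin (2 * n)))
    (P : Matrix (Fin (2 * n)) (Fin (2 * n)) ℂ) : Prop where
  apply_apply : ∀ i, π (π i) = i
  apply_rev : ∀ i, π i.rev = (π i).rev
  eq_zero : ∀ i j, ¬ (i < j ∧ i = π j) → P i j = 0
  ne_zero : ∀ i j, i < j → i = π j → P i j ≠ 0

theorem isChordMatrix_zero (n : ℕ) : IsChordMatrix n 1 0 where
  apply_apply _ := rfl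
  apply_rev _ := rfl
  eq_zero _ _ _ := rfl
  ne_zero _ _ h h' := absurd h' h.ne

namespace IsChordMatrix

variable {n : ℕ} {π : Equiv.Perm (Fin (2 * n))} {P : Matrix (Fin (2 * n)) (Fin (2 * n)) ℂ}

theorem mul_apply (h : IsChordMatrix n π P) (X : Matrix (Fin (2 * n)) (Fin (2 * n)) ℂ)
    (i j : Fin (2 * n)) : (X * P) i j = X i (π j) * P (π j) j := by
  rw [Matrix.mul_apply, Finset.sum_eq_single (π j)]
  · intro k _ hk
    rw [h.eq_zero k j fun h' => hk h'.2, mul_zero]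
  · exact fun h' => absurd (Finset.mem_univ _) h'

theorem apply_mul (h : IsChordMatrix n π P) (X : Matrix (Fin (2 * n)) (Fin (2 * n)) ℂ)
    (i j : Fin (2 * n)) : (P * X) i j = P i (π i) * X (π i) j := by
  rw [Matrix.mul_apply, Finset.sum_eq_single (π i)]
  · intro k _ hk
    rw [h.eq_zero i k fun h' => hk (by rw [h'.2, h.apply_apply]), zero_mul]
  · exact fun h' => absurd (Finset.mem_univ _) h'

theorem lt_of_ne_zero_left (h : IsChordMatrix n π P) {i : Fin (2 * n)} (hp : P i (π i) ≠ 0) :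
    i < π i := by
  by_contra hc
  exact hp (h.eq_zero _ _ fun h' => hc h'.1)

theorem lt_of_ne_zero_right (h : IsChordMatrix n π P) {i : Fin (2 * n)} (hp : P (π i) i ≠ 0) :
    π i < i := by
  by_contra hc
  exact hp (h.eq_zero _ _ fun h' => hc h'.1)

end IsChordMatrix

/-- The signs relating commutation and anticommutation with a chord matrix. -/
noncomputable def twistSign (n : ℕ) (π : Equiv.Perm (Fin (2 * n))) (i j : Fin (2 * n)) : ℂ :=
  if i = j ∨ j = i.rev then 0
  else if i < π i ∧ j < π j then 1
  else if π i < i ∧ π j < j then -1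
  else if (i : ℕ) + j < 2 * n - 1 then 1 else -1

theorem twistSign_self (n : ℕ) (π : Equiv.Perm (Fin (2 * n))) (i : Fin (2 * n)) :
    twistSign n π i i = 0 := if_pos (Or.inl rfl)

theorem twistSign_mul_self (n : ℕ) (π : Equiv.Perm (Fin (2 * n))) {i j : Fin (2 * n)}
    (h1 : i ≠ j) (h2 : j ≠ i.rev) : twistSign n π i j * twistSign n π i j = 1 := by
  unfold twistSign
  rw [if_neg (by tauto)]
  split_ifs <;> norm_num

/-- Reflection exchanges openers with closers, and the two sides of the antidiagonal, so each case
of the definition meets its opposite. This sign change turns `X† = -X` into `Y† = Y`. -/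
theorem twistSign_rev {n : ℕ} {π : Equiv.Perm (Fin (2 * n))}
    (h : ∀ i, π i.rev = (π i).rev) (i j : Fin (2 * n)) :
    twistSign n π j.rev i.rev = -twistSign n π i j := by
  unfold twistSign
  by_cases h0 : i = j ∨ j = i.rev
  · rw [if_pos h0, if_pos, neg_zero]
    rcases h0 with rfl | rfl
    · exact Or.inl rfl
    · right
      simp
  · have h0' : ¬ (j.rev = i.rev ∨ i.rev = j.rev.rev) := by
      rw [Fin.rev_rev, Fin.rev_inj]
      tauto
    simp only [if_neg h0, if_neg h0', h, Fin.rev_lt_rev]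
    by_cases h1 : i < π i ∧ j < π j
    · rw [if_pos h1, if_neg (fun h2 => absurd h2.1 (not_lt.2 h1.2.le)), if_pos h1.symm]
    · rw [if_neg h1]
      by_cases h2 : π i < i ∧ π j < j
      · rw [if_pos h2, if_pos h2.symm, neg_neg]
      · rw [if_neg h2, if_neg (mt And.symm h2), if_neg (mt And.symm h1), Fin.val_rev, Fin.val_rev]
        have hi := i.2
        have hj := j.2
        have hne : (i : ℕ) + j ≠ 2 * n - 1 := by
          intro h3
          refine h0 (Or.inr (Fin.ext ?_))
          rw [Fin.val_rev]
          omega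
        by_cases h3 : (i : ℕ) + j < 2 * n - 1
        · rw [if_pos h3, if_neg (by omega)]
        · rw [if_neg h3, if_pos (by omega), neg_neg]

/-- Here `i` and `π j` are both openers while `π i` and `j` are both closers, so off the diagonal
and antidiagonal the signs are `1` and `-1`. These are the positions where both terms of the
commutation relation survive, and the relative sign makes it an anticommutation relation. -/
theorem twistSign_apply {n : ℕ} {π : Equiv.Perm (Fin (2 * n))} (h0 : ∀ i, π (π i) = i)
    (h : ∀ i, π i.rev = (π i).rev) {i j : Fin (2 * n)} (hi : i < π i) (hj : π j < j) :
    twistSign n π (π i) j = -twistSign n π i (π j) := by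
  unfold twistSign
  by_cases h1 : i = π j ∨ π j = i.rev
  · rw [if_pos h1, if_pos, neg_zero]
    rcases h1 with h1 | h1
    · exact Or.inl (by rw [h1, h0])
    · exact Or.inr (by rw [← h, ← h1, h0])
  · have h1' : ¬ (π i = j ∨ j = (π i).rev) := by
      rintro (h2 | h2)
      · exact h1 (Or.inl (by rw [← h2, h0]))
      · exact h1 (Or.inr (by rw [h2, h, h0]))
    rw [if_neg h1, if_neg h1', h0, h0, if_neg (fun h2 => absurd h2.1 hi.asymm), if_pos ⟨hi, hj⟩,
      if_pos ⟨hi, hj⟩]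

/-- Entrywise multiplication by the twist signs. -/
noncomputable def twist (n : ℕ) (π : Equiv.Perm (Fin (2 * n))) :
    Matrix (Fin (2 * n)) (Fin (2 * n)) ℂ →ₗ[ℂ] Matrix (Fin (2 * n)) (Fin (2 * n)) ℂ where
  toFun X := Matrix.of fun i j => twistSign n π i j * X i j
  map_add' X Y := by ext i j; simp [mul_add]
  map_smul' c X := by ext i j; simp; ring

theorem twist_apply (n : ℕ) (π : Equiv.Perm (Fin (2 * n)))
    (X : Matrix (Fin (2 * n)) (Fin (2 * n)) ℂ) (i j : Fin (2 * n)) :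
    twist n π X i j = twistSign n π i j * X i j := rfl

/-- An antidiagonal position is its own mirror image and acquires the sign `-1`. Thus the zeros of
the twist destroy no information on `nilSym 1 n`. -/
theorem apply_rev_of_mem_nilSym {n : ℕ} {Y : Matrix (Fin (2 * n)) (Fin (2 * n)) ℂ}
    (hY : Y ∈ nilSym 1 n) (i : Fin (2 * n)) : Y i i.rev = 0 := by
  have h := congrFun (congrFun hY.2 i) i.rev
  rw [one_smul, adj_apply, sgn_rev, Fin.rev_rev, mul_neg, sgn_mul_self, neg_one_mul] at h
  exact self_eq_neg.1 h

/-- Representatives `i ≤ n` of the orbits, under `π` and the reflection, of the points that are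
not joined to their mirror image. -/
def orbitReps (n : ℕ) (π : Equiv.Perm (Fin (2 * n))) : Finset (Fin (2 * n)) :=
  Finset.univ.filter fun i => (i : ℕ) < n ∧ π i ≠ i.rev ∧ i ≤ π i ∧ i ≤ (π i).rev

/-- The points `i ≤ n` that do not end a chord. -/
def nonClosers (n : ℕ) (π : Equiv.Perm (Fin (2 * n))) : Finset (Fin (2 * n)) :=
  Finset.univ.filter fun i => (i : ℕ) < n ∧ ¬ π i < i

theorem mem_orbitReps {n : ℕ} {π : Equiv.Perm (Fin (2 * n))} {i : Fin (2 * n)} :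
    i ∈ orbitReps n π ↔ (i : ℕ) < n ∧ π i ≠ i.rev ∧ i ≤ π i ∧ i ≤ (π i).rev := by
  simp [orbitReps]

theorem mem_nonClosers {n : ℕ} {π : Equiv.Perm (Fin (2 * n))} {i : Fin (2 * n)} :
    i ∈ nonClosers n π ↔ (i : ℕ) < n ∧ ¬ π i < i := by
  simp [nonClosers]

namespace IsChordMatrix

variable {n : ℕ} {π : Equiv.Perm (Fin (2 * n))} {P : Matrix (Fin (2 * n)) (Fin (2 * n)) ℂ}

theorem twist_mem (h : IsChordMatrix n π P) {X : Matrix (Fin (2 * n)) (Fin (2 * n)) ℂ}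
    (hX : X ∈ stabLie n P) : twist n π X ∈ antiComm n P := by
  obtain ⟨⟨hB, hs⟩, hc⟩ := hX
  refine ⟨⟨fun i j hij => ?_, ?_⟩, ?_⟩
  · rw [twist_apply]
    rcases hij.eq_or_lt with rfl | hij
    · rw [twistSign_self, zero_mul]
    · rw [hB hij, mul_zero]
  · ext i j
    have hij := congrFun (congrFun hs i) j
    rw [adj_apply, Matrix.neg_apply] at hij
    rw [one_smul, adj_apply, twist_apply, twist_apply, twistSign_rev h.apply_rev]
    linear_combination twistSign n π i j * hij
  · ext i j
    have hij := congrFun (congrFun hc i) j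
    rw [h.mul_apply, h.apply_mul] at hij
    rw [Matrix.add_apply, h.mul_apply, h.apply_mul, twist_apply, twist_apply, Matrix.zero_apply]
    -- If one of the two chord entries vanishes, the relation says that a single product is zero,
    -- and its sign is immaterial.
    by_cases hp : P i (π i) = 0
    · rw [hp, zero_mul] at hij ⊢
      rw [mul_assoc, hij, mul_zero, add_zero]
    · by_cases hq : P (π j) j = 0
      · rw [hq, mul_zero] at hij ⊢
        rw [mul_left_comm, ← hij, mul_zero, add_zero]
      · rw [twistSign_apply h.apply_apply h.apply_rev (h.lt_of_ne_zero_left hp)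
          (h.lt_of_ne_zero_right hq)]
        linear_combination twistSign n π i (π j) * hij

theorem twist_mem_stabLie (h : IsChordMatrix n π P) {Y : Matrix (Fin (2 * n)) (Fin (2 * n)) ℂ}
    (hY : Y ∈ antiComm n P) : twist n π Y ∈ stabLie n P := by
  obtain ⟨⟨hB, hs⟩, hc⟩ := hY
  refine ⟨⟨fun i j hij => ?_, ?_⟩, ?_⟩
  · rw [twist_apply, hB i j (le_of_lt hij), mul_zero]
  · ext i j
    have hij := congrFun (congrFun hs i) j
    rw [one_smul, adj_apply] at hij
    rw [adj_apply, Matrix.neg_apply, twist_apply, twist_apply, twistSign_rev h.apply_rev]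
    linear_combination twistSign n π i j * hij
  · ext i j
    have hij := congrFun (congrFun hc i) j
    rw [Matrix.add_apply, h.mul_apply, h.apply_mul, Matrix.zero_apply] at hij
    rw [h.mul_apply, h.apply_mul, twist_apply, twist_apply]
    by_cases hp : P i (π i) = 0
    · rw [hp, zero_mul, zero_add] at hij
      rw [hp, mul_assoc, hij, mul_zero, zero_mul]
    · by_cases hq : P (π j) j = 0
      · rw [hq, mul_zero, add_zero] at hij
        rw [hq, mul_left_comm, hij, mul_zero, mul_zero]
      · rw [twistSign_apply h.apply_apply h.apply_rev (h.lt_of_ne_zero_left hp)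
          (h.lt_of_ne_zero_right hq)]
        linear_combination twistSign n π i (π j) * hij

theorem twist_twist {Y : Matrix (Fin (2 * n)) (Fin (2 * n)) ℂ}
    (hY : Y ∈ nilSym 1 n) : twist n π (twist n π Y) = Y := by
  ext i j
  rw [twist_apply, twist_apply]
  by_cases h1 : i = j
  · rw [h1, hY.1 j j le_rfl, mul_zero, mul_zero]
  · by_cases h2 : j = i.rev
    · rw [h2, apply_rev_of_mem_nilSym hY, mul_zero, mul_zero]
    · rw [← mul_assoc, twistSign_mul_self n π h1 h2, one_mul]

/-- The twist, as a map from the stabilizer to the anticommutant. -/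
noncomputable def twistMap (h : IsChordMatrix n π P) : stabLie n P →ₗ[ℂ] antiComm n P :=
  (twist n π).restrict fun _ hX => h.twist_mem hX

theorem twistMap_surjective (h : IsChordMatrix n π P) : Function.Surjective h.twistMap := by
  intro Y
  exact ⟨⟨_, h.twist_mem_stabLie Y.2⟩, Subtype.ext (twist_twist Y.2.1)⟩

/-- The diagonal and antidiagonal entries of an element of the kernel of the twist. -/
noncomputable def kerMap (h : IsChordMatrix n π P) :
    LinearMap.ker h.twistMap →ₗ[ℂ] (orbitReps n π → ℂ) × (nonClosers n π → ℂ) where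
  toFun X := (fun i => X.1.1 i i, fun i => X.1.1 i (i : Fin (2 * n)).rev)
  map_add' _ _ := rfl
  map_smul' _ _ := rfl

theorem eq_zero_of_mem_ker (h : IsChordMatrix n π P) (X : LinearMap.ker h.twistMap)
    {i j : Fin (2 * n)} (h1 : i ≠ j) (h2 : j ≠ i.rev) : X.1.1 i j = 0 := by
  have h0 : h.twistMap X.1 = 0 := LinearMap.mem_ker.1 X.2
  have hX : twistSign n π i j * X.1.1 i j = 0 :=
    congrFun (congrFun (congrArg Subtype.val h0) i) j
  refine (mul_eq_zero.1 hX).resolve_left fun h3 => ?_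
  have := twistSign_mul_self n π h1 h2
  rw [h3, mul_zero] at this
  exact zero_ne_one this

theorem diag_rev {X : Matrix (Fin (2 * n)) (Fin (2 * n)) ℂ}
    (hX : X ∈ stabLie n P) (i : Fin (2 * n)) : X i.rev i.rev = -X i i := by
  have h1 := congrFun (congrFun hX.1.2 i) i
  rwa [adj_apply, sgn_mul_self, one_mul, Matrix.neg_apply] at h1

theorem diag_apply (h : IsChordMatrix n π P) {X : Matrix (Fin (2 * n)) (Fin (2 * n)) ℂ}
    (hX : X ∈ stabLie n P) (i : Fin (2 * n)) : X (π i) (π i) = X i i := by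
  have key : ∀ i, i < π i → X (π i) (π i) = X i i := by
    intro i hi
    have h1 := congrFun (congrFun hX.2 i) (π i)
    rw [h.mul_apply, h.apply_mul, h.apply_apply, mul_comm] at h1
    exact (mul_left_cancel₀ (h.ne_zero i (π i) hi (h.apply_apply i).symm) h1).symm
  rcases lt_trichotomy i (π i) with h1 | h1 | h1
  · exact key i h1
  · rw [← h1]
  · have := key (π i) (by rwa [h.apply_apply])
    rw [h.apply_apply] at this
    exact this.symm

/-- In the commutation relation at `(i, (π i).rev)` the right side is zero because `i` closes its
chord, while on the left `X i i.rev` is multiplied by the nonzero entry of the mirror chord, which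
opens at `i.rev`. -/
theorem antidiag_eq_zero (h : IsChordMatrix n π P) {X : Matrix (Fin (2 * n)) (Fin (2 * n)) ℂ}
    (hX : X ∈ stabLie n P) {i : Fin (2 * n)} (hi : π i < i) : X i i.rev = 0 := by
  have h1 := congrFun (congrFun hX.2 i) (π i).rev
  rw [h.mul_apply, h.apply_mul, h.apply_rev, h.apply_apply,
    h.eq_zero i (π i) (fun h' => absurd h'.1 hi.asymm), zero_mul] at h1
  refine (mul_eq_zero.1 h1).resolve_right (h.ne_zero _ _ (Fin.rev_lt_rev.2 hi) ?_)
  rw [h.apply_rev, h.apply_apply]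

/-- The diagonal is invariant under `π` and odd under reflection, so it is determined on
representatives and vanishes at points joined to their mirror image. Antidiagonal entries vanish at
closers and, by triangularity, in the lower half; the others are recorded. -/
theorem kerMap_injective (h : IsChordMatrix n π P) : Function.Injective h.kerMap := by
  rw [injective_iff_map_eq_zero]
  intro X hX
  have hd : ∀ i ∈ orbitReps n π, X.1.1 i i = 0 := fun i hi =>
    congrFun (congrArg Prod.fst hX) ⟨i, hi⟩
  have ha : ∀ i ∈ nonClosers n π, X.1.1 i i.rev = 0 := fun i hi =>
    congrFun (congrArg Prod.snd hX) ⟨i, hi⟩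
  have hd1 : ∀ i : Fin (2 * n), (i : ℕ) < n → X.1.1 i i = 0 := by
    intro i hi
    by_cases hs : π i = i.rev
    · have h1 := h.diag_apply X.1.2 i
      rw [hs, diag_rev X.1.2 i] at h1
      exact neg_eq_self.1 h1
    · have hir : (i.rev : ℕ) = 2 * n - 1 - i := by rw [Fin.val_rev]; omega
      have hpr : ((π i).rev : ℕ) = 2 * n - 1 - π i := by rw [Fin.val_rev]; omega
      have hp := (π i).2
      by_cases h1 : (π i : ℕ) < n
      · by_cases h2 : i ≤ π i
        · exact hd i (mem_orbitReps.2 ⟨hi, hs, h2, by rw [Fin.le_def]; omega⟩)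
        · rw [← h.diag_apply X.1.2]
          have h2' : ¬ (i : ℕ) ≤ π i := h2
          refine hd _ (mem_orbitReps.2 ⟨h1, ?_, ?_, ?_⟩)
          · rw [h.apply_apply]
            exact fun h3 => hs (Fin.rev_eq_iff.1 h3.symm)
          · rw [h.apply_apply, Fin.le_def]; omega
          · rw [h.apply_apply, Fin.le_def]; omega
      · by_cases h2 : i ≤ (π i).rev
        · exact hd i (mem_orbitReps.2 ⟨hi, hs, by rw [Fin.le_def]; omega, h2⟩)
        · rw [← h.diag_apply X.1.2]
          have h2' : ¬ (i : ℕ) ≤ (π i).rev := h2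
          rw [← neg_eq_zero, ← diag_rev X.1.2]
          refine hd _ (mem_orbitReps.2 ⟨by omega, ?_, ?_, ?_⟩)
          · rw [h.apply_rev, h.apply_apply, Fin.rev_rev]
            exact fun h3 => hs h3.symm
          · rw [h.apply_rev, h.apply_apply, Fin.le_def]; omega
          · rw [h.apply_rev, h.apply_apply, Fin.rev_rev, Fin.le_def]; omega
  refine Subtype.ext (Subtype.ext ?_)
  ext i j
  change X.1.1 i j = 0
  by_cases h1 : i = j
  · rw [← h1]
    by_cases h2 : (i : ℕ) < n
    · exact hd1 i h2
    · have := hd1 i.rev (by rw [Fin.val_rev]; omega)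
      rwa [diag_rev X.1.2, neg_eq_zero] at this
  · by_cases h2 : j = i.rev
    · rw [h2]
      by_cases h3 : π i < i
      · exact h.antidiag_eq_zero X.1.2 h3
      · by_cases h4 : (i : ℕ) < n
        · exact ha i (mem_nonClosers.2 ⟨h4, h3⟩)
        · refine X.1.2.1.1 ?_
          change i.rev < i
          rw [Fin.lt_def, Fin.val_rev]
          omega
    · exact h.eq_zero_of_mem_ker X h1 h2

/-- The extension of a function on `orbitReps` by symmetry, first step. -/
noncomputable def diagSeed (f : orbitReps n π → ℂ) (i : Fin (2 * n)) : ℂ :=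
  if h : i ∈ orbitReps n π then f ⟨i, h⟩ / (if π i = i then 2 else 1) else 0

/-- The extension of a function on `orbitReps` by symmetry. -/
noncomputable def diagExt (f : orbitReps n π → ℂ) (i : Fin (2 * n)) : ℂ :=
  diagSeed f i + diagSeed f (π i) - diagSeed f i.rev - diagSeed f (π i).rev

/-- The matrix with prescribed diagonal and antidiagonal entries. -/
noncomputable def kerMatrix (f : orbitReps n π → ℂ) (g : nonClosers n π → ℂ) :
    Matrix (Fin (2 * n)) (Fin (2 * n)) ℂ :=
  Matrix.of fun i j => if i = j then diagExt f i
    else if h : j = i.rev ∧ i ∈ nonClosers n π then g ⟨i, h.2⟩ else 0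

theorem ne_rev (i : Fin (2 * n)) : i ≠ i.rev := by
  intro h
  have := congrArg Fin.val h
  rw [Fin.val_rev] at this
  omega

theorem kerMatrix_diag (f : orbitReps n π → ℂ) (g : nonClosers n π → ℂ) (i : Fin (2 * n)) :
    kerMatrix f g i i = diagExt f i := if_pos rfl

theorem kerMatrix_antidiag (f : orbitReps n π → ℂ) (g : nonClosers n π → ℂ) {i : Fin (2 * n)}
    (hi : i ∈ nonClosers n π) : kerMatrix f g i i.rev = g ⟨i, hi⟩ := by
  change (if i = i.rev then _ else _) = _
  rw [if_neg (ne_rev i), dif_pos ⟨rfl, hi⟩]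

theorem kerMatrix_eq_zero (f : orbitReps n π → ℂ) (g : nonClosers n π → ℂ) {i j : Fin (2 * n)}
    (h1 : i ≠ j) (h2 : ¬ (j = i.rev ∧ i ∈ nonClosers n π)) : kerMatrix f g i j = 0 := by
  change (if i = j then _ else _) = _
  rw [if_neg h1, dif_neg h2]

/-- Among `i`, `π i` and their mirror images a representative is the only one of its kind, so no
other seed contributes. -/
theorem diagExt_of_mem (h : IsChordMatrix n π P) (f : orbitReps n π → ℂ) {i : Fin (2 * n)}
    (hi : i ∈ orbitReps n π) : diagExt f i = f ⟨i, hi⟩ := by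
  have hi' := mem_orbitReps.1 hi
  have h1 : i.rev ∉ orbitReps n π := by
    rw [mem_orbitReps, Fin.val_rev]
    omega
  have h2 : (π i).rev ∉ orbitReps n π := by
    rw [mem_orbitReps, h.apply_rev, h.apply_apply, Fin.rev_rev]
    rintro ⟨-, -, -, h3⟩
    rw [Fin.rev_rev] at h3
    exact hi'.2.1 (Fin.rev_eq_iff.1 (le_antisymm h3 hi'.2.2.2))
  have e1 : diagSeed f i.rev = 0 := dif_neg h1
  have e2 : diagSeed f (π i).rev = 0 := dif_neg h2
  have e3 : diagSeed f i = f ⟨i, hi⟩ / (if π i = i then 2 else 1) := dif_pos hi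
  rw [diagExt, e1, e2, e3]
  -- At a fixed point the seeds at `i` and `π i` are the same and get added, which the division by
  -- `2` in the seed compensates.
  by_cases h3 : π i = i
  · rw [if_pos h3] at e3
    rw [h3, e3, if_pos rfl]
    ring
  · have h4 : π i ∉ orbitReps n π := by
      rw [mem_orbitReps, h.apply_apply]
      rintro ⟨-, -, h4, -⟩
      exact h3 (le_antisymm h4 hi'.2.2.1)
    have e4 : diagSeed f (π i) = 0 := dif_neg h4
    rw [e4, if_neg h3]
    ring

theorem diagExt_rev (h : IsChordMatrix n π P) (f : orbitReps n π → ℂ) (i : Fin (2 * n)) :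
    diagExt f i.rev = -diagExt f i := by
  rw [diagExt, diagExt, h.apply_rev, Fin.rev_rev, Fin.rev_rev]
  ring

theorem diagExt_apply (h : IsChordMatrix n π P) (f : orbitReps n π → ℂ) (i : Fin (2 * n)) :
    diagExt f (π i) = diagExt f i := by
  rw [diagExt, diagExt, h.apply_apply]
  ring

theorem kerMatrix_mem (h : IsChordMatrix n π P) (f : orbitReps n π → ℂ)
    (g : nonClosers n π → ℂ) : kerMatrix f g ∈ stabLie n P := by
  refine ⟨⟨fun i j hij => ?_, ?_⟩, ?_⟩
  · have hij' : j < i := hij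
    refine kerMatrix_eq_zero f g hij'.ne' ?_
    rintro ⟨rfl, h2⟩
    have h3 := (mem_nonClosers.1 h2).1
    rw [Fin.lt_def, Fin.val_rev] at hij'
    omega
  · ext i j
    rw [adj_apply, Matrix.neg_apply]
    by_cases h1 : i = j
    · rw [h1, kerMatrix_diag, kerMatrix_diag, h.diagExt_rev, sgn_mul_self, one_mul]
    · by_cases h2 : j = i.rev
      · rw [h2, Fin.rev_rev, sgn_rev, mul_neg, sgn_mul_self, neg_one_mul]
      · rw [kerMatrix_eq_zero f g h1 (fun h3 => h2 h3.1), kerMatrix_eq_zero f g, mul_zero, neg_zero]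
        · exact fun h3 => h1 (Fin.rev_inj.1 h3).symm
        · rintro ⟨h3, -⟩
          rw [Fin.rev_rev] at h3
          exact h2 h3.symm
  · have hz : ∀ i, π i < i → kerMatrix f g i i.rev = 0 := fun i hi =>
      kerMatrix_eq_zero f g (ne_rev i) fun h1 => (mem_nonClosers.1 h1.2).2 hi
    ext i j
    rw [h.mul_apply, h.apply_mul]
    by_cases h1 : j = π i
    · rw [h1, h.apply_apply, kerMatrix_diag, kerMatrix_diag, h.diagExt_apply, mul_comm]
    · have h1' : i ≠ π j := fun h2 => h1 (by rw [h2, h.apply_apply])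
      by_cases h2 : j = (π i).rev
      · rw [h2, h.apply_rev, h.apply_apply]
        rcases lt_trichotomy i (π i) with h3 | h3 | h3
        · rw [hz (π i) (by rwa [h.apply_apply]), mul_zero,
            h.eq_zero i.rev (π i).rev (fun h4 => absurd (Fin.rev_lt_rev.1 h4.1) h3.asymm), mul_zero]
        · rw [← h3, h.eq_zero i i (fun h4 => absurd h4.1 (lt_irrefl _)),
            h.eq_zero i.rev i.rev (fun h4 => absurd h4.1 (lt_irrefl _)), mul_zero, zero_mul]
        · rw [hz i h3, h.eq_zero i (π i) (fun h4 => absurd h4.1 h3.asymm), zero_mul, zero_mul]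
      · rw [kerMatrix_eq_zero f g h1', kerMatrix_eq_zero f g (Ne.symm h1) (fun h3 => h2 h3.1),
          mul_zero, zero_mul]
        rintro ⟨h3, -⟩
        exact h2 (by rw [← h.apply_rev, ← h3, h.apply_apply])

theorem kerMap_surjective (h : IsChordMatrix n π P) : Function.Surjective h.kerMap := by
  rintro ⟨f, g⟩
  refine ⟨⟨⟨kerMatrix f g, h.kerMatrix_mem f g⟩, ?_⟩, ?_⟩
  · rw [LinearMap.mem_ker]
    refine Subtype.ext ?_
    ext i j
    change twistSign n π i j * kerMatrix f g i j = 0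
    by_cases h1 : i = j ∨ j = i.rev
    · rw [twistSign, if_pos h1, zero_mul]
    · rw [not_or] at h1
      rw [kerMatrix_eq_zero f g h1.1 (fun h2 => h1.2 h2.1), mul_zero]
  · refine Prod.ext (funext fun i => ?_) (funext fun i => ?_)
    · exact (kerMatrix_diag f g _).trans (h.diagExt_of_mem f i.2)
    · exact kerMatrix_antidiag f g i.2

/-- Rank-nullity for the twist, whose kernel is described by the free diagonal and antidiagonal
entries. -/
theorem finrank_stabLie (h : IsChordMatrix n π P) :
    Module.finrank ℂ (stabLie n P) = Module.finrank ℂ (antiComm n P) +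
      (orbitReps n π).card + (nonClosers n π).card := by
  have h1 := LinearMap.finrank_range_add_finrank_ker h.twistMap
  rw [LinearMap.range_eq_top.2 h.twistMap_surjective, finrank_top,
    (LinearEquiv.ofBijective h.kerMap ⟨h.kerMap_injective, h.kerMap_surjective⟩).finrank_eq,
    Module.finrank_prod, Module.finrank_fintype_fun_eq_card, Module.finrank_fintype_fun_eq_card,
    Fintype.card_coe, Fintype.card_coe] at h1
  rw [← h1, add_assoc]

end IsChordMatrix

/-! ### The Lie algebra of `B̃_N` as the stabilizer of the zero matrix -/

theorem stabLie_zero (n : ℕ) : stabLie n 0 = borelLie n := by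
  ext X
  exact ⟨fun h => h.1, fun h => ⟨h, by rw [mul_zero, zero_mul]⟩⟩

theorem antiComm_zero (n : ℕ) : antiComm n 0 = nilSym 1 n := by
  ext X
  exact ⟨fun h => h.1, fun h => ⟨h, by rw [mul_zero, zero_mul, add_zero]⟩⟩

theorem card_filter_val_lt (n : ℕ) :
    (Finset.univ.filter fun i : Fin (2 * n) => (i : ℕ) < n).card = n := by
  rw [Fin.card_filter_val_lt]
  omega

theorem finrank_borelLie (n : ℕ) :
    Module.finrank ℂ (borelLie n) = Module.finrank ℂ (nilSym 1 n) + 2 * n := by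
  have h := (isChordMatrix_zero n).finrank_stabLie
  have h1 : orbitReps n 1 = Finset.univ.filter fun i : Fin (2 * n) => (i : ℕ) < n := by
    ext i
    rw [mem_orbitReps, Finset.mem_filter]
    simp only [Equiv.Perm.one_apply, Finset.mem_univ, true_and, le_refl, Fin.le_def, Fin.val_rev]
    exact ⟨fun h => h.1, fun h => ⟨h, IsChordMatrix.ne_rev i, by omega⟩⟩
  have h2 : nonClosers n 1 = Finset.univ.filter fun i : Fin (2 * n) => (i : ℕ) < n := by
    ext i
    rw [mem_nonClosers, Finset.mem_filter]
    simp
  rw [stabLie_zero, antiComm_zero, h1, h2, card_filter_val_lt] at h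
  omega

/-! ### Dimension counts -/

/-- The extension by zero of a family of entries `(i, i + 1 + k)`. -/
noncomputable def entryExt {n c : ℕ} (g : (Σ i : Fin n, Fin (2 * n - (c + 1) - 2 * i)) → ℂ)
    (i j : ℕ) : ℂ :=
  if h : i < n ∧ i < j ∧ i + j ≤ 2 * n - (c + 1) then g ⟨⟨i, h.1⟩, ⟨j - i - 1, by
    have := h.2; simp only; omega⟩⟩ else 0

theorem entryExt_eq_zero {n c : ℕ} (g : (Σ i : Fin n, Fin (2 * n - (c + 1) - 2 * i)) → ℂ) {i j : ℕ}
    (h : ¬ (i < j ∧ i + j ≤ 2 * n - (c + 1))) : entryExt g i j = 0 :=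
  dif_neg fun h' => h h'.2

theorem entryExt_apply {n c : ℕ} (g : (Σ i : Fin n, Fin (2 * n - (c + 1) - 2 * i)) → ℂ)
    (x : Σ i : Fin n, Fin (2 * n - (c + 1) - 2 * i)) :
    entryExt g x.1 (x.1 + 1 + x.2) = g x := by
  obtain ⟨⟨i, hi⟩, ⟨k, hk⟩⟩ := x
  simp only at hk ⊢
  rw [entryExt, dif_pos ⟨hi, by omega, by omega⟩]
  congr
  omega

/-- The entries of a matrix in `nilSym s n` that determine it. -/
noncomputable def nilSymMap (s : ℂ) (n c : ℕ) :
    nilSym s n →ₗ[ℂ] ((Σ i : Fin n, Fin (2 * n - (c + 1) - 2 * i)) → ℂ) where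
  toFun Z x := Z.1 ⟨x.1, by omega⟩ ⟨x.1 + 1 + x.2, by omega⟩
  map_add' _ _ := rfl
  map_smul' _ _ := rfl

theorem val_add_rev {N : ℕ} (i : Fin N) : (i : ℕ) + i.rev = N - 1 := by
  rw [Fin.val_rev]; omega

/-- The symmetry determines the entries beyond the antidiagonal from those before it. The
antidiagonal itself is free for `s = -1` and forced to vanish for `s = 1`; the offset `c` records
whether it is excluded. -/
theorem nilSymMap_injective {s : ℂ} {c : ℕ} (hc : s = -1 ∧ c = 0 ∨ s = 1 ∧ c = 1) (n : ℕ) :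
    Function.Injective (nilSymMap s n c) := by
  rw [injective_iff_map_eq_zero]
  rintro ⟨Z, hZ1, hZ2⟩ h
  have key : ∀ i j : Fin (2 * n), (i : ℕ) + j ≤ 2 * n - (c + 1) → Z i j = 0 := by
    intro i j hij
    by_cases h1 : j ≤ i
    · exact hZ1 i j h1
    · have h1' : ¬ (j : ℕ) ≤ i := h1
      have hj := j.2
      have := congrFun h ⟨⟨i, by omega⟩, ⟨j - i - 1, by
        simp only; rcases hc with hc | hc <;> omega⟩⟩
      refine Eq.trans ?_ this
      change Z i j = Z _ _
      congr 1
      ext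
      simp only
      omega
  refine Subtype.ext ?_
  ext i j
  change Z i j = 0
  have hi := val_add_rev i
  have hj := val_add_rev j
  by_cases h1 : (i : ℕ) + j ≤ 2 * n - (c + 1)
  · exact key i j h1
  · by_cases h2 : (j.rev : ℕ) + i.rev ≤ 2 * n - (c + 1)
    · rw [hZ2, Matrix.smul_apply, adj_apply, key _ _ h2, mul_zero, smul_zero]
    · rcases hc with ⟨rfl, rfl⟩ | ⟨rfl, rfl⟩
      · omega
      · have h3 : j = i.rev := Fin.ext (by omega)
        rw [h3]
        exact apply_rev_of_mem_nilSym ⟨hZ1, hZ2⟩ i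

theorem nilSymMap_surjective {s : ℂ} {c : ℕ} (hc : s = -1 ∧ c = 0 ∨ s = 1 ∧ c = 1) (n : ℕ) :
    Function.Surjective (nilSymMap s n c) := by
  intro g
  have hss : s * s = 1 := by rcases hc with ⟨rfl, -⟩ | ⟨rfl, -⟩ <;> norm_num
  refine ⟨⟨Matrix.of fun i j : Fin (2 * n) => if (i : ℕ) + j ≤ 2 * n - (c + 1) then entryExt g i j
    else s * (sgn n i * sgn n j * entryExt g j.rev i.rev), fun i j hij => ?_, ?_⟩, ?_⟩
  · have hi := val_add_rev i
    have hj := val_add_rev j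
    have hij' : (j : ℕ) ≤ i := hij
    rw [Matrix.of_apply, entryExt_eq_zero g (by omega), entryExt_eq_zero g (by omega), mul_zero,
      mul_zero, ite_self]
  · ext i j
    have hi := val_add_rev i
    have hj := val_add_rev j
    have h1 := sgn_mul_self n i
    have h2 := sgn_mul_self n j
    rw [Matrix.smul_apply, adj_apply, Matrix.of_apply, Matrix.of_apply, Fin.rev_rev, Fin.rev_rev,
      smul_eq_mul]
    by_cases h3 : (i : ℕ) + j = 2 * n - 1
    · have h4 : j = i.rev := Fin.ext (by omega)
      subst h4
      rw [Fin.rev_rev]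
      rcases hc with ⟨rfl, rfl⟩ | ⟨rfl, rfl⟩
      · rw [if_pos (by omega), sgn_rev]
        linear_combination -(entryExt g i i.rev) * h1
      · rw [if_neg (by omega), entryExt_eq_zero g (by omega)]
        simp
    · by_cases h4 : (i : ℕ) + j ≤ 2 * n - (c + 1)
      · rw [if_pos h4, if_neg (by omega), sgn_rev, sgn_rev]
        linear_combination (-entryExt g i j) * hss - s * s * entryExt g i j * h1 -
          s * s * entryExt g i j * sgn n i * sgn n i * h2
      · rw [if_neg h4, if_pos (by omega)]
  · funext x
    have h1 := x.1.2
    have h2 := x.2.2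
    change (if (x.1 : ℕ) + (x.1 + 1 + x.2) ≤ 2 * n - (c + 1) then
      entryExt g x.1 (x.1 + 1 + x.2) else _) = g x
    rw [if_pos (by omega), entryExt_apply]

theorem finrank_nilSym_eq_sum {s : ℂ} {c : ℕ} (hc : s = -1 ∧ c = 0 ∨ s = 1 ∧ c = 1) (n : ℕ) :
    Module.finrank ℂ (nilSym s n) = ∑ i ∈ Finset.range n, (2 * i + (1 - c)) := by
  rw [(LinearEquiv.ofBijective _ ⟨nilSymMap_injective hc n,
    nilSymMap_surjective hc n⟩).finrank_eq, Module.finrank_fintype_fun_eq_card,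
    Fintype.card_sigma, ← Finset.sum_range_reflect, ← Fin.sum_univ_eq_sum_range
      (fun i => 2 * (n - 1 - i) + (1 - c))]
  refine Finset.sum_congr rfl fun i _ => ?_
  have := i.2
  rw [Fintype.card_fin]
  omega

theorem finrank_nilSym_neg_one (n : ℕ) : Module.finrank ℂ (nilSym (-1) n) = n ^ 2 := by
  rw [finrank_nilSym_eq_sum (Or.inl ⟨rfl, rfl⟩)]
  induction n with
  | zero => rfl
  | succ k ih => rw [Finset.sum_range_succ, ih]; ring

theorem finrank_nilSym_one (n : ℕ) : Module.finrank ℂ (nilSym 1 n) = n * (n - 1) := by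
  rw [finrank_nilSym_eq_sum (Or.inr ⟨rfl, rfl⟩)]
  simp only [Nat.sub_self, add_zero]
  rw [← Finset.mul_sum, mul_comm, Finset.sum_range_id_mul_two]

/-! ### The matrix of an involution -/

theorem Inv.apply_rev {a : Boundary} {n : ℕ} {π : Equiv.Perm (Fin (2 * n))} (hπ : π ∈ Inv a n)
    (i : Fin (2 * n)) : π i.rev = (π i).rev := by
  rw [hπ.2.1 i, Fin.rev_rev]

theorem isChordMatrix_invMatrix {a : Boundary} {n : ℕ} {π : Equiv.Perm (Fin (2 * n))}
    (hπ : π ∈ Inv a n) : IsChordMatrix n π (invMatrix a n π) where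
  apply_apply := hπ.1
  apply_rev := Inv.apply_rev hπ
  eq_zero i j h := by
    rw [← not_le] at h
    cases a <;> simp only [invMatrix, Matrix.of_apply] <;> split_ifs <;> tauto
  ne_zero i j h h' := by
    rw [← not_le] at h
    cases a
    · simp only [invMatrix, Matrix.of_apply, if_neg h, if_pos h']
      split_ifs <;> simp
    · have h2 : i ≠ j.rev := fun h3 => hπ.2.2 rfl j (by rw [← h', h3])
      simp only [invMatrix, Matrix.of_apply, if_neg h, if_pos h', if_neg h2]
      split_ifs <;> simp

/-- The signs in `π_<` are chosen for this: the entry of a chord `(i, j)` is compared with that of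
its mirror chord `(j', i')`, and the position of the endpoints relative to the middle decides the
sign. -/
theorem invMatrix_eq_smul_adj {a : Boundary} {n : ℕ} {π : Equiv.Perm (Fin (2 * n))}
    (hπ : π ∈ Inv a n) : invMatrix a n π = bsign a • adj n (invMatrix a n π) := by
  have hP := isChordMatrix_invMatrix hπ
  ext i j
  rw [Matrix.smul_apply, adj_apply, smul_eq_mul]
  by_cases h : i < j ∧ i = π j
  · have hj : j.rev = π i.rev := by rw [hP.apply_rev, h.2, hP.apply_apply]
    have hr := val_add_rev i
    have hr' := val_add_rev j
    have hij := Fin.lt_def.1 h.1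
    have h1 : ¬ j ≤ i := not_le.2 h.1
    have h1' : ¬ i.rev ≤ j.rev := not_le.2 (Fin.rev_lt_rev.2 h.1)
    cases a
    · simp only [invMatrix, Matrix.of_apply, if_neg h1, if_neg h1', if_pos h.2, if_pos hj, bsign,
        sgn]
      split_ifs <;> first | omega | norm_num
    · have h2 : i ≠ j.rev := fun h3 => hπ.2.2 rfl j (by rw [← h.2, h3])
      have h2' : j.rev ≠ i := h2.symm
      have h3 : (i : ℕ) ≠ j.rev := fun h3 => h2 (Fin.ext h3)
      simp only [invMatrix, Matrix.of_apply, if_neg h1, if_neg h1', if_pos h.2, if_pos hj, bsign,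
        sgn, if_neg h2, Fin.rev_rev, if_neg h2', Fin.lt_def]
      split_ifs <;> first | omega | norm_num
  · rw [hP.eq_zero i j h, hP.eq_zero j.rev i.rev, mul_zero, mul_zero]
    rw [Fin.rev_lt_rev, hP.apply_rev, Fin.rev_inj]
    exact fun h' => h ⟨h'.1, by rw [h'.2, hP.apply_apply]⟩

/-- A nonzero term would need a point that both closes and opens a chord. -/
theorem IsChordMatrix.mul_self {n : ℕ} {π : Equiv.Perm (Fin (2 * n))}
    {P : Matrix (Fin (2 * n)) (Fin (2 * n)) ℂ} (h : IsChordMatrix n π P) : P * P = 0 := by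
  ext i j
  rw [h.mul_apply, Matrix.zero_apply]
  by_cases hq : P (π j) j = 0
  · rw [hq, mul_zero]
  · rw [h.eq_zero i (π j), zero_mul]
    rintro ⟨h1, h2⟩
    rw [h.apply_apply] at h2
    rw [h2] at h1
    exact h1.asymm (h.lt_of_ne_zero_right hq)

theorem IsChordMatrix.eq_zero_of_le {n : ℕ} {π : Equiv.Perm (Fin (2 * n))}
    {P : Matrix (Fin (2 * n)) (Fin (2 * n)) ℂ} (h : IsChordMatrix n π P) (i j : Fin (2 * n))
    (hij : j ≤ i) : P i j = 0 :=
  h.eq_zero i j fun h' => absurd h'.1 (not_lt.2 hij)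

/-- The dimension of a stratum, in terms of the spaces of matrices attached to it. -/
theorem zariskiDim_stratum_add {a : Boundary} {n : ℕ} [NeZero (2 * n)]
    {π : Equiv.Perm (Fin (2 * n))} (hπ : π ∈ Inv a n) :
    ∃ d : ℕ, zariskiDim (stratum a n π) = (d : ℕ) ∧
      d + (orbitReps n π).card + (nonClosers n π).card =
        Module.finrank ℂ (nilSym (bsign a) n) + 2 * n := by
  have hP := isChordMatrix_invMatrix hπ
  have hPs := invMatrix_eq_smul_adj hπ
  have hle : stabLie n (invMatrix a n π) ≤ borelLie n := fun X hX => hX.1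
  obtain ⟨T, hT⟩ := Submodule.exists_isCompl (stabLie n (invMatrix a n π))
  have hsup : borelLie n ≤ (T ⊓ borelLie n) ⊔ stabLie n (invMatrix a n π) := by
    intro X hX
    obtain ⟨Y, hY, Z, hZ, rfl⟩ := Submodule.mem_sup.1
      (show X ∈ stabLie n (invMatrix a n π) ⊔ T by rw [hT.sup_eq_top]; exact Submodule.mem_top)
    refine Submodule.mem_sup.2 ⟨Z, ⟨hZ, ?_⟩, Y, hY, add_comm _ _⟩
    have := Submodule.sub_mem _ hX (hle hY)
    rwa [add_sub_cancel_left] at this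
  have hdis : Disjoint (T ⊓ borelLie n) (stabLie n (invMatrix a n π)) :=
    (hT.disjoint.mono_right inf_le_left).symm
  refine ⟨_, zariskiDim_stratum_eq_finrank_add a n π (fun i j hij => hP.eq_zero_of_le i j hij.le)
    (fun i => hP.eq_zero_of_le i i le_rfl) hP.mul_self hPs inf_le_right hsup hdis, ?_⟩
  have h1 := Submodule.finrank_sup_add_finrank_inf_eq (T ⊓ borelLie n)
    (stabLie n (invMatrix a n π))
  rw [hdis.eq_bot, finrank_bot, le_antisymm (sup_le inf_le_right hle) hsup] at h1
  have h2 := finrank_fibre_add (s := bsign a) (by cases a <;> simp [bsign]) (bsign_mul_self a)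
    hP.eq_zero_of_le hPs
  have h3 := hP.finrank_stabLie
  have h4 := finrank_borelLie n
  -- The anticommutant and `nilSym 1 n` occur with opposite signs in the stabilizer and fibre
  -- contributions and cancel.
  omega

/-! ### Counting chords -/

/-- The number of fixed points of `π` in `{1, …, n}`. -/
def numFix (n : ℕ) (π : Equiv.Perm (Fin (2 * n))) : ℕ :=
  (Finset.univ.filter fun a : Fin n => π (lower a) = lower a).card

theorem val_lower {n : ℕ} (j : Fin n) : (lower j : ℕ) = j := rfl

theorem lower_inj {n : ℕ} {j k : Fin n} : lower j = lower k ↔ j = k :=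
  ⟨fun h => Fin.ext (Fin.ext_iff.1 h :), fun h => h ▸ rfl⟩

theorem val_lower_rev {n : ℕ} (j : Fin n) : ((lower j).rev : ℕ) = 2 * n - 1 - j := by
  rw [Fin.val_rev, val_lower]; omega

theorem exists_lower {n : ℕ} {x : Fin (2 * n)} (hx : (x : ℕ) < n) : ∃ j : Fin n, lower j = x :=
  ⟨⟨x, hx⟩, rfl⟩

theorem exists_lower_rev {n : ℕ} {x : Fin (2 * n)} (hx : ¬ (x : ℕ) < n) :
    ∃ j : Fin n, (lower j).rev = x := by
  obtain ⟨j, hj⟩ := exists_lower (x := x.rev) (by rw [Fin.val_rev]; omega)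
  exact ⟨j, by rw [hj, Fin.rev_rev]⟩

theorem card_filter_lower (n : ℕ) (Q : Fin (2 * n) → Prop) [DecidablePred Q] :
    (Finset.univ.filter fun i : Fin (2 * n) => (i : ℕ) < n ∧ Q i).card =
      ∑ j : Fin n, if Q (lower j) then 1 else 0 := by
  rw [← Finset.card_filter]
  symm
  refine Finset.card_bij (fun j _ => lower j) (fun j hj => ?_) (fun j _ k _ h => lower_inj.1 h)
    fun i hi => ?_
  · rw [Finset.mem_filter] at hj ⊢
    exact ⟨Finset.mem_univ _, j.2, hj.2⟩
  · rw [Finset.mem_filter] at hi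
    obtain ⟨j, rfl⟩ := exists_lower hi.2.1
    exact ⟨j, by rw [Finset.mem_filter]; exact ⟨Finset.mem_univ _, hi.2.2⟩, rfl⟩

section

variable {n : ℕ} {π : Equiv.Perm (Fin (2 * n))}

/-- Writing all counts as sums of indicators over `{1, …, n}`, with pairs counted at either end,
reduces the counting identities to a case check at a single point. -/
theorem numFix_eq_sum (n : ℕ) (π : Equiv.Perm (Fin (2 * n))) :
    numFix n π = ∑ j : Fin n, if (π (lower j) : ℕ) = j then 1 else 0 := by
  rw [← Finset.card_filter]
  simp only [numFix, Fin.ext_iff, val_lower]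

theorem numSelf_eq_sum (n : ℕ) (π : Equiv.Perm (Fin (2 * n))) :
    numSelf n π = ∑ j : Fin n, if (π (lower j) : ℕ) = 2 * n - 1 - j then 1 else 0 := by
  rw [← Finset.card_filter]
  simp only [numSelf, Fin.ext_iff, val_lower_rev]

theorem numArc_eq_sum_left (n : ℕ) (π : Equiv.Perm (Fin (2 * n))) :
    numArc n π = ∑ j : Fin n, if (j : ℕ) < π (lower j) ∧ (π (lower j) : ℕ) < n then 1 else 0 := by
  rw [← Finset.card_filter]
  refine Finset.card_bij (fun x _ => x.1) ?_ ?_ ?_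
  · rintro ⟨j, k⟩ h
    simp only [Finset.mem_filter, Finset.mem_univ, true_and] at h ⊢
    rw [h.2]
    exact ⟨h.1, k.2⟩
  · rintro ⟨j, k⟩ h ⟨j', k'⟩ h' hj
    simp only [Finset.mem_filter, Finset.mem_univ, true_and] at h h' hj
    subst hj
    rw [lower_inj.1 (h.2.symm.trans h'.2)]
  · intro j h
    simp only [Finset.mem_filter, Finset.mem_univ, true_and] at h
    obtain ⟨k, hk⟩ := exists_lower h.2
    rw [← hk] at h
    exact ⟨(j, k), by simpa using ⟨h.1, hk.symm⟩, rfl⟩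

theorem numArc_eq_sum_right (h0 : ∀ i, π (π i) = i) :
    numArc n π = ∑ j : Fin n, if (π (lower j) : ℕ) < j then 1 else 0 := by
  rw [← Finset.card_filter]
  refine Finset.card_bij (fun x _ => x.2) ?_ ?_ ?_
  · rintro ⟨j, k⟩ h
    simp only [Finset.mem_filter, Finset.mem_univ, true_and] at h ⊢
    rw [← h.2, h0]
    exact h.1
  · rintro ⟨j, k⟩ h ⟨j', k'⟩ h' hj
    simp only [Finset.mem_filter, Finset.mem_univ, true_and] at h h' hj
    subst hj
    rw [lower_inj.1 (π.injective (h.2.trans h'.2.symm))]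
  · intro k h
    simp only [Finset.mem_filter, Finset.mem_univ, true_and] at h
    obtain ⟨j, hj⟩ := exists_lower (h.trans k.2)
    rw [← hj] at h
    exact ⟨(j, k), by simpa using ⟨h, by rw [hj, h0]⟩, rfl⟩

theorem numCross_eq_sum_left (n : ℕ) (π : Equiv.Perm (Fin (2 * n))) :
    numCross n π =
      ∑ j : Fin n, if n ≤ (π (lower j) : ℕ) ∧ (π (lower j) : ℕ) + j < 2 * n - 1 then 1 else 0 := by
  rw [← Finset.card_filter]
  refine Finset.card_bij (fun x _ => x.1) ?_ ?_ ?_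
  · rintro ⟨j, k⟩ h
    simp only [Finset.mem_filter, Finset.mem_univ, true_and, Fin.lt_def] at h ⊢
    rw [h.2, val_lower_rev]
    omega
  · rintro ⟨j, k⟩ h ⟨j', k'⟩ h' hj
    simp only [Finset.mem_filter, Finset.mem_univ, true_and] at h h' hj
    subst hj
    rw [lower_inj.1 (Fin.rev_inj.1 (h.2.symm.trans h'.2))]
  · intro j h
    simp only [Finset.mem_filter, Finset.mem_univ, true_and] at h
    obtain ⟨k, hk⟩ := exists_lower_rev (not_lt.2 h.1)
    rw [← hk, val_lower_rev] at h
    refine ⟨(j, k), ?_, rfl⟩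
    simp only [Finset.mem_filter, Finset.mem_univ, true_and, Fin.lt_def]
    exact ⟨by omega, hk.symm⟩

theorem numCross_eq_sum_right (h0 : ∀ i, π (π i) = i) (h1 : ∀ i, π i.rev = (π i).rev) :
    numCross n π = ∑ j : Fin n, if 2 * n - 1 < (π (lower j) : ℕ) + j then 1 else 0 := by
  rw [← Finset.card_filter]
  refine Finset.card_bij (fun x _ => x.2) ?_ ?_ ?_
  · rintro ⟨j, k⟩ h
    simp only [Finset.mem_filter, Finset.mem_univ, true_and, Fin.lt_def] at h ⊢
    have h2 : π (lower k) = (lower j).rev := by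
      rw [← Fin.rev_rev (lower k), h1, ← h.2, h0]
    rw [h2, val_lower_rev]
    omega
  · rintro ⟨j, k⟩ h ⟨j', k'⟩ h' hj
    simp only [Finset.mem_filter, Finset.mem_univ, true_and] at h h' hj
    subst hj
    rw [lower_inj.1 (π.injective (h.2.trans h'.2.symm))]
  · intro k h
    simp only [Finset.mem_filter, Finset.mem_univ, true_and] at h
    have hk := k.2
    obtain ⟨j, hj⟩ := exists_lower_rev (x := π (lower k)) (by omega)
    rw [← hj, val_lower_rev] at h
    refine ⟨(j, k), ?_, rfl⟩
    simp only [Finset.mem_filter, Finset.mem_univ, true_and, Fin.lt_def]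
    refine ⟨by omega, ?_⟩
    rw [← h0 (lower k), ← hj, ← h1, Fin.rev_rev]

/-- Each point of `{1, …, n}` is fixed, joined to its mirror image, or one of the two members of a
crossing or noncrossing pair. -/
theorem count_points (h0 : ∀ i, π (π i) = i) (h1 : ∀ i, π i.rev = (π i).rev) :
    n = numFix n π + numSelf n π + 2 * numCross n π + 2 * numArc n π := by
  have hn : n = ∑ _j : Fin n, 1 := by simp
  have e : numFix n π + numSelf n π + 2 * numCross n π + 2 * numArc n π =
      numFix n π + numSelf n π + numCross n π + numCross n π + numArc n π + numArc n π := by ring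
  rw [e]
  conv_rhs =>
    enter [1]; rw [numArc_eq_sum_left]
    enter [1, 2]; rw [numCross_eq_sum_right h0 h1]
  conv_rhs => rw [numArc_eq_sum_right h0]
  rw [numFix_eq_sum, numSelf_eq_sum, numCross_eq_sum_left, ← Finset.sum_add_distrib,
    ← Finset.sum_add_distrib, ← Finset.sum_add_distrib, ← Finset.sum_add_distrib,
    ← Finset.sum_add_distrib]
  conv_lhs => rw [hn]
  refine Finset.sum_congr rfl fun j _ => ?_
  have hj := j.2
  have hp := (π (lower j)).2
  split_ifs <;> omega

/-- A representative is the smallest element of its orbit: a fixed point, or the smaller member of a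
pair of either kind. -/
theorem card_orbitReps (n : ℕ) (π : Equiv.Perm (Fin (2 * n))) :
    (orbitReps n π).card = numFix n π + numCross n π + numArc n π := by
  rw [orbitReps, card_filter_lower, numFix_eq_sum, numCross_eq_sum_left, numArc_eq_sum_left,
    ← Finset.sum_add_distrib, ← Finset.sum_add_distrib]
  refine Finset.sum_congr rfl fun j _ => ?_
  have hj := j.2
  have hp := (π (lower j)).2
  have h1 := val_add_rev (π (lower j))
  simp only [Ne, Fin.ext_iff, Fin.le_def, val_lower, val_lower_rev]
  split_ifs <;> omega

/-- A closer in `{1, …, n}` has its partner there too, so it is the larger member of a noncrossing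
pair. -/
theorem card_nonClosers (h0 : ∀ i, π (π i) = i) :
    (nonClosers n π).card + numArc n π = n := by
  have hn : n = ∑ _j : Fin n, 1 := by simp
  rw [nonClosers, card_filter_lower, numArc_eq_sum_right h0, ← Finset.sum_add_distrib]
  conv_rhs => rw [hn]
  refine Finset.sum_congr rfl fun j _ => ?_
  simp only [Fin.lt_def, val_lower]
  split_ifs <;> omega

theorem numSelf_eq_zero (hπ : π ∈ Inv .closed n) : numSelf n π = 0 := by
  rw [numSelf, Finset.card_eq_zero, Finset.filter_eq_empty_iff]
  exact fun j _ => hπ.2.2 rfl _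

theorem zariskiDim_stratum {a : Boundary} (hn : 1 ≤ n) (hπ : π ∈ Inv a n) :
    zariskiDim (stratum a n π) = (chordDim a n π : ℕ) := by
  have : NeZero (2 * n) := ⟨by omega⟩
  obtain ⟨d, hd, h⟩ := zariskiDim_stratum_add hπ
  rw [hd]
  congr 2
  have h1 := count_points hπ.1 (Inv.apply_rev hπ)
  have h2 := card_orbitReps n π
  have h3 := card_nonClosers hπ.1
  cases a
  · rw [bsign, finrank_nilSym_neg_one] at h
    simp only [chordDim]
    omega
  · rw [bsign, finrank_nilSym_one] at h
    have h4 := numSelf_eq_zero hπ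
    simp only [chordDim]
    omega

/-! ### Link patterns -/

/-- The number of unpaired points of a link pattern. -/
def patternFix (a : Boundary) (n : ℕ) : ℕ :=
  match a with
  | .identified => 0
  | .closed => n % 2

/-- The value of the chord count if no points are fixed and no chords cross their mirror image. -/
def dimBound (a : Boundary) (n : ℕ) : ℕ :=
  match a with
  | .identified => n * (n + 1)
  | .closed => n ^ 2

/-- Eliminating the other counts through `count_points` leaves fixed points and crossing pairs as
the sole defect from the bound. -/
theorem chordDim_add {a : Boundary} (hπ : π ∈ Inv a n) :
    chordDim a n π + (numFix n π + numCross n π) = dimBound a n := by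
  have h1 := count_points hπ.1 (Inv.apply_rev hπ)
  cases a
  · simp only [chordDim, dimBound]
    rw [mul_add, mul_one, ← pow_two]
    omega
  · have h4 := numSelf_eq_zero hπ
    simp only [chordDim, dimBound]
    have h5 : n ^ 2 = n * (n - 1) + n := by
      cases n with
      | zero => rfl
      | succ k => rw [Nat.add_sub_cancel]; ring
    omega

theorem sq_mod_two (n : ℕ) : n ^ 2 % 2 = n % 2 := by
  rcases Nat.mod_two_eq_zero_or_one n with h | h <;> rw [Nat.pow_mod, h]

/-- In the closed case the number of fixed points has the parity of `n`, so for odd `n` the bound `n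
^ 2` drops by at least one; since `n ^ 2` and `n` have equal parity, this is `2 ⌊n² / 2⌋`. -/
theorem chordDim_le_maxDim {a : Boundary} (hπ : π ∈ Inv a n) : chordDim a n π ≤ maxDim a n := by
  have h1 := count_points hπ.1 (Inv.apply_rev hπ)
  have h2 := chordDim_add hπ
  have h3 := sq_mod_two n
  cases a
  · simp only [maxDim, dimBound] at h2 ⊢
    omega
  · have h4 := numSelf_eq_zero hπ
    simp only [maxDim, dimBound] at h2 ⊢
    omega

theorem maxDim_le_chordDim_iff {a : Boundary} (hπ : π ∈ Inv a n) :
    maxDim a n ≤ chordDim a n π ↔ numCross n π = 0 ∧ numFix n π = patternFix a n := by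
  have h1 := count_points hπ.1 (Inv.apply_rev hπ)
  have h2 := chordDim_add hπ
  have h3 := sq_mod_two n
  cases a
  · simp only [maxDim, dimBound, patternFix] at h2 ⊢
    omega
  · have h4 := numSelf_eq_zero hπ
    simp only [maxDim, dimBound, patternFix] at h2 ⊢
    omega

theorem periodicDiagram_lower (p : Fin n → Option (Fin n)) (j : Fin n) :
    periodicDiagram p (lower j) = match p j with
      | some k => lower k
      | none => (lower j).rev := by
  rw [periodicDiagram, dif_pos (show ((lower j : Fin (2 * n)) : ℕ) < n from j.2)]
  rfl

theorem periodicDiagram_lower_rev (p : Fin n → Option (Fin n)) (j : Fin n) :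
    periodicDiagram p (lower j).rev = (periodicDiagram p (lower j)).rev := by
  have hj := j.2
  rw [periodicDiagram_lower, periodicDiagram, dif_neg (by rw [val_lower_rev]; omega)]
  have h : (⟨(lower j).rev.rev, by rw [Fin.rev_rev]; exact j.2⟩ : Fin n) = j := by
    exact Fin.ext (Fin.ext_iff.1 (Fin.rev_rev (lower j)) :)
  rw [h]
  cases p j <;> rfl

theorem lower_ne_lower_rev (j k : Fin n) : lower j ≠ (lower k).rev := by
  intro h
  have h1 := congrArg Fin.val h
  rw [val_lower_rev, val_lower] at h1
  omega

theorem IsPatternInvolution.counts {a : Boundary} (h : IsPatternInvolution a n π) :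
    numCross n π = 0 ∧ numFix n π = patternFix a n := by
  obtain ⟨p, ⟨hp1, hp2⟩, hp⟩ := h
  have hfix : numFix n π = (Finset.univ.filter fun j => p j = some j).card := by
    rw [numFix]
    congr 1
    ext j
    rw [Finset.mem_filter, Finset.mem_filter, hp, periodicDiagram_lower]
    cases h1 : p j with
    | none => simp [(lower_ne_lower_rev j j).symm]
    | some k => simp [lower_inj]
  refine ⟨?_, ?_⟩
  · rw [numCross, Finset.card_eq_zero, Finset.filter_eq_empty_iff]
    rintro ⟨j, k⟩ - ⟨h1, h2⟩
    simp only at h1 h2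
    rw [hp, periodicDiagram_lower] at h2
    cases h3 : p j with
    | none =>
      rw [h3] at h2
      exact h1.ne (lower_inj.1 (Fin.rev_inj.1 h2))
    | some l =>
      rw [h3] at h2
      exact lower_ne_lower_rev _ _ h2
  · rw [hfix]
    cases a
    · rw [patternFix, Finset.card_eq_zero, Finset.filter_eq_empty_iff]
      exact fun j _ => hp2 j
    · exact hp2.2

/-- If `j` were joined to the mirror image of some `k ≠ j`, then `j` and `k` would form a crossing
pair. -/
theorem apply_lower_eq_rev (h0 : ∀ i, π (π i) = i) (h1 : ∀ i, π i.rev = (π i).rev)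
    (hc : numCross n π = 0) {j : Fin n} (hj : ¬ (π (lower j) : ℕ) < n) :
    π (lower j) = (lower j).rev := by
  rw [numCross, Finset.card_eq_zero, Finset.filter_eq_empty_iff] at hc
  obtain ⟨k, hk⟩ := exists_lower_rev hj
  rcases lt_trichotomy j k with h | h | h
  · exact absurd ⟨h, hk.symm⟩ (hc (Finset.mem_univ (j, k)))
  · rw [← hk, h]
  · refine absurd ⟨h, ?_⟩ (hc (Finset.mem_univ (k, j)))
    rw [← h0 (lower j), ← hk, ← h1, Fin.rev_rev]

theorem isPatternInvolution_iff {a : Boundary} (hπ : π ∈ Inv a n) :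
    IsPatternInvolution a n π ↔ numCross n π = 0 ∧ numFix n π = patternFix a n := by
  refine ⟨IsPatternInvolution.counts, fun ⟨hc, hf⟩ => ?_⟩
  have h1 := Inv.apply_rev hπ
  -- Chords inside `{1, …, n}` are kept, and every chord leaving it is read as a link to `b`; the
  -- absence of crossing pairs makes this faithful.
  set p : Fin n → Option (Fin n) := fun j =>
    if h : (π (lower j) : ℕ) < n then some ⟨π (lower j), h⟩ else none with hp
  have hsome : ∀ j k, p j = some k ↔ π (lower j) = lower k := by
    intro j k
    simp only [hp]
    by_cases h : (π (lower j) : ℕ) < n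
    · rw [dif_pos h, Option.some_inj, Fin.ext_iff, Fin.ext_iff]
      rfl
    · rw [dif_neg h]
      refine ⟨fun h2 => (Option.some_ne_none _ h2.symm).elim, fun h2 => absurd ?_ h⟩
      rw [h2]
      exact k.2
  have hnone : ∀ j, p j = none → π (lower j) = (lower j).rev := by
    intro j hj
    refine apply_lower_eq_rev hπ.1 h1 hc fun h => ?_
    simp only [hp, dif_pos h] at hj
    exact Option.some_ne_none _ hj
  have hlow : ∀ j, π (lower j) = periodicDiagram p (lower j) := by
    intro j
    rw [periodicDiagram_lower]
    cases hj : p j with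
    | none => exact hnone j hj
    | some k => exact (hsome j k).1 hj
  have hfix : numFix n π = (Finset.univ.filter fun j => p j = some j).card := by
    simp only [hsome]
    rfl
  refine ⟨p, ⟨fun j k h => ?_, ?_⟩, fun x => ?_⟩
  · rw [hsome] at h ⊢
    rw [← h, hπ.1]
  · cases a
    · rw [hfix, patternFix, Finset.card_eq_zero, Finset.filter_eq_empty_iff] at hf
      exact fun j => hf (Finset.mem_univ j)
    · exact ⟨fun j hj => hπ.2.2 rfl _ (hnone j hj), hfix ▸ hf⟩
  · by_cases hx : (x : ℕ) < n
    · obtain ⟨j, rfl⟩ := exists_lower hx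
      exact hlow j
    · obtain ⟨j, rfl⟩ := exists_lower_rev hx
      rw [h1, periodicDiagram_lower_rev, hlow]

theorem exists_isPatternInvolution {a : Boundary} {p : Fin n → Option (Fin n)}
    (hp : IsLinkPattern a n p) : ∃ π ∈ Inv a n, IsPatternInvolution a n π := by
  have hrev : ∀ x, periodicDiagram p x.rev = (periodicDiagram p x).rev := by
    intro x
    by_cases hx : (x : ℕ) < n
    · obtain ⟨j, rfl⟩ := exists_lower hx
      exact periodicDiagram_lower_rev p j
    · obtain ⟨j, rfl⟩ := exists_lower_rev hx
      rw [periodicDiagram_lower_rev, Fin.rev_rev, Fin.rev_rev]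
  have hlow : ∀ j, periodicDiagram p (periodicDiagram p (lower j)) = lower j := by
    intro j
    rw [periodicDiagram_lower]
    cases hj : p j with
    | none => simp only [periodicDiagram_lower_rev, periodicDiagram_lower, hj, Fin.rev_rev]
    | some k => simp only [periodicDiagram_lower, hp.1 j k hj]
  have hinv : Function.Involutive (periodicDiagram p) := by
    intro x
    by_cases hx : (x : ℕ) < n
    · obtain ⟨j, rfl⟩ := exists_lower hx
      exact hlow j
    · obtain ⟨j, rfl⟩ := exists_lower_rev hx
      rw [hrev, hrev, hlow]
  refine ⟨hinv.toPerm, ⟨hinv, fun i => ?_, ?_⟩, p, hp, fun _ => rfl⟩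
  · change periodicDiagram p i = (periodicDiagram p i.rev).rev
    rw [hrev, Fin.rev_rev]
  · rintro rfl i
    change periodicDiagram p i ≠ i.rev
    have key : ∀ j : Fin n, periodicDiagram p (lower j) ≠ (lower j).rev := by
      intro j
      rw [periodicDiagram_lower]
      cases hj : p j with
      | none => exact absurd hj (hp.2.1 j)
      | some k => exact lower_ne_lower_rev k j
    by_cases hx : (i : ℕ) < n
    · obtain ⟨j, rfl⟩ := exists_lower hx
      exact key j
    · obtain ⟨j, rfl⟩ := exists_lower_rev hx
      rw [hrev]
      exact fun h => key j (Fin.rev_inj.1 h)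

end

theorem exists_isLinkPattern (a : Boundary) (n : ℕ) :
    ∃ p : Fin n → Option (Fin n), IsLinkPattern a n p := by
  cases a
  · exact ⟨fun _ => none, fun _ _ h => (Option.some_ne_none _ h.symm).elim,
      fun _ h => Option.some_ne_none _ h.symm⟩
  -- Consecutive points are paired, starting from the first; for odd `n` the last one remains
  -- single.
  · have hlt : ∀ j : Fin n,
        (if (j : ℕ) % 2 = 1 then (j : ℕ) - 1 else if (j : ℕ) + 1 < n then j + 1 else j) < n := by
      intro j
      split_ifs <;> omega
    refine ⟨fun j => some ⟨_, hlt j⟩, fun j k h => ?_, fun j => Option.some_ne_none _, ?_⟩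
    · rw [Option.some_inj, Fin.ext_iff] at h ⊢
      simp only at h ⊢
      have := k.2
      rw [← h]
      split_ifs at h ⊢ <;> omega
    · simp only [Option.some_inj, Fin.ext_iff]
      rcases Nat.mod_two_eq_zero_or_one n with hn | hn
      · rw [hn, Finset.card_eq_zero, Finset.filter_eq_empty_iff]
        intro j _
        split_ifs <;> omega
      · rw [hn, Finset.card_eq_one]
        refine ⟨⟨n - 1, by omega⟩, ?_⟩
        ext j
        rw [Finset.mem_filter, Finset.mem_singleton, Fin.ext_iff]
        simp only [Finset.mem_univ, true_and]
        split_ifs <;> omega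

end BrauerLoop

theorem mainTheorem4 (a : Boundary) (n : ℕ) (hn : 1 ≤ n) :
    (∀ π ∈ BrauerLoop.Inv a n,
      BrauerLoop.zariskiDim (BrauerLoop.stratum a n π) = (BrauerLoop.chordDim a n π : ℕ)) ∧
    IsGreatest
      {d : WithBot ℕ∞ | ∃ π ∈ BrauerLoop.Inv a n,
        d = BrauerLoop.zariskiDim (BrauerLoop.stratum a n π)}
      (BrauerLoop.maxDim a n : ℕ) ∧
    (∀ π ∈ BrauerLoop.Inv a n,
      (∀ σ ∈ BrauerLoop.Inv a n,
        BrauerLoop.zariskiDim (BrauerLoop.stratum a n σ) ≤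
          BrauerLoop.zariskiDim (BrauerLoop.stratum a n π)) ↔
      BrauerLoop.IsPatternInvolution a n π) := by
  have hcast : ∀ x y : ℕ, ((x : ℕ) : WithBot ℕ∞) ≤ (y : ℕ) ↔ x ≤ y := fun x y => Nat.cast_le
  have hmax : ∀ π ∈ BrauerLoop.Inv a n, BrauerLoop.IsPatternInvolution a n π ↔
      BrauerLoop.maxDim a n ≤ BrauerLoop.chordDim a n π := fun π hπ =>
    (BrauerLoop.isPatternInvolution_iff hπ).trans (BrauerLoop.maxDim_le_chordDim_iff hπ).symm
  -- Some link pattern exists, so the bound is attained, and a stratum of maximal dimension among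
  -- all must reach it.
  obtain ⟨p, hp⟩ := BrauerLoop.exists_isLinkPattern a n
  obtain ⟨τ, hτ, hτp⟩ := BrauerLoop.exists_isPatternInvolution hp
  rw [hmax τ hτ] at hτp
  refine ⟨fun π hπ => BrauerLoop.zariskiDim_stratum hn hπ, ⟨⟨τ, hτ, ?_⟩, ?_⟩, fun π hπ => ?_⟩
  · rw [BrauerLoop.zariskiDim_stratum hn hτ,
      le_antisymm hτp (BrauerLoop.chordDim_le_maxDim hτ)]
  · rintro _ ⟨π, hπ, rfl⟩
    rw [BrauerLoop.zariskiDim_stratum hn hπ, hcast]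
    exact BrauerLoop.chordDim_le_maxDim hπ
  · rw [hmax π hπ, BrauerLoop.zariskiDim_stratum hn hπ]
    constructor
    · intro h
      have := h τ hτ
      rw [BrauerLoop.zariskiDim_stratum hn hτ, hcast] at this
      exact hτp.trans this
    · intro h σ hσ
      rw [BrauerLoop.zariskiDim_stratum hn hσ, hcast]
      exact (BrauerLoop.chordDim_le_maxDim hσ).trans h
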